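/- **Setting.** A program $\mathfrak P$ consists of finitely many (at least one) processes, each with a finite code, operating on finitely many shared variables; only finitely many data values occur. The instructions are register assignments, conditional and nondeterministic jumps, reads (racing, hazard-free, or acquire), writes (relaxed or release), atomic read-modify-writes (RMWs), full fences, lightweight synchronization, instruction synchronization, and membars. The program runs on the following executing machine. Each process has a program counter, registers, and a transaction buffer that holds speculated instructions in program order; reads are satisfied (from the buffer or from memory) and writes and lightweight fences are flushed out of order, as far as processor self-consistency, address, data and control dependencies, and fences allow; mispredicted instructions are discarded. Flushed writes go to a message propagation unit, which is either multi-copy-atomic (a flushed write immediately replaces the existing write to its location, for all processes) or causal: it maintains a finite partially ordered set of write messages and cumulative fence declarations, and records for each message which processes have seen it and for which processes it is redundant. Writes to a location are totally ordered; a new write is placed above all writes to its location and above the fences issued by its process; a fence is placed above all messages its process has seen and above its previous fences; a process reads from a message that it has seen and that is not redundant to it, which makes redundant to it every message $u$ with $u<v\le v_0$ for some message $v$ to the location of $u$, where $v_0$ is the message read; silent updates let a process see a message; writes redundant to all processes are deleted, as are fences with no write before them. An RMW is executed once everything before it has left the buffer, and is atomically a read from the last write to the location, a fence, and a write; a full fence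 is an RMW on a reserved location. A *control state* consists of the program counters and register values of all processes. The *initial configuration* has program counters at the start of the code, empty buffers, and value $0$ in all registers and in the single message of each location. A configuration is *plain* if all buffers are empty (the speculation tracker coincides with the program counter), the propagation unit (which satisfies its invariants) holds exactly one message per location, and all messages are seen by all processes. **Lemma.** The problem of control state reachability from a given plain configuration reduces to the problem of control state reachability from the initial configuration. Precisely: there is a computable map that takes a program $\mathfrak P$, a control state $c_0$ of $\mathfrak P$, an assignment $d$ of values to the variables of $\mathfrak P$, and a control state $c$ of $\mathfrak P$ to an augmented program $\mathfrak P'$ and a control state $c'$ of $\mathfrak P'$, with the following properties. 1. $\mathfrak P'$ depends on $\mathfrak P, c_0, d$ only. It is obtained from $\mathfrak P$ by adding shared variables and by putting a preamble in front of the (accordingly relocated) code of each process. The preambles use only register assignments, conditional jumps, and strong synchronization (RMWs and full fences). The control state $c'$ is $c$ with its program counters relocated. 2. Whether the propagation unit is multi-copy-atomic or causal, $\mathfrak P'$ can reach, from its initial configuration, a plain configuration in which the control state is $c_0$ relocated and the variables of $\mathfrak P$ have the values $d$. 3. Whether the propagation unit is multi-copy-atomic or causal, for every plain configuration $\gamma$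 of $\mathfrak P$ with control state $c_0$ and memory values $d$: the control state $c$ is reachable from $\gamma$ in $\mathfrak P$ if and only if $c'$ is reachable from the initial configuration in $\mathfrak P'$. -/

import Mathlib

/-! ## Programs

A program has finitely many processes, shared variables and values. Values are coded by natural
numbers and every operation on them is a finite table, so only finitely many values occur. -/

/-- An operation applied to registers: the tuple of the values of the registers `args` is looked up
in the finite table `table`; tuples that are not listed give `0`. -/
structure Expr where
  args : List ℕ
  table : List (List ℕ × ℕ)

/-- Value of an expression when some registers are still unknown (`none`). The value is known as
soon as all the registers that the expression depends on are known. -/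
def Expr.eval (e : Expr) (env : ℕ → Option ℕ) : Option ℕ :=
  (e.args.mapM env).map fun vs => (e.table.lookup vs).getD 0

/-- The constant expression. -/
def Expr.const (v : ℕ) : Expr := ⟨[], [([], v)]⟩

/-- Racing reads may be overtaken by reads of the same location, hazard-free ones may not;
acquire reads may not be overtaken by any transaction. -/
inductive ReadMode
  | racing | hazardFree | acquire

/-- Release writes may not overtake any transaction, nor be overtaken by acquire reads. -/
inductive WriteMode
  | relaxed | release

/-- Instructions of compiled code. Labels are positions in the code of the process. -/
inductive Instr
  /-- `r := e` -/
  | assign (r : ℕ) (e : Expr)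
  /-- jump to `target` if `e` is not `0`, otherwise fall through -/
  | branch (e : Expr) (target : ℕ)
  /-- nondeterministically jump to `target` or fall through -/
  | choose (target : ℕ)
  /-- `r := [addr]` -/
  | read (m : ReadMode) (r : ℕ) (addr : Expr)
  /-- `[addr] := e` -/
  | write (m : WriteMode) (addr e : Expr)
  /-- atomically `r := [addr]; [addr] := e`, where `e` may use the new content of `r` -/
  | rmw (r : ℕ) (addr e : Expr)
  | fullFence
  /-- lightweight (cumulative) synchronization -/
  | lwsync
  /-- instruction synchronization -/
  | isync
  /-- memory barrier; the four flags order, in turn, earlier reads before later reads, earlier reads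
  before later writes, earlier writes before later reads, earlier writes before later writes -/
  | membar (rr rw wr ww : Bool)

/-- A program: the number of its shared variables `0, …, vars - 1`, and the code of each process. -/
structure Program where
  vars : ℕ
  procs : List (List Instr)

/-! Codings of programs as natural numbers, through sums and products. -/

def exprEquiv : Expr ≃ List ℕ × List (List ℕ × ℕ) where
  toFun e := (e.args, e.table)
  invFun x := ⟨x.1, x.2⟩
  left_inv _ := rfl
  right_inv _ := rfl

instance : Primcodable Expr := Primcodable.ofEquiv _ exprEquiv

def readModeEquiv : ReadMode ≃ Unit ⊕ Unit ⊕ Unit where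
  toFun
    | .racing => .inl ()
    | .hazardFree => .inr (.inl ())
    | .acquire => .inr (.inr ())
  invFun
    | .inl _ => .racing
    | .inr (.inl _) => .hazardFree
    | .inr (.inr _) => .acquire
  left_inv m := by cases m <;> rfl
  right_inv x := by rcases x with _ | _ | _ <;> rfl

instance : Primcodable ReadMode := Primcodable.ofEquiv _ readModeEquiv

def writeModeEquiv : WriteMode ≃ Unit ⊕ Unit where
  toFun
    | .relaxed => .inl ()
    | .release => .inr ()
  invFun
    | .inl _ => .relaxed
    | .inr _ => .release
  left_inv m := by cases m <;> rfl
  right_inv x := by rcases x with _ | _ <;> rfl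

instance : Primcodable WriteMode := Primcodable.ofEquiv _ writeModeEquiv

def instrEquiv : Instr ≃
    (ℕ × Expr) ⊕ (Expr × ℕ) ⊕ ℕ ⊕ (ReadMode × ℕ × Expr) ⊕ (WriteMode × Expr × Expr) ⊕
      (ℕ × Expr × Expr) ⊕ Unit ⊕ Unit ⊕ Unit ⊕ (Bool × Bool × Bool × Bool) where
  toFun
    | .assign r e => .inl (r, e)
    | .branch e t => .inr (.inl (e, t))
    | .choose t => .inr (.inr (.inl t))
    | .read m r a => .inr (.inr (.inr (.inl (m, r, a))))
    | .write m a e => .inr (.inr (.inr (.inr (.inl (m, a, e)))))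
    | .rmw r a e => .inr (.inr (.inr (.inr (.inr (.inl (r, a, e))))))
    | .fullFence => .inr (.inr (.inr (.inr (.inr (.inr (.inl ()))))))
    | .lwsync => .inr (.inr (.inr (.inr (.inr (.inr (.inr (.inl ())))))))
    | .isync => .inr (.inr (.inr (.inr (.inr (.inr (.inr (.inr (.inl ()))))))))
    | .membar a b c d => .inr (.inr (.inr (.inr (.inr (.inr (.inr (.inr (.inr (a, b, c, d)))))))))
  invFun
    | .inl (r, e) => .assign r e
    | .inr (.inl (e, t)) => .branch e t
    | .inr (.inr (.inl t)) => .choose t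
    | .inr (.inr (.inr (.inl (m, r, a)))) => .read m r a
    | .inr (.inr (.inr (.inr (.inl (m, a, e))))) => .write m a e
    | .inr (.inr (.inr (.inr (.inr (.inl (r, a, e)))))) => .rmw r a e
    | .inr (.inr (.inr (.inr (.inr (.inr (.inl _)))))) => .fullFence
    | .inr (.inr (.inr (.inr (.inr (.inr (.inr (.inl _))))))) => .lwsync
    | .inr (.inr (.inr (.inr (.inr (.inr (.inr (.inr (.inl _)))))))) => .isync
    | .inr (.inr (.inr (.inr (.inr (.inr (.inr (.inr (.inr (a, b, c, d))))))))) => .membar a b c d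
  left_inv i := by cases i <;> rfl
  right_inv x := by
    rcases x with _ | _ | _ | _ | _ | _ | _ | _ | _ | _ <;> rfl

instance : Primcodable Instr := Primcodable.ofEquiv _ instrEquiv

def programEquiv : Program ≃ ℕ × List (List Instr) where
  toFun P := (P.vars, P.procs)
  invFun x := ⟨x.1, x.2⟩
  left_inv _ := rfl
  right_inv _ := rfl

instance : Primcodable Program := Primcodable.ofEquiv _ programEquiv

/-- Every value of the address expression is one of the variables `0, …, N - 1`. -/
def Expr.IsAddress (N : ℕ) (e : Expr) : Prop := 0 < N ∧ ∀ row ∈ e.table, row.2 < N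

def Instr.AddressesIn (N : ℕ) : Instr → Prop
  | .read _ _ a => a.IsAddress N
  | .write _ a _ => a.IsAddress N
  | .rmw _ a _ => a.IsAddress N
  | _ => True

/-- There is at least one process, and only declared variables are accessed. -/
def Program.WellFormed (P : Program) : Prop :=
  P.procs ≠ [] ∧ ∀ code ∈ P.procs, ∀ ins ∈ code, ins.AddressesIn P.vars

/-- The code of process `p`. -/
def Program.code (P : Program) (p : ℕ) : List Instr := P.procs.getD p []

/-- The labels at which execution may continue after `ins` at label `l`. -/
def Instr.successors (ins : Instr) (l : ℕ) : Set ℕ :=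
  match ins with
  | .branch _ t => {l + 1, t}
  | .choose t => {l + 1, t}
  | _ => {l + 1}

/-! ## Transaction buffers -/

/-- A speculated instruction in the buffer: its label, the label speculated to follow it, and
`done`, which is `none` while the transaction is active. For a satisfied read it is the value
read; for a flushed write or fence its content is immaterial. -/
structure Entry where
  label : ℕ
  ins : Instr
  next : ℕ
  done : Option ℕ

/-- Effect of an entry on the (partially known) registers. -/
def Entry.effect (env : ℕ → Option ℕ) (e : Entry) : ℕ → Option ℕ :=
  match e.ins with
  | .assign r ex => Function.update env r (ex.eval env)
  | .read _ r _ => Function.update env r e.done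
  | .rmw r _ _ => Function.update env r none
  | _ => env

/-- The registers after the entries of `l`, as far as they are resolved. -/
def envAfter (reg : ℕ → ℕ) (l : List Entry) : ℕ → Option ℕ :=
  l.foldl Entry.effect (fun r => some (reg r))

/-- Discard everything that follows a branch that is resolved and was mispredicted, and
redirect speculation to the right label. -/
def settle (env : ℕ → Option ℕ) : List Entry → List Entry
  | [] => []
  | e :: l =>
    match e.ins with
    | .branch c t =>
      match c.eval env with
      | none => e :: settle env l
      | some b =>
        if e.next = (if b = 0 then e.label + 1 else t) then e :: settle env l
        else [{ e with next := if b = 0 then e.label + 1 else t }]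
    | _ => e :: settle (e.effect env) l

/-- Local state of a process. The buffer is `past ++ spec` in program order: `past` has been
crossed by the program counter, `spec` lies between the program counter and the speculation
tracker. -/
structure Proc where
  pc : ℕ
  reg : ℕ → ℕ
  past : List Entry
  spec : List Entry

/-- The speculation tracker. -/
def Proc.tracker (q : Proc) : ℕ := (q.spec.getLast?.map Entry.next).getD q.pc

def Proc.settled (q : Proc) : Proc := { q with spec := settle (fun r => some (q.reg r)) q.spec }

/-- The address `a`, evaluated after the entries `l`, is resolved and is not `x`. -/
def Differs (reg : ℕ → ℕ) (l : List Entry) (a : Expr) (x : ℕ) : Prop :=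
  ∃ y, a.eval (envAfter reg l) = some y ∧ y ≠ x

def ReadsDone (l : List Entry) : Prop :=
  ∀ e ∈ l, ∀ m r a, e.ins = .read m r a → e.done ≠ none

def WritesDone (l : List Entry) : Prop :=
  ∀ e ∈ l, ∀ m a v, e.ins = .write m a v → e.done ≠ none

/-- A read of mode `m` from `x` may overtake the entry `f`, which `l` precedes in the buffer.
Earlier writes to the same location are dealt with by `NoLocalWrite` and `LocalValue`. -/
def ReadPasses (reg : ℕ → ℕ) (m : ReadMode) (x : ℕ) (l : List Entry) (f : Entry) : Prop :=
  match f.ins with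
  | .read m' _ a => f.done ≠ none ∨ m' = .racing ∨ (m' = .hazardFree ∧ Differs reg l a x)
  | .write m' _ _ => f.done ≠ none ∨ ¬ (m' = .release ∧ m = .acquire)
  | .rmw _ _ _ => False
  | .fullFence => False
  | .isync => False
  | .lwsync => f.done ≠ none ∨ ReadsDone l
  | .membar rr _ wr _ => (rr = true → ReadsDone l) ∧ (wr = true → WritesDone l)
  | _ => True

/-- A resolved write of mode `m` to `x` may be flushed ahead of the entry `f`, which `l` precedes
in the buffer. -/
def WritePasses (reg : ℕ → ℕ) (m : WriteMode) (x : ℕ) (l : List Entry) (f : Entry) : Prop :=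
  match f.ins with
  | .read m' _ a => f.done ≠ none ∨ (m' ≠ .acquire ∧ m ≠ .release ∧ Differs reg l a x)
  | .write _ a _ => f.done ≠ none ∨ (m ≠ .release ∧ Differs reg l a x)
  | .rmw _ _ _ => False
  | .fullFence => False
  | .isync => False
  | .lwsync => f.done ≠ none
  | .membar _ rw _ ww => (rw = true → ReadsDone l) ∧ (ww = true → WritesDone l)
  | .branch c _ => c.eval (envAfter reg l) ≠ none
  | _ => True

/-- A lightweight fence may be flushed ahead of the entry `f` that `l` precedes: `f` is not an
active transaction, and if it is a branch, it is resolved. -/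
def FencePasses (reg : ℕ → ℕ) (l : List Entry) (f : Entry) : Prop :=
  match f.ins with
  | .read _ _ _ => f.done ≠ none
  | .write _ _ _ => f.done ≠ none
  | .lwsync => f.done ≠ none
  | .rmw _ _ _ => False
  | .fullFence => False
  | .isync => False
  | .branch c _ => c.eval (envAfter reg l) ≠ none
  | _ => True

/-- `R l f` for every entry `f` of `pre`, `l` being what precedes `f`. -/
def PassesAll (R : List Entry → Entry → Prop) (pre : List Entry) : Prop :=
  ∀ l f l', pre = l ++ f :: l' → R l f

/-- After the entries `base`, no entry of `l` is an unflushed write that might be to `x`. -/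
def NoLocalWrite (reg : ℕ → ℕ) (x : ℕ) (base l : List Entry) : Prop :=
  ∀ k f k' m a v, l = k ++ f :: k' → f.ins = .write m a v → f.done = none →
    Differs reg (base ++ k) a x

/-- The most recent write to `x` in `pre` is still unflushed, and its resolved value is `v`. -/
def LocalValue (reg : ℕ → ℕ) (x v : ℕ) (pre : List Entry) : Prop :=
  ∃ l w l' m a e, pre = l ++ w :: l' ∧ w.ins = .write m a e ∧ w.done = none ∧
    a.eval (envAfter reg l) = some x ∧ e.eval (envAfter reg l) = some v ∧
    NoLocalWrite reg x (l ++ [w]) l'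

/-- The active entry `e`, preceded in the buffer by `pre`, is flushed. It leaves the
buffer if the program counter has crossed it, and becomes passive otherwise. -/
inductive Proc.Flush (q : Proc) : List Entry → Entry → Proc → Prop
  | crossed (l : List Entry) (e : Entry) (l' : List Entry) (h : q.past = l ++ e :: l')
      (ha : e.done = none) : Proc.Flush q l e { q with past := l ++ l' }
  | uncrossed (l : List Entry) (e : Entry) (l' : List Entry) (h : q.spec = l ++ e :: l')
      (ha : e.done = none) :
      Proc.Flush q (q.past ++ l) e { q with spec := l ++ { e with done := some 0 } :: l' }

/-- The program counter crosses the first entry of `spec`. Reads must be satisfied. Unflushed writes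
(with address and value now fixed) and fences stay in the buffer. -/
inductive Proc.Cross (q : Proc) : Proc → Prop
  | assign (e : Entry) (l : List Entry) (r : ℕ) (ex : Expr) (v : ℕ) (h : q.spec = e :: l)
      (hi : e.ins = .assign r ex) (hv : ex.eval (fun s => some (q.reg s)) = some v) :
      Proc.Cross q ⟨e.next, Function.update q.reg r v, q.past, l⟩
  | branch (e : Entry) (l : List Entry) (c : Expr) (t : ℕ) (h : q.spec = e :: l)
      (hi : e.ins = .branch c t) : Proc.Cross q ⟨e.next, q.reg, q.past, l⟩
  | choose (e : Entry) (l : List Entry) (t : ℕ) (h : q.spec = e :: l)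
      (hi : e.ins = .choose t) : Proc.Cross q ⟨e.next, q.reg, q.past, l⟩
  | read (e : Entry) (l : List Entry) (m : ReadMode) (r : ℕ) (a : Expr) (v : ℕ)
      (h : q.spec = e :: l) (hi : e.ins = .read m r a) (hv : e.done = some v) :
      Proc.Cross q ⟨e.next, Function.update q.reg r v, q.past, l⟩
  | flushed (e : Entry) (l : List Entry) (h : q.spec = e :: l)
      (hi : (∃ m a ex, e.ins = .write m a ex) ∨ e.ins = .lwsync) (hd : e.done ≠ none) :
      Proc.Cross q ⟨e.next, q.reg, q.past, l⟩
  | write (e : Entry) (l : List Entry) (m : WriteMode) (a ex : Expr) (x v : ℕ)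
      (h : q.spec = e :: l) (hi : e.ins = .write m a ex) (hd : e.done = none)
      (hx : a.eval (fun s => some (q.reg s)) = some x)
      (hv : ex.eval (fun s => some (q.reg s)) = some v) :
      Proc.Cross q ⟨e.next, q.reg,
        q.past ++ [{ e with ins := .write m (.const x) (.const v) }], l⟩
  | lwsync (e : Entry) (l : List Entry) (h : q.spec = e :: l)
      (hi : e.ins = .lwsync) (hd : e.done = none) :
      Proc.Cross q ⟨e.next, q.reg, q.past ++ [e], l⟩
  | isync (e : Entry) (l : List Entry) (h : q.spec = e :: l)
      (hi : e.ins = .isync) : Proc.Cross q ⟨e.next, q.reg, q.past, l⟩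
  | membar (e : Entry) (l : List Entry) (rr rw wr ww : Bool) (h : q.spec = e :: l)
      (hi : e.ins = .membar rr rw wr ww) :
      Proc.Cross q ⟨e.next, q.reg, q.past ++ [e], l⟩

/-! ## Message propagation unit -/

/-- In a multi-copy-atomic model a flushed write at once replaces, for all processes, the existing
write. In a causal model, propagation respects a partial order. -/
inductive Propagation
  | multiCopyAtomic | causal

/-- The location `some x` is the variable `x`; `none` is a location that programs cannot name and
that serves to implement full fences. -/
abbrev Loc := Option ℕ

/-- A write message. `source`: it can still be the source of a read-modify-write. `seen`: the
processes that have seen it. `redundant`: the processes for which it is redundant. -/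
structure Msg where
  loc : Loc
  val : ℕ
  source : Bool
  seen : Set ℕ
  redundant : Set ℕ

/-- State of the propagation unit: identifiers of its write messages and fence declarations, their
contents, and the order "ordered before". Only the identifiers in `writes` and `fences` matter. -/
structure Mem where
  writes : Finset ℕ
  fences : Finset ℕ
  msg : ℕ → Msg
  issuer : ℕ → ℕ
  lt : ℕ → ℕ → Prop

namespace Mem

def le (m : Mem) (i j : ℕ) : Prop := i = j ∨ m.lt i j

def ids (m : Mem) : Finset ℕ := m.writes ∪ m.fences

def fresh (m : Mem) : ℕ := m.ids.sup id + 1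

open scoped Classical in
/-- Garbage collection in a system of `n` processes. -/
noncomputable def gc (n : ℕ) (m : Mem) : Mem :=
  { m with
    writes := m.writes.filter fun i => ∃ p < n, p ∉ (m.msg i).redundant
    fences := m.fences.filter fun f =>
      ∃ v ∈ m.writes, (∃ p < n, p ∉ (m.msg v).redundant) ∧ m.lt v f }

open scoped Classical in
/-- Mark the messages in `S` as redundant to the processes in `A`. -/
noncomputable def mark (A S : Set ℕ) (m : Mem) : Mem :=
  { m with
    msg := fun i =>
      if i ∈ S then { m.msg i with redundant := (m.msg i).redundant ∪ A } else m.msg i }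

/-- The process `p` can satisfy a read from `x` with the message `v`. -/
def Readable (m : Mem) (p : ℕ) (x : Loc) (v : ℕ) : Prop :=
  v ∈ m.writes ∧ (m.msg v).loc = x ∧ p ∈ (m.msg v).seen ∧ p ∉ (m.msg v).redundant

/-- Effect of a read by `p` from the message `v₀`. -/
noncomputable def read (n p v₀ : ℕ) (m : Mem) : Mem :=
  gc n (m.mark {p} {u | u ∈ m.writes ∧
    ∃ v ∈ m.writes, (m.msg u).loc = (m.msg v).loc ∧ m.lt u v ∧ m.le v v₀})

/-- Silent update: `p` sees the message `v`. -/
noncomputable def update (n p v : ℕ) (m : Mem) : Mem :=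
  let m' := m.mark {p} {u | u ∈ m.writes ∧ (m.msg u).loc = (m.msg v).loc ∧ m.lt u v}
  gc n { m' with
    msg := Function.update m'.msg v { m'.msg v with seen := insert p (m'.msg v).seen } }

/-- The order after inserting the fresh element `i` above the downward closure of `S`. -/
def insertLt (m : Mem) (i : ℕ) (S : Set ℕ) (a b : ℕ) : Prop :=
  (b = i ∧ a ∈ m.ids ∧ ∃ t ∈ m.ids, t ∈ S ∧ m.le a t) ∨ (a ≠ i ∧ b ≠ i ∧ m.lt a b)

/-- The process `p` issues a cumulative fence. Multi-copy-atomic models need no bookkeeping. -/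
def fence (M : Propagation) (p : ℕ) (m : Mem) : Mem :=
  match M with
  | .multiCopyAtomic => m
  | .causal =>
    { m with
      fences := insert m.fresh m.fences
      issuer := Function.update m.issuer m.fresh p
      lt := m.insertLt m.fresh {t | (t ∈ m.writes ∧ p ∈ (m.msg t).seen) ∨
        (t ∈ m.fences ∧ m.issuer t = p)} }

/-- The process `p` writes `v` to `x`. The new message is placed above all the writes to `x` and
above the fences issued by `p`. These form a chain, so this is the same as being above
the latest of them. -/
noncomputable def write (M : Propagation) (n p : ℕ) (x : Loc) (v : ℕ) (m : Mem) : Mem :=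
  let everyone : Set ℕ := match M with
    | .multiCopyAtomic => {q | q < n}
    | .causal => {p}
  let m' := m.mark everyone {u | u ∈ m.writes ∧ (m.msg u).loc = x}
  gc n { m' with
    writes := insert m.fresh m.writes
    msg := Function.update m'.msg m.fresh ⟨x, v, true, everyone, ∅⟩
    lt := m.insertLt m.fresh {t | (t ∈ m.writes ∧ (m.msg t).loc = x) ∨
      (t ∈ m.fences ∧ m.issuer t = p)} }

/-- A read-modify-write by `p` can use `v` as its source: `p` can read it, it is eligible,
and it is the last of the writes to `x`. -/
def RmwReadable (m : Mem) (p : ℕ) (x : Loc) (v : ℕ) : Prop :=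
  m.Readable p x v ∧ (m.msg v).source = true ∧
    ∀ u ∈ m.writes, (m.msg u).loc = x → ¬ m.lt v u

def consume (v : ℕ) (m : Mem) : Mem :=
  { m with msg := Function.update m.msg v { m.msg v with source := false } }

/-- Read-modify-write by `p` on `x`, from the message `v₀`: a read, a fence and a
write, and `v₀` can no longer be the source of a read-modify-write. -/
noncomputable def rmw (M : Propagation) (n p : ℕ) (x : Loc) (v₀ v : ℕ) (m : Mem) : Mem :=
  (((m.read n p v₀).fence M p).consume v₀).write M n p x v

end Mem

/-! ## The executing machine -/

/-- A configuration; `proc p` matters for the processes `p` of the program only. -/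
structure Config where
  proc : ℕ → Proc
  mem : Mem

def Config.set (γ : Config) (p : ℕ) (q : Proc) (m : Mem) : Config :=
  ⟨Function.update γ.proc p q, m⟩

/-- The transitions of the executing machine. -/
inductive Step (M : Propagation) (P : Program) (γ : Config) : Config → Prop
  /-- the speculation tracker crosses an instruction and adds it to the buffer -/
  | fetch (p : ℕ) (hp : p < P.procs.length) (ins : Instr) (l : ℕ)
      (hi : (P.code p)[(γ.proc p).tracker]? = some ins)
      (hl : l ∈ ins.successors (γ.proc p).tracker) :
      Step M P γ (γ.set p (Proc.settled { γ.proc p with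
        spec := (γ.proc p).spec ++ [⟨(γ.proc p).tracker, ins, l, none⟩] }) γ.mem)
  /-- the program counter advances -/
  | cross (p : ℕ) (hp : p < P.procs.length) (q : Proc) (hq : (γ.proc p).Cross q) :
      Step M P γ (γ.set p q.settled γ.mem)
  /-- a read is satisfied by a write in the buffer -/
  | readLocal (p : ℕ) (hp : p < P.procs.length) (l l' : List Entry) (e : Entry)
      (m : ReadMode) (r : ℕ) (a : Expr) (x v : ℕ)
      (hs : (γ.proc p).spec = l ++ e :: l') (hi : e.ins = .read m r a) (hd : e.done = none)
      (hx : a.eval (envAfter (γ.proc p).reg ((γ.proc p).past ++ l)) = some x)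
      (hpass : PassesAll (ReadPasses (γ.proc p).reg m x) ((γ.proc p).past ++ l))
      (hv : LocalValue (γ.proc p).reg x v ((γ.proc p).past ++ l)) :
      Step M P γ (γ.set p (Proc.settled { γ.proc p with
        spec := l ++ { e with done := some v } :: l' }) γ.mem)
  /-- a read is satisfied by the propagation unit -/
  | readMemory (p : ℕ) (hp : p < P.procs.length) (l l' : List Entry) (e : Entry)
      (m : ReadMode) (r : ℕ) (a : Expr) (x v₀ : ℕ)
      (hs : (γ.proc p).spec = l ++ e :: l') (hi : e.ins = .read m r a) (hd : e.done = none)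
      (hx : a.eval (envAfter (γ.proc p).reg ((γ.proc p).past ++ l)) = some x)
      (hpass : PassesAll (ReadPasses (γ.proc p).reg m x) ((γ.proc p).past ++ l))
      (hloc : NoLocalWrite (γ.proc p).reg x [] ((γ.proc p).past ++ l))
      (hv : γ.mem.Readable p (some x) v₀) :
      Step M P γ (γ.set p (Proc.settled { γ.proc p with
        spec := l ++ { e with done := some (γ.mem.msg v₀).val } :: l' })
        (γ.mem.read P.procs.length p v₀))
  /-- a write is flushed to the propagation unit -/
  | flushWrite (p : ℕ) (hp : p < P.procs.length) (pre : List Entry) (e : Entry) (q : Proc)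
      (m : WriteMode) (a ex : Expr) (x v : ℕ)
      (hq : (γ.proc p).Flush pre e q) (hi : e.ins = .write m a ex)
      (hx : a.eval (envAfter (γ.proc p).reg pre) = some x)
      (hv : ex.eval (envAfter (γ.proc p).reg pre) = some v)
      (hpass : PassesAll (WritePasses (γ.proc p).reg m x) pre) :
      Step M P γ (γ.set p q (γ.mem.write M P.procs.length p (some x) v))
  /-- a lightweight fence is flushed to the propagation unit -/
  | flushFence (p : ℕ) (hp : p < P.procs.length) (pre : List Entry) (e : Entry) (q : Proc)
      (hq : (γ.proc p).Flush pre e q) (hi : e.ins = .lwsync)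
      (hpass : PassesAll (FencePasses (γ.proc p).reg) pre) :
      Step M P γ (γ.set p q (γ.mem.fence M p))
  /-- a barrier that nothing precedes leaves the buffer -/
  | dropBarrier (p : ℕ) (hp : p < P.procs.length) (e : Entry) (l : List Entry)
      (rr rw wr ww : Bool) (h : (γ.proc p).past = e :: l) (hi : e.ins = .membar rr rw wr ww) :
      Step M P γ (γ.set p { γ.proc p with past := l } γ.mem)
  /-- a read-modify-write is executed, when everything before it has left the buffer -/
  | rmw (p : ℕ) (hp : p < P.procs.length) (e : Entry) (l : List Entry)
      (r : ℕ) (a ex : Expr) (x v₀ v : ℕ)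
      (hpast : (γ.proc p).past = []) (hs : (γ.proc p).spec = e :: l) (hi : e.ins = .rmw r a ex)
      (hx : a.eval (fun s => some ((γ.proc p).reg s)) = some x)
      (h₀ : γ.mem.RmwReadable p (some x) v₀)
      (hv : ex.eval (fun s => some (Function.update (γ.proc p).reg r (γ.mem.msg v₀).val s))
        = some v) :
      Step M P γ (γ.set p
        (Proc.settled ⟨e.next, Function.update (γ.proc p).reg r (γ.mem.msg v₀).val, [], l⟩)
        (γ.mem.rmw M P.procs.length p (some x) v₀ v))
  /-- a full fence is executed, as a read-modify-write on the reserved location -/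
  | fullFence (p : ℕ) (hp : p < P.procs.length) (e : Entry) (l : List Entry) (v₀ : ℕ)
      (hpast : (γ.proc p).past = []) (hs : (γ.proc p).spec = e :: l) (hi : e.ins = .fullFence)
      (h₀ : γ.mem.RmwReadable p none v₀) :
      Step M P γ (γ.set p (Proc.settled ⟨e.next, (γ.proc p).reg, [], l⟩)
        (γ.mem.rmw M P.procs.length p none v₀ 0))
  /-- silent update -/
  | update (p : ℕ) (hp : p < P.procs.length) (v : ℕ) (hv : v ∈ γ.mem.writes)
      (hr : p ∉ (γ.mem.msg v).redundant) :
      Step M P γ ⟨γ.proc, γ.mem.update P.procs.length p v⟩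

/-- The locations of a program: its variables and the reserved location. -/
def Program.IsLoc (P : Program) (x : Loc) : Prop := ∀ y, x = some y → y < P.vars

/-- The initial configuration: all processes are at label `0` with empty buffers, all registers and
locations hold `0`, and the initial write to every location is seen by everyone. -/
def initial (P : Program) : Config where
  proc _ := ⟨0, fun _ => 0, [], []⟩
  mem :=
    { writes := Finset.range (P.vars + 1)
      fences := ∅
      msg := fun i =>
        ⟨if i = 0 then none else some (i - 1), 0, true, {q | q < P.procs.length}, ∅⟩
      issuer := fun _ => 0
      lt := fun _ _ => False }

/-- Invariants of the propagation unit. -/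
structure Mem.Invariants (P : Program) (m : Mem) : Prop where
  disjoint : Disjoint m.writes m.fences
  irrefl : ∀ i ∈ m.ids, ¬ m.lt i i
  trans : ∀ i ∈ m.ids, ∀ j ∈ m.ids, ∀ k ∈ m.ids, m.lt i j → m.lt j k → m.lt i k
  locations : ∀ v ∈ m.writes, P.IsLoc (m.msg v).loc
  issuers : ∀ f ∈ m.fences, m.issuer f < P.procs.length
  enabledRead : ∀ p < P.procs.length, ∀ x, P.IsLoc x →
    ∃ v ∈ m.writes, (m.msg v).loc = x ∧ (m.msg v).source = true ∧ p ∉ (m.msg v).redundant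
  coherence : ∀ u ∈ m.writes, ∀ v ∈ m.writes, (m.msg u).loc = (m.msg v).loc →
    m.lt u v ∨ u = v ∨ m.lt v u
  causalPropagation : ∀ p < P.procs.length, ∀ u ∈ m.writes, ∀ v ∈ m.writes,
    (m.msg u).loc = (m.msg v).loc → m.lt u v → p ∈ (m.msg v).redundant → p ∈ (m.msg u).redundant
  coherentObservation : ∀ p < P.procs.length, ∀ u ∈ m.writes, ∀ v ∈ m.writes,
    (m.msg u).loc = (m.msg v).loc → p ∉ (m.msg u).redundant → p ∉ (m.msg v).redundant →
    p ∈ (m.msg v).seen → ¬ m.lt u v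
  noGarbageWrite : ∀ v ∈ m.writes, ∃ p < P.procs.length, p ∉ (m.msg v).redundant
  noGarbageFence : ∀ f ∈ m.fences, ∃ v ∈ m.writes, m.lt v f

/-- Plain configurations: empty buffers, exactly one message per location, and all messages
are seen by all processes. -/
structure Config.IsPlain (P : Program) (γ : Config) : Prop where
  invariants : γ.mem.Invariants P
  buffers : ∀ p < P.procs.length, (γ.proc p).past = [] ∧ (γ.proc p).spec = []
  oneMessage : ∀ x, P.IsLoc x → ∃! v, v ∈ γ.mem.writes ∧ (γ.mem.msg v).loc = x
  seen : ∀ v ∈ γ.mem.writes, ∀ p < P.procs.length, p ∈ (γ.mem.msg v).seen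

/-! ## Control state reachability -/

/-- A control state: for each process, the program counter and the contents of the registers
`0, 1, …`; registers that are not listed hold `0`. -/
abbrev ControlState := List (ℕ × List ℕ)

/-- The control state of `γ` is `s`. -/
def Config.HasControl (γ : Config) (s : ControlState) : Prop :=
  ∀ p (h : p < s.length), (γ.proc p).pc = s[p].1 ∧ ∀ r, (γ.proc p).reg r = s[p].2.getD r 0

/-- The messages to the variables `0, 1, …` in `γ` carry the values listed in `vals`. -/
def Config.HasValues (γ : Config) (vals : List ℕ) : Prop :=
  ∀ x (h : x < vals.length), ∀ v ∈ γ.mem.writes, (γ.mem.msg v).loc = some x →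
    (γ.mem.msg v).val = vals[x]

/-- The control state `c` is reachable from the configuration `γ`. -/
def ControlReachableFrom (M : Propagation) (P : Program) (γ : Config) (c : ControlState) : Prop :=
  ∃ γ', Relation.ReflTransGen (Step M P) γ γ' ∧ γ'.HasControl c

/-- The control state `c` is reachable (from the initial configuration). -/
def ControlReachable (M : Propagation) (P : Program) (c : ControlState) : Prop :=
  ControlReachableFrom M P (initial P) c

/-! ## Augmented programs -/

/-- Relocate an instruction by `k` labels. -/
def Instr.shift (k : ℕ) : Instr → Instr
  | .branch e t => .branch e (t + k)
  | .choose t => .choose (t + k)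
  | i => i

/-- Add `extra.1` fresh variables, and put the preambles `extra.2` in front of the processes. -/
def Program.augment (P : Program) (extra : ℕ × List (List Instr)) : Program where
  vars := P.vars + extra.1
  procs := List.zipWith (fun pre code => pre ++ code.map (Instr.shift pre.length)) extra.2 P.procs

/-- The control state of the augmented program that corresponds to the control state `c`. -/
def ControlState.augment (c : ControlState) (extra : ℕ × List (List Instr)) : ControlState :=
  List.zipWith (fun pre s => (s.1 + pre.length, s.2)) extra.2 c

/-- Local computation and strong synchronization: the only memory instructions are
read-modify-writes and full fences. -/
def Instr.IsStrong : Instr → Prop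
  | .assign _ _ => True
  | .branch _ _ => True
  | .rmw _ _ _ => True
  | .fullFence => True
  | _ => False

/-! The augmented program has one fresh variable, the flag. The preamble of process `0` stores the
prescribed values by read-modify-writes (RMWs) and then sets the flag to `1`. Every other process
spins on an RMW of the flag until it reads `1`. All processes then assign constants to their
registers and jump to their label in `c₀`. Part 2 is obtained by running the preambles one after the
other and then performing silent updates until every process has seen the last message to each
location; coherent observation makes all other messages garbage.

Both directions of part 3 are simulations. A transition factors into a step of one process
(`Proc.Act`) and an action of the propagation unit (`Mem.Act`), and these are compared separately.

For memories, `Mem.Sim` says that one unit is at least as permissive as another. The future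
behaviour of a unit depends on its order only through what is overwritten below a message, below the
fences of a process, below the messages that a process has seen, and below the messages to a
location (`Below`, `FenceView`, `SeenView`, `LocView`). Each operation turns these views into one
another in a monotone way, and garbage collection does not change them for the surviving messages.
In a plain configuration there is one message per location, so nothing is overwritten and all views
are empty. Hence a plain memory is at least as permissive as any other memory with the same last
values, apart from old messages that can no longer be read. This is why all plain configurations
with the same values are equally good.

From the original to the augmented program, the plain configuration of part 2 simulates the given
one, with relocated processes (`Shifted.step`).

In the converse direction an arbitrary run of the augmented program has to be cut at the moment when
the flag is set (`Storing`, then `Running`). At this moment the last messages carry the prescribed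
values, and process `0` has seen them. In a causal unit the fence inside the signalling RMW places
the flag message above them, so that every older message is overwritten below the flag
(`Mem.rmw_signal`). In a multi-copy-atomic unit there are no older messages. A process leaves its
waiting loop only by reading `1` from the last message to the flag, which makes the older messages
redundant to it (`Related.rmw_flag`). From then on it can only read messages that have counterparts
in the original run (`Related.act`).

On the side of the processes, the difficulty is speculation: code behind the preamble may be fetched
at any time. Before the synchronization, the pending RMW lets nothing overtake it, so that
speculation has no effect (`Speculating`). After it, only assignments of constants and resolved
branches remain. They block nothing, and what follows acts as if they had been executed (`Prelude`,
`Lifted`, `Post`). When a process passes its synchronization, the original process catches up by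
fetching the same speculated entries (`Post.of_codePath`). -/

namespace Mem

/-! ## The order of the propagation unit -/

/-- The message `u` is overwritten at or below `t`: a write to its location lies above `u` and is
`t` or below `t`. -/
def Below (m : Mem) (u t : ℕ) : Prop :=
  u ∈ m.writes ∧ ∃ v ∈ m.writes, (m.msg u).loc = (m.msg v).loc ∧ m.lt u v ∧ m.le v t

/-- `u` is overwritten below a fence of the process `p`. -/
def FenceView (m : Mem) (p u : ℕ) : Prop := ∃ t ∈ m.fences, m.issuer t = p ∧ m.Below u t

/-- `u` is overwritten below a message that the process `p` has seen. -/
def SeenView (m : Mem) (p u : ℕ) : Prop := ∃ t ∈ m.writes, p ∈ (m.msg t).seen ∧ m.Below u t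

/-- `u` is overwritten below a message to the location `x`. -/
def LocView (m : Mem) (x : Loc) (u : ℕ) : Prop :=
  ∃ t ∈ m.writes, (m.msg t).loc = x ∧ m.Below u t

/-- `i` is the last message to `x`. -/
def IsLast (m : Mem) (x : Loc) (i : ℕ) : Prop :=
  i ∈ m.writes ∧ (m.msg i).loc = x ∧ ∀ u ∈ m.writes, (m.msg u).loc = x → u = i ∨ m.lt u i

/-- The processes that see a write of `p` at once. -/
def audience (M : Propagation) (n p : ℕ) : Set ℕ :=
  match M with
  | .multiCopyAtomic => {q | q < n}
  | .causal => {p}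

theorem mem_audience (M : Propagation) {n p : ℕ} (hp : p < n) : p ∈ audience M n p := by
  cases M
  · exact hp
  · rfl

/-! ### Operations before garbage collection -/

/-- `Mem.read` before garbage collection. -/
noncomputable def readRaw (p v₀ : ℕ) (m : Mem) : Mem := m.mark {p} {u | m.Below u v₀}

/-- `Mem.update` before garbage collection. -/
noncomputable def updateRaw (p v : ℕ) (m : Mem) : Mem :=
  let m' := m.mark {p} {u | u ∈ m.writes ∧ (m.msg u).loc = (m.msg v).loc ∧ m.lt u v}
  { m' with msg := Function.update m'.msg v { m'.msg v with seen := insert p (m'.msg v).seen } }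

/-- `Mem.write` before garbage collection. -/
noncomputable def writeRaw (M : Propagation) (n p : ℕ) (x : Loc) (v : ℕ) (m : Mem) : Mem :=
  let m' := m.mark (audience M n p) {u | u ∈ m.writes ∧ (m.msg u).loc = x}
  { m' with
    writes := insert m.fresh m.writes
    msg := Function.update m'.msg m.fresh ⟨x, v, true, audience M n p, ∅⟩
    lt := m.insertLt m.fresh {t | (t ∈ m.writes ∧ (m.msg t).loc = x) ∨
      (t ∈ m.fences ∧ m.issuer t = p)} }

theorem read_eq (n p v₀ : ℕ) (m : Mem) : m.read n p v₀ = gc n (m.readRaw p v₀) := rfl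

theorem update_eq (n p v : ℕ) (m : Mem) : m.update n p v = gc n (m.updateRaw p v) := rfl

theorem write_eq (M : Propagation) (n p : ℕ) (x : Loc) (v : ℕ) (m : Mem) :
    m.write M n p x v = gc n (m.writeRaw M n p x v) := rfl

section Fields

variable (m : Mem) (A S : Set ℕ) (n p v i q : ℕ)

@[simp] theorem mark_loc : ((m.mark A S).msg i).loc = (m.msg i).loc := by
  simp only [mark]; split_ifs <;> rfl
@[simp] theorem mark_val : ((m.mark A S).msg i).val = (m.msg i).val := by
  simp only [mark]; split_ifs <;> rfl
@[simp] theorem mark_source : ((m.mark A S).msg i).source = (m.msg i).source := by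
  simp only [mark]; split_ifs <;> rfl
@[simp] theorem mark_seen : ((m.mark A S).msg i).seen = (m.msg i).seen := by
  simp only [mark]; split_ifs <;> rfl
@[simp] theorem mem_mark_redundant :
    q ∈ ((m.mark A S).msg i).redundant ↔ q ∈ (m.msg i).redundant ∨ (i ∈ S ∧ q ∈ A) := by
  simp only [mark]; split_ifs with h <;> simp [h]

@[simp] theorem readRaw_writes : (m.readRaw p v).writes = m.writes := rfl
@[simp] theorem readRaw_fences : (m.readRaw p v).fences = m.fences := rfl
@[simp] theorem readRaw_issuer : (m.readRaw p v).issuer = m.issuer := rfl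
@[simp] theorem readRaw_lt : (m.readRaw p v).lt = m.lt := rfl
@[simp] theorem readRaw_loc : ((m.readRaw p v).msg i).loc = (m.msg i).loc := mark_loc ..
@[simp] theorem readRaw_val : ((m.readRaw p v).msg i).val = (m.msg i).val := mark_val ..
@[simp] theorem readRaw_source : ((m.readRaw p v).msg i).source = (m.msg i).source :=
  mark_source ..
@[simp] theorem readRaw_seen : ((m.readRaw p v).msg i).seen = (m.msg i).seen := mark_seen ..
@[simp] theorem mem_readRaw_redundant :
    q ∈ ((m.readRaw p v).msg i).redundant ↔
      q ∈ (m.msg i).redundant ∨ (m.Below i v ∧ q = p) := by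
  simp [readRaw]

@[simp] theorem updateRaw_writes : (m.updateRaw p v).writes = m.writes := rfl
@[simp] theorem updateRaw_fences : (m.updateRaw p v).fences = m.fences := rfl
@[simp] theorem updateRaw_issuer : (m.updateRaw p v).issuer = m.issuer := rfl
@[simp] theorem updateRaw_lt : (m.updateRaw p v).lt = m.lt := rfl
@[simp] theorem updateRaw_loc : ((m.updateRaw p v).msg i).loc = (m.msg i).loc := by
  by_cases h : i = v
  · subst h; simp [updateRaw]
  · simp [updateRaw, Function.update_of_ne h]
@[simp] theorem updateRaw_val : ((m.updateRaw p v).msg i).val = (m.msg i).val := by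
  by_cases h : i = v
  · subst h; simp [updateRaw]
  · simp [updateRaw, Function.update_of_ne h]
@[simp] theorem updateRaw_source : ((m.updateRaw p v).msg i).source = (m.msg i).source := by
  by_cases h : i = v
  · subst h; simp [updateRaw]
  · simp [updateRaw, Function.update_of_ne h]
@[simp] theorem mem_updateRaw_seen :
    q ∈ ((m.updateRaw p v).msg i).seen ↔ q ∈ (m.msg i).seen ∨ (i = v ∧ q = p) := by
  by_cases h : i = v
  · subst h; simp [updateRaw, or_comm]
  · simp [updateRaw, h]
@[simp] theorem mem_updateRaw_redundant :
    q ∈ ((m.updateRaw p v).msg i).redundant ↔ q ∈ (m.msg i).redundant ∨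
      ((i ∈ m.writes ∧ (m.msg i).loc = (m.msg v).loc ∧ m.lt i v) ∧ q = p) := by
  by_cases h : i = v
  · subst h; simp [updateRaw]
  · simp [updateRaw, Function.update_of_ne h]

variable (M : Propagation) (x : Loc)

@[simp] theorem writeRaw_writes : (m.writeRaw M n p x v).writes = insert m.fresh m.writes := rfl
@[simp] theorem writeRaw_fences : (m.writeRaw M n p x v).fences = m.fences := rfl
@[simp] theorem writeRaw_issuer : (m.writeRaw M n p x v).issuer = m.issuer := rfl
theorem writeRaw_lt : (m.writeRaw M n p x v).lt =
    m.insertLt m.fresh {t | (t ∈ m.writes ∧ (m.msg t).loc = x) ∨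
      (t ∈ m.fences ∧ m.issuer t = p)} := rfl
@[simp] theorem writeRaw_msg_fresh :
    (m.writeRaw M n p x v).msg m.fresh = ⟨x, v, true, audience M n p, ∅⟩ := by
  simp [writeRaw]

variable {m i}

theorem fresh_notMem_ids : m.fresh ∉ m.ids := fun h => by
  have : m.fresh ≤ m.ids.sup id := Finset.le_sup (f := id) h
  exact absurd this (Nat.not_succ_le_self _)

theorem ne_fresh_of_mem_writes (h : i ∈ m.writes) : i ≠ m.fresh := by
  rintro rfl; exact fresh_notMem_ids (Finset.mem_union_left _ h)

theorem ne_fresh_of_mem_fences (h : i ∈ m.fences) : i ≠ m.fresh := by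
  rintro rfl; exact fresh_notMem_ids (Finset.mem_union_right _ h)

theorem writeRaw_loc (h : i ≠ m.fresh) :
    ((m.writeRaw M n p x v).msg i).loc = (m.msg i).loc := by
  simp [writeRaw, Function.update_of_ne h]
theorem writeRaw_val (h : i ≠ m.fresh) :
    ((m.writeRaw M n p x v).msg i).val = (m.msg i).val := by
  simp [writeRaw, Function.update_of_ne h]
theorem writeRaw_source (h : i ≠ m.fresh) :
    ((m.writeRaw M n p x v).msg i).source = (m.msg i).source := by
  simp [writeRaw, Function.update_of_ne h]
theorem writeRaw_seen (h : i ≠ m.fresh) :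
    ((m.writeRaw M n p x v).msg i).seen = (m.msg i).seen := by
  simp [writeRaw, Function.update_of_ne h]
theorem mem_writeRaw_redundant (h : i ≠ m.fresh) :
    q ∈ ((m.writeRaw M n p x v).msg i).redundant ↔ q ∈ (m.msg i).redundant ∨
      ((i ∈ m.writes ∧ (m.msg i).loc = x) ∧ q ∈ audience M n p) := by
  simp [writeRaw, Function.update_of_ne h]

@[simp] theorem fence_writes : (m.fence M p).writes = m.writes := by cases M <;> rfl
@[simp] theorem fence_msg : (m.fence M p).msg = m.msg := by cases M <;> rfl

@[simp] theorem consume_writes : (m.consume v).writes = m.writes := rfl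
@[simp] theorem consume_fences : (m.consume v).fences = m.fences := rfl
@[simp] theorem consume_issuer : (m.consume v).issuer = m.issuer := rfl
@[simp] theorem consume_lt : (m.consume v).lt = m.lt := rfl
@[simp] theorem consume_loc : ((m.consume v).msg i).loc = (m.msg i).loc := by
  by_cases h : i = v
  · subst h; simp [consume]
  · simp [consume, Function.update_of_ne h]
@[simp] theorem consume_val : ((m.consume v).msg i).val = (m.msg i).val := by
  by_cases h : i = v
  · subst h; simp [consume]
  · simp [consume, Function.update_of_ne h]
@[simp] theorem consume_seen : ((m.consume v).msg i).seen = (m.msg i).seen := by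
  by_cases h : i = v
  · subst h; simp [consume]
  · simp [consume, Function.update_of_ne h]
@[simp] theorem consume_redundant :
    ((m.consume v).msg i).redundant = (m.msg i).redundant := by
  by_cases h : i = v
  · subst h; simp [consume]
  · simp [consume, Function.update_of_ne h]
theorem consume_source_eq_true :
    ((m.consume v).msg i).source = true ↔ i ≠ v ∧ (m.msg i).source = true := by
  by_cases h : i = v
  · subst h; simp [consume]
  · simp [consume, h]

variable (m i)

@[simp] theorem gc_msg : (m.gc n).msg = m.msg := rfl
theorem mem_gc_writes : i ∈ (m.gc n).writes ↔
    i ∈ m.writes ∧ ∃ p < n, p ∉ (m.msg i).redundant := by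
  simp [gc]
theorem mem_gc_fences : i ∈ (m.gc n).fences ↔ i ∈ m.fences ∧
    ∃ v ∈ m.writes, (∃ p < n, p ∉ (m.msg v).redundant) ∧ m.lt v i := by
  simp [gc]

end Fields

/-! ### Invariants -/

/-- Invariants of the propagation unit that hold before garbage collection, too, for a system of
`n` processes with locations `L`. -/
structure Core (n : ℕ) (L : Loc → Prop) (m : Mem) : Prop where
  disjoint : Disjoint m.writes m.fences
  irrefl : ∀ i ∈ m.ids, ¬ m.lt i i
  trans : ∀ i ∈ m.ids, ∀ j ∈ m.ids, ∀ k ∈ m.ids, m.lt i j → m.lt j k → m.lt i k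
  locations : ∀ v ∈ m.writes, L (m.msg v).loc
  issuers : ∀ f ∈ m.fences, m.issuer f < n
  coherence : ∀ u ∈ m.writes, ∀ v ∈ m.writes, (m.msg u).loc = (m.msg v).loc →
    m.lt u v ∨ u = v ∨ m.lt v u
  causalPropagation : ∀ p < n, ∀ u ∈ m.writes, ∀ v ∈ m.writes,
    (m.msg u).loc = (m.msg v).loc → m.lt u v → p ∈ (m.msg v).redundant → p ∈ (m.msg u).redundant
  coherentObservation : ∀ p < n, ∀ u ∈ m.writes, ∀ v ∈ m.writes,
    (m.msg u).loc = (m.msg v).loc → p ∉ (m.msg u).redundant → p ∉ (m.msg v).redundant →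
    p ∈ (m.msg v).seen → ¬ m.lt u v
  last : ∀ x, L x → ∃ v, m.IsLast x v ∧ ∀ p < n, p ∉ (m.msg v).redundant
  -- This makes the view of what a process has seen robust under garbage collection: when a message
  -- becomes redundant to the process, a later one that it has seen takes over.
  acquired : ∀ p < n, ∀ t ∈ m.writes, p ∈ (m.msg t).redundant →
    ∃ t' ∈ m.writes, p ∈ (m.msg t').seen ∧ p ∉ (m.msg t').redundant ∧ m.lt t t'

theorem mem_ids_of_writes {m : Mem} {i : ℕ} (h : i ∈ m.writes) : i ∈ m.ids :=
  Finset.mem_union_left _ h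

theorem mem_ids_of_fences {m : Mem} {i : ℕ} (h : i ∈ m.fences) : i ∈ m.ids :=
  Finset.mem_union_right _ h

theorem le_trans' {m : Mem}
    (h : ∀ i ∈ m.ids, ∀ j ∈ m.ids, ∀ k ∈ m.ids, m.lt i j → m.lt j k → m.lt i k)
    {i j k : ℕ} (hi : i ∈ m.ids) (hj : j ∈ m.ids) (hk : k ∈ m.ids) (hij : m.lt i j)
    (hjk : m.le j k) : m.lt i k := by
  rcases hjk with rfl | hjk
  · exact hij
  · exact h i hi j hj k hk hij hjk

theorem insertLt_irrefl {m : Mem} {i : ℕ} {S : Set ℕ} (hi : i ∉ m.ids)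
    (h : ∀ j ∈ m.ids, ¬ m.lt j j) : ∀ j ∈ insert i m.ids, ¬ m.insertLt i S j j := by
  rintro j hj (⟨rfl, h', -⟩ | ⟨h1, -, h2⟩)
  · exact hi h'
  · exact h j ((Finset.mem_insert.1 hj).resolve_left h1) h2

/-- The inserted element is maximal, so in a chain of two steps it can occur only at the upper end.
-/
theorem insertLt_trans {m : Mem} {i : ℕ} {S : Set ℕ} (hi : i ∉ m.ids)
    (h : ∀ i ∈ m.ids, ∀ j ∈ m.ids, ∀ k ∈ m.ids, m.lt i j → m.lt j k → m.lt i k) :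
    ∀ a ∈ insert i m.ids, ∀ b ∈ insert i m.ids, ∀ c ∈ insert i m.ids,
      m.insertLt i S a b → m.insertLt i S b c → m.insertLt i S a c := by
  intro a ha b hb c hc hab hbc
  have hbi : b ≠ i := by
    rcases hbc with ⟨-, hb', -⟩ | ⟨h1, -⟩
    · rintro rfl; exact hi hb'
    · exact h1
  obtain ⟨hai, -, hab'⟩ : a ≠ i ∧ b ≠ i ∧ m.lt a b := by
    rcases hab with ⟨h1, -⟩ | h1
    · exact absurd h1 hbi
    · exact h1
  have ha' := (Finset.mem_insert.1 ha).resolve_left hai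
  have hb' := (Finset.mem_insert.1 hb).resolve_left hbi
  rcases hbc with ⟨rfl, -, t, ht, htS, hbt⟩ | ⟨-, hci, hbc⟩
  · exact Or.inl ⟨rfl, ha', t, ht, htS, Or.inr (le_trans' h ha' hb' ht hab' hbt)⟩
  · exact Or.inr ⟨hai, hci, h a ha' b hb' c ((Finset.mem_insert.1 hc).resolve_left hci) hab' hbc⟩

namespace Core

variable {n : ℕ} {L : Loc → Prop} {m : Mem}

theorem lt_asymm (h : Core n L m) {i j : ℕ} (hi : i ∈ m.ids) (hj : j ∈ m.ids)
    (hij : m.lt i j) : ¬ m.lt j i := fun hji => h.irrefl i hi (h.trans i hi j hj i hi hij hji)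

theorem isLast_unique (h : Core n L m) {x : Loc} {i j : ℕ} (hi : m.IsLast x i)
    (hj : m.IsLast x j) : i = j := by
  rcases hi.2.2 j hj.1 hj.2.1 with h1 | h1
  · exact h1.symm
  rcases hj.2.2 i hi.1 hi.2.1 with h2 | h2
  · exact h2
  exact absurd h1 (h.lt_asymm (mem_ids_of_writes hi.1) (mem_ids_of_writes hj.1) h2)

theorem notMem_redundant_of_isLast (h : Core n L m) {x : Loc} {i p : ℕ} (hi : m.IsLast x i)
    (hp : p < n) : p ∉ (m.msg i).redundant := by
  obtain ⟨v, hv, hv'⟩ := h.last x (hi.2.1 ▸ h.locations i hi.1)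
  exact h.isLast_unique hi hv ▸ hv' p hp

/-- Writes to one location are totally ordered, so a maximal one is the greatest. -/
theorem isLast_iff (h : Core n L m) {x : Loc} {i : ℕ} :
    m.IsLast x i ↔ i ∈ m.writes ∧ (m.msg i).loc = x ∧
      ∀ u ∈ m.writes, (m.msg u).loc = x → ¬ m.lt i u := by
  constructor
  · rintro ⟨h1, h2, h3⟩
    refine ⟨h1, h2, fun u hu hux hlt => ?_⟩
    rcases h3 u hu hux with rfl | h4
    · exact h.irrefl _ (mem_ids_of_writes h1) hlt
    · exact h.lt_asymm (mem_ids_of_writes h1) (mem_ids_of_writes hu) hlt h4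
  · rintro ⟨h1, h2, h3⟩
    refine ⟨h1, h2, fun u hu hux => ?_⟩
    rcases h.coherence u hu i h1 (hux.trans h2.symm) with h4 | h4 | h4
    · exact Or.inr h4
    · exact Or.inl h4
    · exact absurd h4 (h3 u hu hux)

theorem below_lt (h : Core n L m) {u t : ℕ} (ht : t ∈ m.ids) (hu : m.Below u t) : m.lt u t := by
  obtain ⟨hu, v, hv, -, h1, h2⟩ := hu
  exact le_trans' h.trans (mem_ids_of_writes hu) (mem_ids_of_writes hv) ht h1 h2

theorem below_of_lt (h : Core n L m) {u t t' : ℕ} (ht : t ∈ m.ids) (ht' : t' ∈ m.ids)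
    (hu : m.Below u t) (hlt : m.lt t t') : m.Below u t' := by
  obtain ⟨hu, v, hv, h0, h1, h2⟩ := hu
  refine ⟨hu, v, hv, h0, h1, Or.inr ?_⟩
  rcases h2 with rfl | h2
  · exact hlt
  · exact h.trans v (mem_ids_of_writes hv) t ht t' ht' h2 hlt

theorem not_below_self (h : Core n L m) {u : ℕ} (hu : u ∈ m.writes) : ¬ m.Below u u := fun hb =>
  h.irrefl u (mem_ids_of_writes hu) (h.below_lt (mem_ids_of_writes hu) hb)

/-- The only invariants that assert existence are `last` and `acquired`. Their witnesses are not
redundant to some process and are therefore not deleted. -/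
theorem gc (h : Core n L m) (hn : 0 < n) : Core n L (m.gc n) := by
  have hw : ∀ i, i ∈ (m.gc n).writes → i ∈ m.writes := fun i hi => ((mem_gc_writes m n i).1 hi).1
  have hf : ∀ i, i ∈ (m.gc n).fences → i ∈ m.fences := fun i hi => ((mem_gc_fences m n i).1 hi).1
  have hids : ∀ i, i ∈ (m.gc n).ids → i ∈ m.ids := fun i hi => by
    rcases Finset.mem_union.1 hi with hi | hi
    · exact mem_ids_of_writes (hw i hi)
    · exact mem_ids_of_fences (hf i hi)
  exact {
    disjoint := Finset.disjoint_left.2 fun i hi hi' =>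
      Finset.disjoint_left.1 h.disjoint (hw i hi) (hf i hi')
    irrefl := fun i hi => h.irrefl i (hids i hi)
    trans := fun i hi j hj k hk => h.trans i (hids i hi) j (hids j hj) k (hids k hk)
    locations := fun v hv => h.locations v (hw v hv)
    issuers := fun f hf' => h.issuers f (hf f hf')
    coherence := fun u hu v hv => h.coherence u (hw u hu) v (hw v hv)
    causalPropagation := fun p hp u hu v hv => h.causalPropagation p hp u (hw u hu) v (hw v hv)
    coherentObservation := fun p hp u hu v hv =>
      h.coherentObservation p hp u (hw u hu) v (hw v hv)
    last := fun x hx => by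
      obtain ⟨v, hv, hr⟩ := h.last x hx
      exact ⟨v, ⟨(mem_gc_writes m n v).2 ⟨hv.1, 0, hn, hr 0 hn⟩, hv.2.1,
        fun u hu => hv.2.2 u (hw u hu)⟩, hr⟩
    acquired := fun p hp t ht hr => by
      obtain ⟨t', h1, h2, h3, h4⟩ := h.acquired p hp t (hw t ht) hr
      exact ⟨t', (mem_gc_writes m n t').2 ⟨h1, p, hp, h3⟩, h2, h3, h4⟩ }

theorem readRaw (h : Core n L m) {p v₀ : ℕ} (hv : v₀ ∈ m.writes)
    (hs : p ∈ (m.msg v₀).seen) (hr : p ∉ (m.msg v₀).redundant) : Core n L (m.readRaw p v₀) where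
  disjoint := h.disjoint
  irrefl := h.irrefl
  trans := h.trans
  locations v hv := by simpa using h.locations v hv
  issuers := h.issuers
  coherence u hu v hv := by simpa using h.coherence u hu v hv
  causalPropagation q hq u hu v hv hl hlt := by
    simp only [mem_readRaw_redundant, readRaw_loc] at hl ⊢
    rintro (h1 | ⟨h1, rfl⟩)
    · exact Or.inl (h.causalPropagation q hq u hu v hv hl hlt h1)
    · exact Or.inr ⟨⟨hu, v, hv, hl, hlt,
        Or.inr (h.below_lt (mem_ids_of_writes ‹_›) h1)⟩, rfl⟩
  coherentObservation q hq u hu v hv := by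
    simp only [mem_readRaw_redundant, readRaw_loc, readRaw_seen, not_or]
    exact fun h1 h2 h3 => h.coherentObservation q hq u hu v hv h1 h2.1 h3.1
  last x hx := by
    obtain ⟨v, h1, h2⟩ := h.last x hx
    refine ⟨v, ⟨h1.1, by simpa using h1.2.1, by simpa using h1.2.2⟩, fun q hq => ?_⟩
    rw [mem_readRaw_redundant]
    rintro (h3 | ⟨⟨-, w, hw, h3, h4, -⟩, -⟩)
    · exact h2 q hq h3
    · exact ((h.isLast_iff.1 h1).2.2 w hw (h3.symm.trans h1.2.1)) h4
  acquired q hq t ht hrt := by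
    have hself := h.not_below_self hv
    simp only [mem_readRaw_redundant, readRaw_seen] at hrt ⊢
    -- Whatever the read makes redundant lies below the source `v₀`, which the process has seen and
    -- which the read does not make redundant. So `v₀` is the new witness.
    have key : ∀ t ∈ m.writes, m.Below t v₀ → q = p → ∃ t' ∈ m.writes, q ∈ (m.msg t').seen ∧
        ¬ (q ∈ (m.msg t').redundant ∨ (m.Below t' v₀ ∧ q = p)) ∧ m.lt t t' := by
      rintro t ht hb rfl
      exact ⟨v₀, hv, hs, by tauto, h.below_lt (mem_ids_of_writes hv) hb⟩
    rcases hrt with hrt | ⟨hrt, hqp⟩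
    · obtain ⟨t', h1, h2, h3, h4⟩ := h.acquired q hq t ht hrt
      by_cases hb : m.Below t' v₀ ∧ q = p
      · obtain ⟨t'', h5, h6, h7, h8⟩ := key t' h1 hb.1 hb.2
        exact ⟨t'', h5, h6, h7, h.trans t (mem_ids_of_writes ht) t' (mem_ids_of_writes h1) t''
          (mem_ids_of_writes h5) h4 h8⟩
      · exact ⟨t', h1, h2, by tauto, h4⟩
    · exact key t ht hrt hqp

theorem updateRaw (h : Core n L m) {p v₀ : ℕ} (hv₀ : v₀ ∈ m.writes)
    (hr : p ∉ (m.msg v₀).redundant) : Core n L (m.updateRaw p v₀) where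
  disjoint := h.disjoint
  irrefl := h.irrefl
  trans := h.trans
  locations v hv := by simpa using h.locations v hv
  issuers := h.issuers
  coherence u hu v hv := by simpa using h.coherence u hu v hv
  causalPropagation q hq u hu v hv hl hlt := by
    simp only [mem_updateRaw_redundant, updateRaw_loc] at hl ⊢
    rintro (h1 | ⟨⟨-, h1, h2⟩, rfl⟩)
    · exact Or.inl (h.causalPropagation q hq u hu v hv hl hlt h1)
    · exact Or.inr ⟨⟨hu, hl.trans h1, h.trans u (mem_ids_of_writes hu) v (mem_ids_of_writes hv) v₀
        (mem_ids_of_writes hv₀) hlt h2⟩, rfl⟩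
  coherentObservation q hq u hu v hv := by
    simp only [mem_updateRaw_redundant, updateRaw_loc, mem_updateRaw_seen, not_or]
    rintro h1 h2 h3 (h4 | ⟨rfl, rfl⟩) h5
    · exact h.coherentObservation q hq u hu v hv h1 h2.1 h3.1 h4 h5
    -- For the newly seen message, the same update has made all older messages to its location
    -- redundant.
    · exact h2.2 ⟨⟨hu, h1, h5⟩, rfl⟩
  last x hx := by
    obtain ⟨v, h1, h2⟩ := h.last x hx
    refine ⟨v, ⟨h1.1, by simpa using h1.2.1, by simpa using h1.2.2⟩, fun q hq => ?_⟩
    rw [mem_updateRaw_redundant]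
    rintro (h3 | ⟨⟨-, h3, h4⟩, -⟩)
    · exact h2 q hq h3
    · exact ((h.isLast_iff.1 h1).2.2 v₀ hv₀ (h3.symm.trans h1.2.1)) h4
  acquired q hq t ht hrt := by
    simp only [mem_updateRaw_redundant, mem_updateRaw_seen] at hrt ⊢
    have hself := h.irrefl v₀ (mem_ids_of_writes hv₀)
    by_cases hqp : q = p
    · subst hqp
      rcases hrt with hrt | ⟨hrt, -⟩
      · obtain ⟨t', h1, h2, h3, h4⟩ := h.acquired q hq t ht hrt
        by_cases hb : t' ∈ m.writes ∧ (m.msg t').loc = (m.msg v₀).loc ∧ m.lt t' v₀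
        · exact ⟨v₀, hv₀, by tauto, by tauto, h.trans t (mem_ids_of_writes ht) t'
            (mem_ids_of_writes h1) v₀ (mem_ids_of_writes hv₀) h4 hb.2.2⟩
        · exact ⟨t', h1, by tauto, by tauto, h4⟩
      · exact ⟨v₀, hv₀, by tauto, by tauto, hrt.2.2⟩
    · obtain ⟨t', h1, h2, h3, h4⟩ := h.acquired q hq t ht (by tauto)
      exact ⟨t', h1, by tauto, by tauto, h4⟩

theorem consume (h : Core n L m) (v₀ : ℕ) : Core n L (m.consume v₀) where
  disjoint := h.disjoint
  irrefl := h.irrefl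
  trans := h.trans
  locations v hv := by simpa using h.locations v hv
  issuers := h.issuers
  coherence u hu v hv := by simpa using h.coherence u hu v hv
  causalPropagation q hq u hu v hv := by simpa using h.causalPropagation q hq u hu v hv
  coherentObservation q hq u hu v hv := by simpa using h.coherentObservation q hq u hu v hv
  last x hx := by simpa [IsLast] using h.last x hx
  acquired q hq t ht := by simpa using h.acquired q hq t ht

/-- The new fence is maximal and is not a write, so it leaves the order among the writes as it was.
-/
theorem fence (h : Core n L m) (M : Propagation) {p : ℕ} (hp : p < n) :
    Core n L (m.fence M p) := by
  cases M
  · exact h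
  have hids : ∀ i ∈ (m.fence .causal p).ids, i ∈ insert m.fresh m.ids := fun i hi => by
    simp only [ids, Mem.fence, Finset.mem_union, Finset.mem_insert] at hi ⊢; tauto
  have hlt : ∀ i ∈ m.writes, ∀ j ∈ m.writes, (m.fence .causal p).lt i j ↔ m.lt i j :=
    fun i hi j hj => by
      simp [Mem.fence, insertLt, ne_fresh_of_mem_writes hi, ne_fresh_of_mem_writes hj]
  exact {
    disjoint := by
      simpa [Mem.fence] using
        ⟨fun hi => ne_fresh_of_mem_writes hi rfl, h.disjoint⟩
    irrefl := fun i hi => insertLt_irrefl fresh_notMem_ids h.irrefl i (hids i hi)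
    trans := fun i hi j hj k hk => insertLt_trans fresh_notMem_ids h.trans i (hids i hi) j
      (hids j hj) k (hids k hk)
    locations := h.locations
    issuers := fun f hf => by
      by_cases hf' : f = m.fresh
      · subst hf'; simpa [Mem.fence] using hp
      · have : f ∈ m.fences := (Finset.mem_insert.1 hf).resolve_left hf'
        simpa [Mem.fence, Function.update_of_ne hf'] using h.issuers f this
    coherence := fun u hu v hv => by
      rw [hlt u hu v hv, hlt v hv u hu]; exact h.coherence u hu v hv
    causalPropagation := fun q hq u hu v hv => by
      rw [hlt u hu v hv]; exact h.causalPropagation q hq u hu v hv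
    coherentObservation := fun q hq u hu v hv => by
      rw [hlt u hu v hv]; exact h.coherentObservation q hq u hu v hv
    last := fun x hx => by
      obtain ⟨v, h1, h2⟩ := h.last x hx
      exact ⟨v, ⟨h1.1, h1.2.1, fun u hu => by rw [hlt u hu v h1.1]; exact h1.2.2 u hu⟩, h2⟩
    acquired := fun q hq t ht hr => by
      obtain ⟨t', h1, h2⟩ := h.acquired q hq t ht hr
      exact ⟨t', h1, by rwa [hlt t ht t' h1]⟩ }

end Core

theorem writeRaw_lt_of_ne {m : Mem} {M : Propagation} {n p v : ℕ} {x : Loc} {i j : ℕ}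
    (hi : i ≠ m.fresh) (hj : j ≠ m.fresh) : (m.writeRaw M n p x v).lt i j ↔ m.lt i j := by
  simp [writeRaw_lt, insertLt, hi, hj]

theorem writeRaw_lt_fresh {m : Mem} {M : Propagation} {n p v : ℕ} {x : Loc} {i : ℕ}
    (hi : i ∈ m.writes) (hx : (m.msg i).loc = x) : (m.writeRaw M n p x v).lt i m.fresh :=
  Or.inl ⟨rfl, mem_ids_of_writes hi, i, mem_ids_of_writes hi, Or.inl ⟨hi, hx⟩, Or.inl rfl⟩

theorem not_writeRaw_lt_fresh {m : Mem} {M : Propagation} {n p v : ℕ} {x : Loc} {j : ℕ} :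
    ¬ (m.writeRaw M n p x v).lt m.fresh j := by
  rintro (⟨-, h, -⟩ | ⟨h, -⟩)
  · exact fresh_notMem_ids h
  · exact h rfl

theorem writeRaw_isLast_fresh (m : Mem) (M : Propagation) (n p v : ℕ) (x : Loc) :
    (m.writeRaw M n p x v).IsLast x m.fresh := by
  refine ⟨Finset.mem_insert_self _ _, by simp, fun u hu hux => ?_⟩
  by_cases h : u = m.fresh
  · exact Or.inl h
  · rw [writeRaw_loc _ _ _ _ _ h] at hux
    exact Or.inr (writeRaw_lt_fresh ((Finset.mem_insert.1 hu).resolve_left h) hux)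

theorem writeRaw_isLast_of_ne {m : Mem} {M : Propagation} {n p v : ℕ} {x y : Loc} {i : ℕ}
    (hy : y ≠ x) (hi : m.IsLast y i) : (m.writeRaw M n p x v).IsLast y i := by
  have h := ne_fresh_of_mem_writes hi.1
  refine ⟨Finset.mem_insert_of_mem hi.1, by rw [writeRaw_loc _ _ _ _ _ h, hi.2.1],
    fun u hu huy => ?_⟩
  have h' : u ≠ m.fresh := by
    rintro rfl; simp at huy; exact hy huy.symm
  rw [writeRaw_loc _ _ _ _ _ h'] at huy
  rw [writeRaw_lt_of_ne h' h]
  exact hi.2.2 u ((Finset.mem_insert.1 hu).resolve_left h') huy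

theorem Core.writeRaw {n : ℕ} {L : Loc → Prop} {m : Mem} (h : Core n L m) (M : Propagation)
    {p : ℕ} {x : Loc} (hx : L x) (v : ℕ) :
    Core n L (m.writeRaw M n p x v) := by
  have hids : ∀ i ∈ (m.writeRaw M n p x v).ids, i ∈ insert m.fresh m.ids := fun i hi => by
    simp only [ids, writeRaw_writes, writeRaw_fences, Finset.mem_union, Finset.mem_insert] at hi ⊢
    tauto
  have hold : ∀ i ∈ (m.writeRaw M n p x v).writes, i = m.fresh ∨ (i ∈ m.writes ∧ i ≠ m.fresh) :=
    fun i hi => by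
      rcases Finset.mem_insert.1 hi with hi | hi
      · exact Or.inl hi
      · exact Or.inr ⟨hi, ne_fresh_of_mem_writes hi⟩
  exact {
    disjoint := by
      rw [writeRaw_writes, writeRaw_fences, Finset.disjoint_insert_left]
      exact ⟨fun hi => ne_fresh_of_mem_fences hi rfl, h.disjoint⟩
    irrefl := fun i hi => insertLt_irrefl fresh_notMem_ids h.irrefl i (hids i hi)
    trans := fun i hi j hj k hk => insertLt_trans fresh_notMem_ids h.trans i (hids i hi) j
      (hids j hj) k (hids k hk)
    locations := fun i hi => by
      rcases hold i hi with rfl | ⟨hi, hi'⟩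
      · simpa using hx
      · rw [writeRaw_loc _ _ _ _ _ hi']; exact h.locations i hi
    issuers := h.issuers
    coherence := fun i hi j hj hl => by
      rcases hold i hi with rfl | ⟨hi, hi'⟩ <;> rcases hold j hj with rfl | ⟨hj, hj'⟩
      · simp
      · rw [writeRaw_loc _ _ _ _ _ hj'] at hl
        exact Or.inr (Or.inr (writeRaw_lt_fresh hj (by simpa using hl.symm)))
      · rw [writeRaw_loc _ _ _ _ _ hi'] at hl
        exact Or.inl (writeRaw_lt_fresh hi (by simpa using hl))
      · rw [writeRaw_loc _ _ _ _ _ hi', writeRaw_loc _ _ _ _ _ hj'] at hl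
        rw [writeRaw_lt_of_ne hi' hj', writeRaw_lt_of_ne hj' hi']
        exact h.coherence i hi j hj hl
    causalPropagation := fun q hq i hi j hj hl hlt hr => by
      rcases hold i hi with rfl | ⟨hi, hi'⟩
      · exact absurd hlt not_writeRaw_lt_fresh
      rcases hold j hj with rfl | ⟨hj, hj'⟩
      · simp at hr
      · rw [writeRaw_loc _ _ _ _ _ hi', writeRaw_loc _ _ _ _ _ hj'] at hl
        rw [writeRaw_lt_of_ne hi' hj'] at hlt
        rw [mem_writeRaw_redundant _ _ _ _ _ _ hj'] at hr
        rw [mem_writeRaw_redundant _ _ _ _ _ _ hi']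
        rcases hr with hr | hr
        · exact Or.inl (h.causalPropagation q hq i hi j hj hl hlt hr)
        · exact Or.inr ⟨⟨hi, hl.trans hr.1.2⟩, hr.2⟩
    coherentObservation := fun q hq i hi j hj hl hri hrj hs hlt => by
      rcases hold i hi with rfl | ⟨hi, hi'⟩
      · exact absurd hlt not_writeRaw_lt_fresh
      rw [writeRaw_loc _ _ _ _ _ hi'] at hl
      rw [mem_writeRaw_redundant _ _ _ _ _ _ hi'] at hri
      rcases hold j hj with rfl | ⟨hj, hj'⟩
      · simp only [writeRaw_msg_fresh] at hl hs
        exact hri (Or.inr ⟨⟨hi, hl⟩, hs⟩)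
      · rw [writeRaw_loc _ _ _ _ _ hj'] at hl
        rw [mem_writeRaw_redundant _ _ _ _ _ _ hj'] at hrj
        rw [writeRaw_seen _ _ _ _ _ hj'] at hs
        rw [writeRaw_lt_of_ne hi' hj'] at hlt
        exact h.coherentObservation q hq i hi j hj hl (fun h => hri (Or.inl h))
          (fun h => hrj (Or.inl h)) hs hlt
    last := fun y hy => by
      by_cases hyx : y = x
      · subst hyx
        exact ⟨m.fresh, writeRaw_isLast_fresh .., by simp⟩
      · obtain ⟨i, h1, h2⟩ := h.last y hy
        refine ⟨i, writeRaw_isLast_of_ne hyx h1, fun q hq => ?_⟩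
        rw [mem_writeRaw_redundant _ _ _ _ _ _ (ne_fresh_of_mem_writes h1.1)]
        rintro (h3 | ⟨⟨-, h3⟩, -⟩)
        · exact h2 q hq h3
        · exact hyx (h1.2.1.symm.trans h3)
    acquired := fun q hq t ht hr => by
      rcases hold t ht with rfl | ⟨ht, ht'⟩
      · simp at hr
      rw [mem_writeRaw_redundant _ _ _ _ _ _ ht'] at hr
      rcases hr with hr | ⟨⟨-, h1⟩, h2⟩
      · obtain ⟨t', h1, h2, h3, h4⟩ := h.acquired q hq t ht hr
        have h1' := ne_fresh_of_mem_writes h1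
        -- If the witness `t'` is itself overwritten for `q`, then `q` belongs to the audience of
        -- the new message, which lies above `t'` and takes over.
        by_cases hc : (m.msg t').loc = x ∧ q ∈ audience M n p
        · refine ⟨m.fresh, Finset.mem_insert_self _ _, by simpa using hc.2, by simp, ?_⟩
          exact Or.inl ⟨rfl, mem_ids_of_writes ht, t', mem_ids_of_writes h1,
            Or.inl ⟨h1, hc.1⟩, Or.inr h4⟩
        · refine ⟨t', Finset.mem_insert_of_mem h1, by rwa [writeRaw_seen _ _ _ _ _ h1'], ?_,
            by rwa [writeRaw_lt_of_ne ht' h1']⟩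
          rw [mem_writeRaw_redundant _ _ _ _ _ _ h1']
          tauto
      · exact ⟨m.fresh, Finset.mem_insert_self _ _, by simpa using h2, by simp,
          writeRaw_lt_fresh ht h1⟩ }

/-! ### Effect of the operations on the views -/

section Views

variable {m : Mem} {M : Propagation} {n p q u t v : ℕ} {x y : Loc}

@[simp] theorem readRaw_below : (m.readRaw p v).Below u t ↔ m.Below u t := by
  simp [Below, le]
@[simp] theorem readRaw_fenceView : (m.readRaw p v).FenceView q u ↔ m.FenceView q u := by
  simp [FenceView]
@[simp] theorem readRaw_seenView : (m.readRaw p v).SeenView q u ↔ m.SeenView q u := by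
  simp [SeenView]
@[simp] theorem readRaw_locView : (m.readRaw p v).LocView x u ↔ m.LocView x u := by
  simp [LocView]
@[simp] theorem readRaw_isLast : (m.readRaw p v).IsLast x u ↔ m.IsLast x u := by
  simp [IsLast]

@[simp] theorem updateRaw_below : (m.updateRaw p v).Below u t ↔ m.Below u t := by
  simp [Below, le]
@[simp] theorem updateRaw_fenceView : (m.updateRaw p v).FenceView q u ↔ m.FenceView q u := by
  simp [FenceView]
@[simp] theorem updateRaw_locView : (m.updateRaw p v).LocView x u ↔ m.LocView x u := by
  simp [LocView]
@[simp] theorem updateRaw_isLast : (m.updateRaw p v).IsLast x u ↔ m.IsLast x u := by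
  simp [IsLast]
theorem updateRaw_seenView (hv : v ∈ m.writes) :
    (m.updateRaw p v).SeenView q u ↔ m.SeenView q u ∨ (q = p ∧ m.Below u v) := by
  simp only [SeenView, updateRaw_writes, mem_updateRaw_seen, updateRaw_below]
  constructor
  · rintro ⟨t, h1, h2 | ⟨rfl, rfl⟩, h3⟩
    · exact Or.inl ⟨t, h1, h2, h3⟩
    · exact Or.inr ⟨rfl, h3⟩
  · rintro (⟨t, h1, h2, h3⟩ | ⟨rfl, h3⟩)
    · exact ⟨t, h1, Or.inl h2, h3⟩
    · exact ⟨v, hv, Or.inr ⟨rfl, rfl⟩, h3⟩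

@[simp] theorem consume_below : (m.consume v).Below u t ↔ m.Below u t := by
  simp [Below, le]
@[simp] theorem consume_fenceView : (m.consume v).FenceView q u ↔ m.FenceView q u := by
  simp [FenceView]
@[simp] theorem consume_seenView : (m.consume v).SeenView q u ↔ m.SeenView q u := by
  simp [SeenView]
@[simp] theorem consume_locView : (m.consume v).LocView x u ↔ m.LocView x u := by
  simp [LocView]
@[simp] theorem consume_isLast : (m.consume v).IsLast x u ↔ m.IsLast x u := by
  simp [IsLast]

theorem insertLt_of_ne {i a b : ℕ} {S : Set ℕ} (ha : a ≠ i) (hb : b ≠ i) :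
    m.insertLt i S a b ↔ m.lt a b := by
  simp [insertLt, ha, hb]

theorem fence_lt_of_ne {i j : ℕ} (hi : i ≠ m.fresh) (hj : j ≠ m.fresh) :
    (m.fence M p).lt i j ↔ m.lt i j := by
  cases M
  · rfl
  · exact insertLt_of_ne hi hj

theorem fence_below (ht : t ≠ m.fresh) : (m.fence M p).Below u t ↔ m.Below u t := by
  simp only [Below, fence_writes, fence_msg, le]
  refine and_congr_right fun hu => exists_congr fun w => and_congr_right fun hw => ?_
  rw [fence_lt_of_ne (ne_fresh_of_mem_writes hu) (ne_fresh_of_mem_writes hw),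
    fence_lt_of_ne (ne_fresh_of_mem_writes hw) ht]

theorem fence_seenView : (m.fence M p).SeenView q u ↔ m.SeenView q u := by
  simp only [SeenView, fence_writes, fence_msg]
  exact exists_congr fun t => and_congr_right fun ht => by
    rw [fence_below (ne_fresh_of_mem_writes ht)]

theorem fence_locView : (m.fence M p).LocView x u ↔ m.LocView x u := by
  simp only [LocView, fence_writes, fence_msg]
  exact exists_congr fun t => and_congr_right fun ht => by
    rw [fence_below (ne_fresh_of_mem_writes ht)]

theorem fence_isLast : (m.fence M p).IsLast x u ↔ m.IsLast x u := by
  simp only [IsLast, fence_writes, fence_msg]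
  exact and_congr_right fun hu => and_congr_right fun _ => forall₂_congr fun w hw => by
    rw [fence_lt_of_ne (ne_fresh_of_mem_writes hw) (ne_fresh_of_mem_writes hu)]

theorem insertLt_fresh {a : ℕ} {S : Set ℕ} (ha : a ∈ m.ids) :
    m.insertLt m.fresh S a m.fresh ↔ ∃ t ∈ m.ids, t ∈ S ∧ m.le a t := by
  simp [insertLt, ha]

/-- Cumulativity: the new fence lies above all that its issuer has seen and above its earlier
fences, so the fence view absorbs the seen view. In a multi-copy-atomic unit a fence leaves no
trace. -/
theorem fence_fenceView : (m.fence M p).FenceView q u ↔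
    m.FenceView q u ∨ (M = .causal ∧ q = p ∧ m.SeenView p u) := by
  cases M
  · simp [fence]
  have hold : ∀ t ∈ m.fences, (m.fence .causal p).issuer t = m.issuer t := fun t ht =>
    Function.update_of_ne (ne_fresh_of_mem_fences ht) _ _
  have hnew : (m.fence .causal p).issuer m.fresh = p := Function.update_self ..
  have hb : (m.fence .causal p).Below u m.fresh ↔ m.SeenView p u ∨ m.FenceView p u := by
    have hle : ∀ w ∈ m.writes, (m.fence .causal p).le w m.fresh ↔
        ∃ t ∈ m.ids, ((t ∈ m.writes ∧ p ∈ (m.msg t).seen) ∨ (t ∈ m.fences ∧ m.issuer t = p)) ∧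
          m.le w t := fun w hw => by
      rw [le, or_iff_right (ne_fresh_of_mem_writes hw)]
      exact insertLt_fresh (mem_ids_of_writes hw)
    have hlt : ∀ i ∈ m.writes, ∀ j ∈ m.writes, (m.fence .causal p).lt i j ↔ m.lt i j :=
      fun i hi j hj => fence_lt_of_ne (ne_fresh_of_mem_writes hi) (ne_fresh_of_mem_writes hj)
    constructor
    · rintro ⟨hu, w, hw, h1, h2, h3⟩
      rw [hlt u hu w hw] at h2
      obtain ⟨t, -, ⟨h4, h5⟩ | ⟨h4, h5⟩, h6⟩ := (hle w hw).1 h3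
      · exact Or.inl ⟨t, h4, h5, hu, w, hw, h1, h2, h6⟩
      · exact Or.inr ⟨t, h4, h5, hu, w, hw, h1, h2, h6⟩
    · rintro (⟨t, h4, h5, hu, w, hw, h1, h2, h6⟩ | ⟨t, h4, h5, hu, w, hw, h1, h2, h6⟩)
      · exact ⟨hu, w, hw, h1, (hlt u hu w hw).2 h2,
          (hle w hw).2 ⟨t, mem_ids_of_writes h4, Or.inl ⟨h4, h5⟩, h6⟩⟩
      · exact ⟨hu, w, hw, h1, (hlt u hu w hw).2 h2,
          (hle w hw).2 ⟨t, mem_ids_of_fences h4, Or.inr ⟨h4, h5⟩, h6⟩⟩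
  constructor
  · rintro ⟨t, ht, h1, h2⟩
    rcases Finset.mem_insert.1 ht with rfl | ht
    · rw [hnew] at h1
      subst h1
      rcases hb.1 h2 with h | h
      · exact Or.inr ⟨rfl, rfl, h⟩
      · exact Or.inl h
    · rw [hold t ht] at h1
      exact Or.inl ⟨t, ht, h1, (fence_below (ne_fresh_of_mem_fences ht)).1 h2⟩
  · rintro (⟨t, ht, h1, h2⟩ | ⟨-, rfl, h⟩)
    · exact ⟨t, Finset.mem_insert_of_mem ht, (hold t ht).trans h1,
        (fence_below (ne_fresh_of_mem_fences ht)).2 h2⟩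
    · exact ⟨m.fresh, Finset.mem_insert_self _ _, hnew, hb.2 (Or.inl h)⟩

theorem not_writeRaw_below_fresh : ¬ (m.writeRaw M n p x v).Below m.fresh t := by
  rintro ⟨-, w, -, -, h, -⟩
  exact not_writeRaw_lt_fresh h

theorem writeRaw_below (ht : t ≠ m.fresh) (hu : u ≠ m.fresh) :
    (m.writeRaw M n p x v).Below u t ↔ m.Below u t := by
  simp only [Below, writeRaw_writes, le, Finset.mem_insert, hu, false_or]
  refine and_congr_right fun _ => exists_congr fun w => ?_
  by_cases hw : w = m.fresh
  · subst hw
    have h1 : m.fresh ∉ m.writes := fun h => ne_fresh_of_mem_writes h rfl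
    have h2 : m.fresh ≠ t := fun h => ht h.symm
    simp [h1, h2, not_writeRaw_lt_fresh]
  · simp only [hw, false_or]
    rw [writeRaw_lt_of_ne hu hw, writeRaw_lt_of_ne hw ht, writeRaw_loc _ _ _ _ _ hw,
      writeRaw_loc _ _ _ _ _ hu]

/-- The new message lies above the writes to `x` and the fences of `p`. It inherits what is
overwritten below them, and it overwrites the older messages to `x` itself. -/
theorem writeRaw_below_fresh (hu : u ∈ m.writes) :
    (m.writeRaw M n p x v).Below u m.fresh ↔
      (m.msg u).loc = x ∨ m.LocView x u ∨ m.FenceView p u := by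
  have hu' := ne_fresh_of_mem_writes hu
  constructor
  · rintro ⟨-, w, hw, h1, h2, h3⟩
    rw [writeRaw_loc _ _ _ _ _ hu'] at h1
    by_cases hw' : w = m.fresh
    · subst hw'; left; simpa using h1
    right
    rw [writeRaw_loc _ _ _ _ _ hw'] at h1
    rw [writeRaw_lt_of_ne hu' hw'] at h2
    have hw := (Finset.mem_insert.1 hw).resolve_left hw'
    rw [le, or_iff_right hw', writeRaw_lt, insertLt_fresh (mem_ids_of_writes hw)] at h3
    obtain ⟨t, -, ⟨h4, h5⟩ | ⟨h4, h5⟩, h6⟩ := h3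
    · exact Or.inl ⟨t, h4, h5, hu, w, hw, h1, h2, h6⟩
    · exact Or.inr ⟨t, h4, h5, hu, w, hw, h1, h2, h6⟩
  · rintro (h | ⟨t, h4, h5, -, w, hw, h1, h2, h6⟩ | ⟨t, h4, h5, -, w, hw, h1, h2, h6⟩)
    · exact ⟨Finset.mem_insert_of_mem hu, m.fresh, Finset.mem_insert_self _ _,
        by rw [writeRaw_loc _ _ _ _ _ hu']; simpa using h, writeRaw_lt_fresh hu h, Or.inl rfl⟩
    all_goals
      have hw' := ne_fresh_of_mem_writes hw
      refine ⟨Finset.mem_insert_of_mem hu, w, Finset.mem_insert_of_mem hw,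
        by rwa [writeRaw_loc _ _ _ _ _ hu', writeRaw_loc _ _ _ _ _ hw'],
        (writeRaw_lt_of_ne hu' hw').2 h2, Or.inr ?_⟩
      rw [writeRaw_lt, insertLt_fresh (mem_ids_of_writes hw)]
    · exact ⟨t, mem_ids_of_writes h4, Or.inl ⟨h4, h5⟩, h6⟩
    · exact ⟨t, mem_ids_of_fences h4, Or.inr ⟨h4, h5⟩, h6⟩

theorem writeRaw_fenceView (hu : u ≠ m.fresh) :
    (m.writeRaw M n p x v).FenceView q u ↔ m.FenceView q u := by
  simp only [FenceView, writeRaw_fences, writeRaw_issuer]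
  exact exists_congr fun t => and_congr_right fun ht => by
    rw [writeRaw_below (ne_fresh_of_mem_fences ht) hu]

theorem writeRaw_locView_of_ne (hu : u ≠ m.fresh) (hy : y ≠ x) :
    (m.writeRaw M n p x v).LocView y u ↔ m.LocView y u := by
  constructor
  · rintro ⟨t, ht, h1, h2⟩
    by_cases ht' : t = m.fresh
    · subst ht'; simp at h1; exact absurd h1.symm hy
    · rw [writeRaw_loc _ _ _ _ _ ht'] at h1
      exact ⟨t, (Finset.mem_insert.1 ht).resolve_left ht', h1, (writeRaw_below ht' hu).1 h2⟩
  · rintro ⟨t, ht, h1, h2⟩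
    have ht' := ne_fresh_of_mem_writes ht
    exact ⟨t, Finset.mem_insert_of_mem ht, by rwa [writeRaw_loc _ _ _ _ _ ht'],
      (writeRaw_below ht' hu).2 h2⟩

theorem LocView.writeRaw (h : m.LocView y u) : (m.writeRaw M n p x v).LocView y u := by
  obtain ⟨t, ht, h1, h2⟩ := h
  have ht' := ne_fresh_of_mem_writes ht
  exact ⟨t, Finset.mem_insert_of_mem ht, by rwa [writeRaw_loc _ _ _ _ _ ht'],
    (writeRaw_below ht' (ne_fresh_of_mem_writes h2.1)).2 h2⟩

theorem writeRaw_locView_self (hu : u ∈ m.writes) :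
    (m.writeRaw M n p x v).LocView x u ↔
      (m.msg u).loc = x ∨ m.LocView x u ∨ m.FenceView p u := by
  rw [← writeRaw_below_fresh hu (M := M) (n := n) (v := v)]
  constructor
  · rintro ⟨t, ht, h1, h2⟩
    by_cases ht' : t = m.fresh
    · exact ht' ▸ h2
    · rw [writeRaw_loc _ _ _ _ _ ht'] at h1
      rw [writeRaw_below ht' (ne_fresh_of_mem_writes hu)] at h2
      exact (writeRaw_below_fresh hu).2
        (Or.inr (Or.inl ⟨t, (Finset.mem_insert.1 ht).resolve_left ht', h1, h2⟩))
  · exact fun h => ⟨m.fresh, Finset.mem_insert_self _ _, by simp, h⟩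

theorem writeRaw_seenView (hu : u ∈ m.writes) :
    (m.writeRaw M n p x v).SeenView q u ↔ m.SeenView q u ∨ (q ∈ audience M n p ∧
      ((m.msg u).loc = x ∨ m.LocView x u ∨ m.FenceView p u)) := by
  have hu' := ne_fresh_of_mem_writes hu
  rw [← writeRaw_below_fresh hu (M := M) (n := n) (v := v)]
  constructor
  · rintro ⟨t, ht, h1, h2⟩
    by_cases ht' : t = m.fresh
    · subst ht'; exact Or.inr ⟨by simpa using h1, h2⟩
    · rw [writeRaw_seen _ _ _ _ _ ht'] at h1
      rw [writeRaw_below ht' hu'] at h2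
      exact Or.inl ⟨t, (Finset.mem_insert.1 ht).resolve_left ht', h1, h2⟩
  · rintro (⟨t, ht, h1, h2⟩ | ⟨h1, h2⟩)
    · have ht' := ne_fresh_of_mem_writes ht
      exact ⟨t, Finset.mem_insert_of_mem ht, by rwa [writeRaw_seen _ _ _ _ _ ht'],
        (writeRaw_below ht' hu').2 h2⟩
    · exact ⟨m.fresh, Finset.mem_insert_self _ _, by simpa using h1, h2⟩

theorem mem_writes_of_gc (h : u ∈ (m.gc n).writes) : u ∈ m.writes :=
  ((mem_gc_writes m n u).1 h).1

theorem Below.of_gc (h : (m.gc n).Below u t) : m.Below u t :=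
  let ⟨hu, w, hw, h'⟩ := h
  ⟨mem_writes_of_gc hu, w, mem_writes_of_gc hw, h'⟩

theorem FenceView.of_gc (h : (m.gc n).FenceView p u) : m.FenceView p u :=
  let ⟨t, ht, h1, h2⟩ := h
  ⟨t, ((mem_gc_fences m n t).1 ht).1, h1, h2.of_gc⟩

theorem SeenView.of_gc (h : (m.gc n).SeenView p u) : m.SeenView p u :=
  let ⟨t, ht, h1, h2⟩ := h
  ⟨t, mem_writes_of_gc ht, h1, h2.of_gc⟩

theorem LocView.of_gc (h : (m.gc n).LocView x u) : m.LocView x u :=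
  let ⟨t, ht, h1, h2⟩ := h
  ⟨t, mem_writes_of_gc ht, h1, h2.of_gc⟩

variable {L : Loc → Prop}

/-- By causal propagation, a message that overwrites `u` is not redundant to a process to which `u`
is not redundant. Hence it survives together with `u`. -/
theorem Below.gc (h : m.Below u t) (hm : Core n L m) (hu : u ∈ (m.gc n).writes) :
    (m.gc n).Below u t := by
  obtain ⟨hu', w, hw, h1, h2, h3⟩ := h
  obtain ⟨p, hp, hr⟩ := ((mem_gc_writes m n u).1 hu).2
  exact ⟨hu, w, (mem_gc_writes m n w).2 ⟨hw, p, hp, fun h =>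
    hr (hm.causalPropagation p hp u hu' w hw h1 h2 h)⟩, h1, h2, h3⟩

/-- A fence above a surviving message is not garbage. -/
theorem FenceView.gc (h : m.FenceView p u) (hm : Core n L m) (hu : u ∈ (m.gc n).writes) :
    (m.gc n).FenceView p u := by
  obtain ⟨t, ht, h1, h2⟩ := h
  obtain ⟨hu', hr⟩ := (mem_gc_writes m n u).1 hu
  exact ⟨t, (mem_gc_fences m n t).2 ⟨ht, u, hu', hr, hm.below_lt (mem_ids_of_fences ht) h2⟩, h1,
    h2.gc hm hu⟩

/-- The seen message that witnesses the view may be deleted. In that case `acquired` provides a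
later one that the process has seen and that survives. -/
theorem SeenView.gc (h : m.SeenView p u) (hm : Core n L m) (hp : p < n)
    (hu : u ∈ (m.gc n).writes) : (m.gc n).SeenView p u := by
  obtain ⟨t, ht, h1, h2⟩ := h
  by_cases hr : p ∈ (m.msg t).redundant
  · obtain ⟨t', ht', h3, h4, h5⟩ := hm.acquired p hp t ht hr
    exact ⟨t', (mem_gc_writes m n t').2 ⟨ht', p, hp, h4⟩, h3, (hm.below_of_lt
      (mem_ids_of_writes ht) (mem_ids_of_writes ht') h2 h5).gc hm hu⟩
  · exact ⟨t, (mem_gc_writes m n t).2 ⟨ht, p, hp, hr⟩, h1, h2.gc hm hu⟩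

theorem IsLast.gc {i : ℕ} (h : m.IsLast x i) (hm : Core n L m) (hn : 0 < n) :
    (m.gc n).IsLast x i :=
  ⟨(mem_gc_writes m n i).2 ⟨h.1, 0, hn, hm.notMem_redundant_of_isLast h hn⟩, h.2.1,
    fun u hu => h.2.2 u (mem_writes_of_gc hu)⟩

/-- What is overwritten below some message to `x` is overwritten below the last one. -/
theorem LocView.below_last (h : m.LocView x u) (hm : Core n L m) {i : ℕ} (hi : m.IsLast x i) :
    m.Below u i := by
  obtain ⟨t, ht, h1, h2⟩ := h
  rcases hi.2.2 t ht h1 with rfl | h3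
  · exact h2
  · exact hm.below_of_lt (mem_ids_of_writes ht) (mem_ids_of_writes hi.1) h2 h3

/-- The view is already that of the last message to `x`, which is never garbage. -/
theorem LocView.gc (h : m.LocView x u) (hm : Core n L m) (hn : 0 < n) (hx : L x)
    (hu : u ∈ (m.gc n).writes) : (m.gc n).LocView x u := by
  obtain ⟨i, hi, hr⟩ := hm.last x hx
  exact ⟨i, (mem_gc_writes m n i).2 ⟨hi.1, 0, hn, hr 0 hn⟩, hi.2.1,
    (h.below_last hm hi).gc hm hu⟩

end Views

/-! ### Simulation between propagation units -/

/-- The propagation unit `a` is at least as permissive as `b`, as far as the messages `D` of `b`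
are concerned, which `f` maps to messages of `a`; all of them are to locations in `L`. -/
structure Sim (n : ℕ) (L : Loc → Prop) (D : Set ℕ) (f : ℕ → ℕ) (b a : Mem) : Prop where
  mem_left : ∀ u ∈ D, u ∈ b.writes
  mem_right : ∀ u ∈ D, f u ∈ a.writes
  inj : Set.InjOn f D
  isLoc : ∀ u ∈ D, L (b.msg u).loc
  loc : ∀ u ∈ D, (a.msg (f u)).loc = (b.msg u).loc
  -- The reserved location is exempt: a full fence ignores the value that it reads, and plain
  -- configurations may have any value there.
  val : ∀ u ∈ D, (b.msg u).loc ≠ none → (a.msg (f u)).val = (b.msg u).val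
  source : ∀ u ∈ D, (b.msg u).source = true → (a.msg (f u)).source = true
  seen : ∀ u ∈ D, ∀ p < n, p ∈ (b.msg u).seen → p ∈ (a.msg (f u)).seen
  redundant : ∀ u ∈ D, ∀ p < n, p ∈ (a.msg (f u)).redundant → p ∈ (b.msg u).redundant
  -- The restrictive side overwrites at least as much. These four views are closed under the
  -- operations: reads and updates consult `Below`, a fence adds the seen view to the fence view,
  -- and a write combines a location view with a fence view.
  below : ∀ u ∈ D, ∀ v ∈ D, a.Below (f u) (f v) → b.Below u v
  fenceView : ∀ u ∈ D, ∀ p < n, a.FenceView p (f u) → b.FenceView p u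
  seenView : ∀ u ∈ D, ∀ p < n, a.SeenView p (f u) → b.SeenView p u
  locView : ∀ u ∈ D, ∀ x, L x → a.LocView x (f u) → b.LocView x u

namespace Sim

variable {n : ℕ} {L L' : Loc → Prop} {D : Set ℕ} {f : ℕ → ℕ} {b b' a : Mem}

/-- The restrictive side may become more restrictive. -/
theorem mono_left (h : Sim n L D f b a) {D' : Set ℕ} (hD : D' ⊆ D)
    (hmem : ∀ u ∈ D', u ∈ b'.writes)
    (hloc : ∀ u ∈ D', (b'.msg u).loc = (b.msg u).loc)
    (hval : ∀ u ∈ D', (b'.msg u).val = (b.msg u).val)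
    (hsource : ∀ u ∈ D', (b'.msg u).source = true → (b.msg u).source = true)
    (hseen : ∀ u ∈ D', ∀ p < n, p ∈ (b'.msg u).seen → p ∈ (b.msg u).seen)
    (hred : ∀ u ∈ D', ∀ p < n, p ∈ (b.msg u).redundant → p ∈ (b'.msg u).redundant)
    (hbelow : ∀ u ∈ D', ∀ v ∈ D', b.Below u v → b'.Below u v)
    (hfence : ∀ u ∈ D', ∀ p < n, b.FenceView p u → b'.FenceView p u)
    (hseenv : ∀ u ∈ D', ∀ p < n, b.SeenView p u → b'.SeenView p u)
    (hlocv : ∀ u ∈ D', ∀ x, L x → b.LocView x u → b'.LocView x u) :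
    Sim n L D' f b' a where
  mem_left := hmem
  mem_right u hu := h.mem_right u (hD hu)
  inj := h.inj.mono hD
  isLoc u hu := by rw [hloc u hu]; exact h.isLoc u (hD hu)
  loc u hu := by rw [hloc u hu]; exact h.loc u (hD hu)
  val u hu := by rw [hloc u hu, hval u hu]; exact h.val u (hD hu)
  source u hu hs := h.source u (hD hu) (hsource u hu hs)
  seen u hu p hp hs := h.seen u (hD hu) p hp (hseen u hu p hp hs)
  redundant u hu p hp hs := hred u hu p hp (h.redundant u (hD hu) p hp hs)
  below u hu v hv hs := hbelow u hu v hv (h.below u (hD hu) v (hD hv) hs)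
  fenceView u hu p hp hs := hfence u hu p hp (h.fenceView u (hD hu) p hp hs)
  seenView u hu p hp hs := hseenv u hu p hp (h.seenView u (hD hu) p hp hs)
  locView u hu x hx hs := hlocv u hu x hx (h.locView u (hD hu) x hx hs)

/-- Deleting messages on the restrictive side only shrinks the correspondence, because the views of
the surviving messages are unchanged. -/
theorem gc_left (h : Sim n L D f b a) (hb : Core n L' b) (hL : ∀ x, L x → L' x) (hn : 0 < n) :
    Sim n L {u | u ∈ D ∧ u ∈ (b.gc n).writes} f (b.gc n) a :=
  h.mono_left (fun _ hu => hu.1) (fun _ hu => hu.2) (fun _ _ => rfl) (fun _ _ => rfl)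
    (fun _ _ => id) (fun _ _ _ _ => id) (fun _ _ _ _ => id)
    (fun _ hu _ _ hb' => hb'.gc hb hu.2) (fun _ hu _ _ hb' => hb'.gc hb hu.2)
    (fun _ hu _ hp hb' => hb'.gc hb hp hu.2)
    (fun _ hu _ hx hb' => hb'.gc hb hn (hL _ hx) hu.2)

theorem gc (h : Sim n L D f b a) (hb : Core n L' b) (hL : ∀ x, L x → L' x) (hn : 0 < n) :
    Sim n L {u | u ∈ D ∧ u ∈ (b.gc n).writes} f (b.gc n) (a.gc n) :=
  let g := h.gc_left hb hL hn
  { g with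
    -- A message kept on the restrictive side is not redundant to some process there, hence not on
    -- the permissive side either, and is kept there as well.
    mem_right := fun u hu => by
      obtain ⟨p, hp, hr⟩ := ((mem_gc_writes b n u).1 hu.2).2
      exact (mem_gc_writes a n _).2 ⟨h.mem_right u hu.1, p, hp,
        fun h' => hr (h.redundant u hu.1 p hp h')⟩
    below := fun u hu v hv h' => g.below u hu v hv h'.of_gc
    fenceView := fun u hu p hp h' => g.fenceView u hu p hp h'.of_gc
    seenView := fun u hu p hp h' => g.seenView u hu p hp h'.of_gc
    locView := fun u hu x hx h' => g.locView u hu x hx h'.of_gc }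

theorem readRaw_left (h : Sim n L D f b a) (p v : ℕ) : Sim n L D f (b.readRaw p v) a :=
  h.mono_left subset_rfl h.mem_left (by simp) (by simp) (by simp) (by simp)
    (by simp +contextual) (by simp) (by simp) (by simp) (by simp)

theorem readRaw (h : Sim n L D f b a) (p : ℕ) {v : ℕ} (hv : v ∈ D) :
    Sim n L D f (b.readRaw p v) (a.readRaw p (f v)) :=
  let g := h.readRaw_left p v
  { g with
    loc := fun u hu => by simpa using h.loc u hu
    val := fun u hu => by simpa using h.val u hu
    source := fun u hu => by simpa using h.source u hu
    seen := fun u hu => by simpa using h.seen u hu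
    redundant := fun u hu q hq => by
      simp only [mem_readRaw_redundant]
      exact Or.imp (h.redundant u hu q hq) (And.imp_left (h.below u hu v hv))
    below := fun u hu v hv => by simpa using h.below u hu v hv
    fenceView := fun u hu p hp => by simpa using h.fenceView u hu p hp
    seenView := fun u hu p hp => by simpa using h.seenView u hu p hp
    locView := fun u hu x hx => by simpa using h.locView u hu x hx }

theorem updateRaw_left (h : Sim n L D f b a) (p : ℕ) {v : ℕ} (hv : v ∈ b.writes) (hvD : v ∉ D) :
    Sim n L D f (b.updateRaw p v) a :=
  h.mono_left subset_rfl h.mem_left (by simp) (by simp) (by simp)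
    (fun u hu q hq => by
      rw [mem_updateRaw_seen]
      exact fun h' => h'.resolve_right fun h'' => hvD (h''.1 ▸ hu))
    (by simp +contextual) (by simp) (by simp)
    (fun u hu q hq h' => (updateRaw_seenView hv).2 (Or.inl h')) (by simp)

theorem updateRaw (h : Sim n L D f b a) (hb : Core n L' b) (p : ℕ) {v : ℕ} (hv : v ∈ D) :
    Sim n L D f (b.updateRaw p v) (a.updateRaw p (f v)) where
  mem_left := h.mem_left
  mem_right := h.mem_right
  inj := h.inj
  isLoc u hu := by simpa using h.isLoc u hu
  loc u hu := by simpa using h.loc u hu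
  val u hu := by simpa using h.val u hu
  source u hu := by simpa using h.source u hu
  seen u hu q hq := by
    simp only [mem_updateRaw_seen]
    exact Or.imp (h.seen u hu q hq) (And.imp_left (congrArg f))
  redundant u hu q hq := by
    simp only [mem_updateRaw_redundant]
    refine Or.imp (h.redundant u hu q hq) (And.imp_left ?_)
    rintro ⟨-, h1, h2⟩
    have hl : (b.msg u).loc = (b.msg v).loc := by rw [← h.loc u hu, ← h.loc v hv, h1]
    exact ⟨h.mem_left u hu, hl, hb.below_lt (mem_ids_of_writes (h.mem_left v hv))
      (h.below u hu v hv ⟨h.mem_right u hu, f v, h.mem_right v hv, h1, h2, Or.inl rfl⟩)⟩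
  below u hu v hv := by simpa using h.below u hu v hv
  fenceView u hu p hp := by simpa using h.fenceView u hu p hp
  seenView u hu q hq := by
    rw [updateRaw_seenView (h.mem_left v hv), updateRaw_seenView (h.mem_right v hv)]
    exact Or.imp (h.seenView u hu q hq) (And.imp_right (h.below u hu v hv))
  locView u hu x hx := by simpa using h.locView u hu x hx

theorem fence_left (h : Sim n L D f b a) (M : Propagation) (p : ℕ) :
    Sim n L D f (b.fence M p) a :=
  h.mono_left subset_rfl (by simpa using h.mem_left) (by simp) (by simp) (by simp) (by simp)
    (by simp) (fun u hu v hv => (fence_below (ne_fresh_of_mem_writes (h.mem_left v hv))).2)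
    (fun u hu q hq h' => fence_fenceView.2 (Or.inl h')) (fun u hu q hq => fence_seenView.2)
    (fun u hu q hq => fence_locView.2)

theorem fence (h : Sim n L D f b a) (M : Propagation) {p : ℕ} (hp : p < n) :
    Sim n L D f (b.fence M p) (a.fence M p) where
  mem_left := by simpa using h.mem_left
  mem_right := by simpa using h.mem_right
  inj := h.inj
  isLoc u hu := by simpa using h.isLoc u hu
  loc u hu := by simpa using h.loc u hu
  val u hu := by simpa using h.val u hu
  source u hu := by simpa using h.source u hu
  seen u hu := by simpa using h.seen u hu
  redundant u hu := by simpa using h.redundant u hu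
  below u hu v hv := by
    rw [fence_below (ne_fresh_of_mem_writes (h.mem_left v hv)),
      fence_below (ne_fresh_of_mem_writes (h.mem_right v hv))]
    exact h.below u hu v hv
  fenceView u hu q hq := by
    simp only [fence_fenceView]
    exact Or.imp (h.fenceView u hu q hq) (And.imp_right (And.imp_right (h.seenView u hu p hp)))
  seenView u hu q hq := by simpa only [fence_seenView] using h.seenView u hu q hq
  locView u hu x hx := by simpa only [fence_locView] using h.locView u hu x hx

theorem consume_left (h : Sim n L D f b a) (v : ℕ) : Sim n L D f (b.consume v) a :=
  h.mono_left subset_rfl h.mem_left (by simp) (by simp)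
    (fun u hu h' => ((consume_source_eq_true v).1 h').2) (by simp) (by simp) (by simp) (by simp)
    (by simp) (by simp)

theorem consume (h : Sim n L D f b a) {v : ℕ} (hv : v ∈ D) :
    Sim n L D f (b.consume v) (a.consume (f v)) :=
  let g := h.consume_left v
  { g with
    loc := fun u hu => by simpa using h.loc u hu
    val := fun u hu => by simpa using h.val u hu
    source := fun u hu => by
      rw [consume_source_eq_true, consume_source_eq_true]
      exact And.imp (mt fun h' => h.inj hu hv h') (h.source u hu)
    seen := fun u hu => by simpa using h.seen u hu
    redundant := fun u hu => by simpa using h.redundant u hu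
    below := fun u hu v hv => by simpa using h.below u hu v hv
    fenceView := fun u hu p hp => by simpa using h.fenceView u hu p hp
    seenView := fun u hu p hp => by simpa using h.seenView u hu p hp
    locView := fun u hu x hx => by simpa using h.locView u hu x hx }

theorem writeRaw_left (h : Sim n L D f b a) (M : Propagation) (p : ℕ) (x : Loc) (v : ℕ) :
    Sim n L D f (b.writeRaw M n p x v) a := by
  have hw := fun u hu => h.mem_left u hu
  have hf := fun u hu => ne_fresh_of_mem_writes (h.mem_left u hu)
  exact h.mono_left subset_rfl (fun u hu => Finset.mem_insert_of_mem (hw u hu))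
    (fun u hu => writeRaw_loc _ _ _ _ _ (hf u hu)) (fun u hu => writeRaw_val _ _ _ _ _ (hf u hu))
    (fun u hu => by rw [writeRaw_source _ _ _ _ _ (hf u hu)]; exact id)
    (fun u hu q hq => by rw [writeRaw_seen _ _ _ _ _ (hf u hu)]; exact id)
    (fun u hu q hq => by rw [mem_writeRaw_redundant _ _ _ _ _ _ (hf u hu)]; exact Or.inl)
    (fun u hu w hw => (writeRaw_below (hf w hw) (hf u hu)).2)
    (fun u hu q hq => (writeRaw_fenceView (hf u hu)).2)
    (fun u hu q hq h' => (writeRaw_seenView (hw u hu)).2 (Or.inl h'))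
    (fun u hu x hx h' => h'.writeRaw)

/-- What the new messages overwrite is determined on both sides by their location, by its location
view and by the fence view of the writer, and these are compared by hypothesis. Nothing lies above a
new message, so it is itself in no view. -/
theorem writeRaw (h : Sim n L D f b a) (M : Propagation) {p : ℕ} (hp : p < n) {x : Loc}
    (hx : L x) (v : ℕ) :
    Sim n L (insert b.fresh D) (Function.update f b.fresh a.fresh)
      (b.writeRaw M n p x v) (a.writeRaw M n p x v) := by
  have hw := fun u hu => h.mem_left u hu
  have hf := fun u hu => ne_fresh_of_mem_writes (h.mem_left u hu)
  have hw' := fun u hu => h.mem_right u hu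
  have hf' := fun u hu => ne_fresh_of_mem_writes (h.mem_right u hu)
  have hg : ∀ u ∈ D, Function.update f b.fresh a.fresh u = f u := fun u hu =>
    Function.update_of_ne (hf u hu) _ _
  have hnew : ∀ u ∈ D, ((a.msg (f u)).loc = x ∨ a.LocView x (f u) ∨ a.FenceView p (f u)) →
      ((b.msg u).loc = x ∨ b.LocView x u ∨ b.FenceView p u) := fun u hu => by
    rw [h.loc u hu]
    exact Or.imp_right (Or.imp (h.locView u hu x hx) (h.fenceView u hu p hp))
  refine ⟨?_, ?_, ?_, ?_, ?_, ?_, ?_, ?_, ?_, ?_, ?_, ?_, ?_⟩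
  · rintro u (rfl | hu)
    · exact Finset.mem_insert_self _ _
    · exact Finset.mem_insert_of_mem (hw u hu)
  · rintro u (rfl | hu)
    · simp
    · rw [hg u hu]; exact Finset.mem_insert_of_mem (hw' u hu)
  · rintro u (rfl | hu) w (rfl | hw) he
    · rfl
    · rw [hg w hw, Function.update_self] at he
      exact absurd he.symm (hf' w hw)
    · rw [hg u hu, Function.update_self] at he
      exact absurd he (hf' u hu)
    · rw [hg u hu, hg w hw] at he; exact h.inj hu hw he
  · rintro u (rfl | hu)
    · simpa using hx
    · rw [writeRaw_loc _ _ _ _ _ (hf u hu)]; exact h.isLoc u hu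
  · rintro u (rfl | hu)
    · simp
    · rw [hg u hu, writeRaw_loc _ _ _ _ _ (hf u hu), writeRaw_loc _ _ _ _ _ (hf' u hu)]
      exact h.loc u hu
  · rintro u (rfl | hu)
    · simp
    · rw [hg u hu, writeRaw_loc _ _ _ _ _ (hf u hu), writeRaw_val _ _ _ _ _ (hf' u hu),
        writeRaw_val _ _ _ _ _ (hf u hu)]
      exact h.val u hu
  · rintro u (rfl | hu)
    · simp
    · rw [hg u hu, writeRaw_source _ _ _ _ _ (hf u hu), writeRaw_source _ _ _ _ _ (hf' u hu)]
      exact h.source u hu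
  · rintro u (rfl | hu)
    · simp
    · rw [hg u hu, writeRaw_seen _ _ _ _ _ (hf u hu), writeRaw_seen _ _ _ _ _ (hf' u hu)]
      exact h.seen u hu
  · rintro u (rfl | hu) q hq
    · simp
    · rw [hg u hu, mem_writeRaw_redundant _ _ _ _ _ _ (hf u hu),
        mem_writeRaw_redundant _ _ _ _ _ _ (hf' u hu), h.loc u hu]
      exact Or.imp (h.redundant u hu q hq)
        (And.imp_left (And.imp_left fun _ => hw u hu))
  · rintro u (rfl | hu) w (rfl | hw')
    · rw [Function.update_self]; exact fun h' => absurd h' not_writeRaw_below_fresh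
    · rw [Function.update_self]; exact fun h' => absurd h' not_writeRaw_below_fresh
    · rw [Function.update_self, hg u hu, writeRaw_below_fresh (hw u hu),
        writeRaw_below_fresh (h.mem_right u hu)]
      exact hnew u hu
    · rw [hg u hu, hg w hw', writeRaw_below (hf w hw') (hf u hu),
        writeRaw_below (hf' w hw') (hf' u hu)]
      exact h.below u hu w hw'
  · rintro u (rfl | hu) q hq
    · rw [Function.update_self]
      rintro ⟨t, -, -, h'⟩
      exact absurd h' not_writeRaw_below_fresh
    · rw [hg u hu, writeRaw_fenceView (hf u hu), writeRaw_fenceView (hf' u hu)]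
      exact h.fenceView u hu q hq
  · rintro u (rfl | hu) q hq
    · rw [Function.update_self]
      rintro ⟨t, -, -, h'⟩
      exact absurd h' not_writeRaw_below_fresh
    · rw [hg u hu, writeRaw_seenView (hw u hu), writeRaw_seenView (hw' u hu)]
      exact Or.imp (h.seenView u hu q hq) (And.imp_right (hnew u hu))
  · rintro u (rfl | hu) y hy
    · rw [Function.update_self]
      rintro ⟨t, -, -, h'⟩
      exact absurd h' not_writeRaw_below_fresh
    · rw [hg u hu]
      by_cases hyx : y = x
      · subst hyx
        rw [writeRaw_locView_self (hw u hu), writeRaw_locView_self (hw' u hu)]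
        exact hnew u hu
      · rw [writeRaw_locView_of_ne (hf u hu) hyx, writeRaw_locView_of_ne (hf' u hu) hyx]
        exact h.locView u hu y hy

end Sim

end Mem

/-! ### Actions on the propagation unit and their simulation -/

/-- What a step of a process asks of the propagation unit. -/
inductive MemAction
  | tau
  | read (x v : ℕ)
  | write (x v : ℕ)
  | fence
  | rmw (x : Loc) (r v : ℕ)

/-- The location accessed, if any, belongs to `L`. -/
def MemAction.LocsIn (L : Loc → Prop) : MemAction → Prop
  | .tau => True
  | .read x _ => L (some x)
  | .write x _ => L (some x)
  | .fence => True
  | .rmw x _ _ => L x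

namespace Mem

/-- The propagation unit performs an action of the process `p`. -/
def Act (M : Propagation) (n p : ℕ) (act : MemAction) (m m' : Mem) : Prop :=
  match act with
  | .tau => m' = m
  | .read x v => ∃ v₀, m.Readable p (some x) v₀ ∧ (m.msg v₀).val = v ∧ m' = m.read n p v₀
  | .write x v => m' = m.write M n p (some x) v
  | .fence => m' = m.fence M p
  -- A full fence does not depend on the value that it reads, so at the reserved location `r` is
  -- arbitrary.
  | .rmw x r v => ∃ v₀, m.RmwReadable p x v₀ ∧ (x = none ∨ (m.msg v₀).val = r) ∧
      m' = m.rmw M n p x v₀ v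

theorem RmwReadable.isLast {n : ℕ} {L : Loc → Prop} {m : Mem} {p v : ℕ} {x : Loc}
    (h : m.RmwReadable p x v) (hm : Core n L m) : m.IsLast x v :=
  hm.isLast_iff.2 ⟨h.1.1, h.1.2.1, h.2.2⟩

/-- A simulation in which every message of the restrictive side outside `D` to a location in `L`
is redundant to the processes in `post`, and is overwritten below some message to `flag`. -/
structure Rel (n : ℕ) (L L' : Loc → Prop) (flag : Loc) (post : Set ℕ) (D : Set ℕ) (f : ℕ → ℕ)
    (b a : Mem) : Prop where
  core : Core n L' b
  sim : Sim n L D f b a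
  -- The view of `flag` prepares for processes that are not yet in `post`: whoever reads the last
  -- message to `flag` thereby makes these messages redundant to itself.
  old : ∀ v ∈ b.writes, L (b.msg v).loc → v ∉ D →
    b.LocView flag v ∧ ∀ p < n, p ∈ post → p ∈ (b.msg v).redundant

namespace Rel

variable {n : ℕ} {L L' : Loc → Prop} {flag : Loc} {post : Set ℕ} {D : Set ℕ} {f : ℕ → ℕ}
  {b a : Mem} {M : Propagation} {p v : ℕ} {x : Loc}

theorem gc_old (h : Rel n L L' flag post D f b a) (hn : 0 < n) (hflag : L' flag) :
    ∀ v ∈ (b.gc n).writes, L ((b.gc n).msg v).loc → v ∉ {u | u ∈ D ∧ u ∈ (b.gc n).writes} →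
    (b.gc n).LocView flag v ∧ ∀ p < n, p ∈ post → p ∈ ((b.gc n).msg v).redundant :=
  fun v hv hl hD =>
    let ⟨h1, h2⟩ := h.old v (mem_writes_of_gc hv) hl fun h' => hD ⟨h', hv⟩
    ⟨h1.gc h.core hn hflag hv, h2⟩

theorem gc_left (h : Rel n L L' flag post D f b a) (hL : ∀ x, L x → L' x) (hn : 0 < n)
    (hflag : L' flag) :
    Rel n L L' flag post {u | u ∈ D ∧ u ∈ (b.gc n).writes} f (b.gc n) a :=
  ⟨h.core.gc hn, h.sim.gc_left h.core hL hn, h.gc_old hn hflag⟩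

theorem gc (h : Rel n L L' flag post D f b a) (hL : ∀ x, L x → L' x) (hn : 0 < n)
    (hflag : L' flag) :
    Rel n L L' flag post {u | u ∈ D ∧ u ∈ (b.gc n).writes} f (b.gc n) (a.gc n) :=
  ⟨h.core.gc hn, h.sim.gc h.core hL hn, h.gc_old hn hflag⟩

theorem readRaw_old (h : Rel n L L' flag post D f b a) (p v : ℕ) :
    ∀ u ∈ (b.readRaw p v).writes, L ((b.readRaw p v).msg u).loc → u ∉ D →
    (b.readRaw p v).LocView flag u ∧
      ∀ q < n, q ∈ post → q ∈ ((b.readRaw p v).msg u).redundant := fun u hu hl hD => by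
  have := h.old u hu (by simpa using hl) hD
  simp only [readRaw_locView, mem_readRaw_redundant]
  exact ⟨this.1, fun q hq hq' => Or.inl (this.2 q hq hq')⟩

theorem readRaw (h : Rel n L L' flag post D f b a) (hv : v ∈ D)
    (hs : p ∈ (b.msg v).seen) (hr : p ∉ (b.msg v).redundant) :
    Rel n L L' flag post D f (b.readRaw p v) (a.readRaw p (f v)) :=
  ⟨h.core.readRaw (h.sim.mem_left v hv) hs hr, h.sim.readRaw p hv, h.readRaw_old p v⟩

/-- After reading the last message to `flag`, messages outside `D` are redundant. -/
theorem readRaw_flag (h : Rel n L L' flag post D f b a) (hv : b.IsLast flag v)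
    (hs : p ∈ (b.msg v).seen) (hr : p ∉ (b.msg v).redundant) :
    Rel n L L' flag (insert p post) D f (b.readRaw p v) a := by
  refine ⟨h.core.readRaw hv.1 hs hr, h.sim.readRaw_left p v, fun u hu hl hD =>
    ⟨(h.readRaw_old p v u hu hl hD).1, fun q hq hq' => ?_⟩⟩
  rcases hq' with rfl | hq'
  · rw [mem_readRaw_redundant]
    exact Or.inr ⟨(h.old u hu (by simpa using hl) hD).1.below_last h.core hv, rfl⟩
  · exact (h.readRaw_old p v u hu hl hD).2 q hq hq'

theorem updateRaw_old (h : Rel n L L' flag post D f b a) (p v : ℕ) :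
    ∀ u ∈ (b.updateRaw p v).writes, L ((b.updateRaw p v).msg u).loc → u ∉ D →
    (b.updateRaw p v).LocView flag u ∧
      ∀ q < n, q ∈ post → q ∈ ((b.updateRaw p v).msg u).redundant := fun u hu hl hD => by
  have := h.old u hu (by simpa using hl) hD
  simp only [updateRaw_locView, mem_updateRaw_redundant]
  exact ⟨this.1, fun q hq hq' => Or.inl (this.2 q hq hq')⟩

theorem updateRaw_left (h : Rel n L L' flag post D f b a) (hv : v ∈ b.writes) (hvD : v ∉ D)
    (hr : p ∉ (b.msg v).redundant) :
    Rel n L L' flag post D f (b.updateRaw p v) a :=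
  ⟨h.core.updateRaw hv hr, h.sim.updateRaw_left p hv hvD, h.updateRaw_old p v⟩

theorem updateRaw (h : Rel n L L' flag post D f b a) (hv : v ∈ D)
    (hr : p ∉ (b.msg v).redundant) :
    Rel n L L' flag post D f (b.updateRaw p v) (a.updateRaw p (f v)) :=
  ⟨h.core.updateRaw (h.sim.mem_left v hv) hr, h.sim.updateRaw h.core p hv, h.updateRaw_old p v⟩

theorem fence_old (h : Rel n L L' flag post D f b a) (M : Propagation) (p : ℕ) :
    ∀ u ∈ (b.fence M p).writes, L ((b.fence M p).msg u).loc → u ∉ D →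
    (b.fence M p).LocView flag u ∧
      ∀ q < n, q ∈ post → q ∈ ((b.fence M p).msg u).redundant := by
  simpa only [fence_writes, fence_msg, fence_locView] using h.old

theorem fence_left (h : Rel n L L' flag post D f b a) (M : Propagation) (hp : p < n) :
    Rel n L L' flag post D f (b.fence M p) a :=
  ⟨h.core.fence M hp, h.sim.fence_left M p, h.fence_old M p⟩

theorem fence (h : Rel n L L' flag post D f b a) (M : Propagation) (hp : p < n) :
    Rel n L L' flag post D f (b.fence M p) (a.fence M p) :=
  ⟨h.core.fence M hp, h.sim.fence M hp, h.fence_old M p⟩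

theorem consume_left (h : Rel n L L' flag post D f b a) (v : ℕ) :
    Rel n L L' flag post D f (b.consume v) a :=
  ⟨h.core.consume v, h.sim.consume_left v, by simpa using h.old⟩

theorem consume (h : Rel n L L' flag post D f b a) (hv : v ∈ D) :
    Rel n L L' flag post D f (b.consume v) (a.consume (f v)) :=
  ⟨h.core.consume v, h.sim.consume hv, by simpa using h.old⟩

/-- The new message is to a location outside `L`, in the application the flag, and needs no
counterpart. -/
theorem writeRaw_left (h : Rel n L L' flag post D f b a) (M : Propagation) (p v : ℕ)
    (hx : ¬ L x) (hx' : L' x) : Rel n L L' flag post D f (b.writeRaw M n p x v) a := by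
  refine ⟨h.core.writeRaw M hx' v, h.sim.writeRaw_left M p x v, fun u hu hl hD => ?_⟩
  by_cases hu' : u = b.fresh
  · subst hu'; simp at hl; exact absurd hl hx
  rw [writeRaw_loc _ _ _ _ _ hu'] at hl
  have := h.old u ((Finset.mem_insert.1 hu).resolve_left hu') hl hD
  refine ⟨this.1.writeRaw, fun q hq hq' => ?_⟩
  rw [mem_writeRaw_redundant _ _ _ _ _ _ hu']
  exact Or.inl (this.2 q hq hq')

theorem writeRaw (h : Rel n L L' flag post D f b a) (hL : ∀ x, L x → L' x) (M : Propagation)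
    (hp : p < n) (v : ℕ) (hx : L x) :
    Rel n L L' flag post (insert b.fresh D) (Function.update f b.fresh a.fresh)
      (b.writeRaw M n p x v) (a.writeRaw M n p x v) := by
  refine ⟨h.core.writeRaw M (hL x hx) v, h.sim.writeRaw M hp hx v, fun u hu hl hD => ?_⟩
  have hu' : u ≠ b.fresh := fun h' => hD (Or.inl h')
  rw [writeRaw_loc _ _ _ _ _ hu'] at hl
  have := h.old u ((Finset.mem_insert.1 hu).resolve_left hu') hl fun h' => hD (Or.inr h')
  refine ⟨this.1.writeRaw, fun q hq hq' => ?_⟩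
  rw [mem_writeRaw_redundant _ _ _ _ _ _ hu']
  exact Or.inl (this.2 q hq hq')

end Rel

/-- `Mem.Rel` for some correspondence of messages. -/
def Related (n : ℕ) (L L' : Loc → Prop) (flag : Loc) (post : Set ℕ) (b a : Mem) : Prop :=
  ∃ D f, Rel n L L' flag post D f b a

namespace Related

variable {n : ℕ} {L L' : Loc → Prop} {flag : Loc} {post : Set ℕ}
  {b b' a : Mem} {M : Propagation} {p v : ℕ} {x : Loc}

/-- Messages without a counterpart are redundant to the processes in `post` and hence unreadable for
them. -/
theorem mem_of_readable {D : Set ℕ} {f : ℕ → ℕ} (h : Rel n L L' flag post D f b a) (hp : p < n)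
    (hpost : p ∈ post) (hx : L x) (hr : b.Readable p x v) : v ∈ D := by
  by_contra hv
  exact hr.2.2.2 ((h.old v hr.1 (hr.2.1.symm ▸ hx) hv).2 p hp hpost)

theorem readable {D : Set ℕ} {f : ℕ → ℕ} (h : Rel n L L' flag post D f b a) (hp : p < n)
    (hv : v ∈ D) (hr : b.Readable p x v) : a.Readable p x (f v) :=
  ⟨h.sim.mem_right v hv, (h.sim.loc v hv).trans hr.2.1, h.sim.seen v hv p hp hr.2.2.1,
    fun h' => hr.2.2.2 (h.sim.redundant v hv p hp h')⟩

/-- A process to which the messages outside the correspondence are redundant is simulated. -/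
theorem act (h : Related n L L' flag post b a) (hL : ∀ x, L x → L' x) (hflag : L' flag)
    (hp : p < n) (hpost : p ∈ post) {act : MemAction} (hact : act.LocsIn L)
    (hb : b.Act M n p act b') :
    ∃ a', a.Act M n p act a' ∧ Related n L L' flag post b' a' := by
  have hn : 0 < n := by omega
  obtain ⟨D, f, h⟩ := h
  cases act with
  | tau => cases hb; exact ⟨a, rfl, D, f, h⟩
  | read x v =>
    obtain ⟨v₀, hr, hv, rfl⟩ := hb
    have hD := mem_of_readable h hp hpost hact hr
    refine ⟨_, ⟨f v₀, readable h hp hD hr, ?_, rfl⟩, _, _,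
      (h.readRaw hD hr.2.2.1 hr.2.2.2).gc hL hn hflag⟩
    rw [h.sim.val v₀ hD (by simp [hr.2.1]), hv]
  | write x v =>
    cases hb
    exact ⟨_, rfl, _, _, (h.writeRaw hL M hp v hact).gc hL hn hflag⟩
  | fence => cases hb; exact ⟨_, rfl, _, _, h.fence M hp⟩
  | rmw x r v =>
    obtain ⟨v₀, hr, hv, rfl⟩ := hb
    have hD := mem_of_readable h hp hpost hact hr.1
    have hlast := hr.isLast h.core
    refine ⟨_, ⟨f v₀, ⟨readable h hp hD hr.1, h.sim.source v₀ hD hr.2.1, ?_⟩, ?_, rfl⟩, ?_⟩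
    -- If the source had a successor on the permissive side, it would be overwritten below a message
    -- to its own location. The comparison of location views carries this over to the restrictive
    -- side, where the source is last.
    · intro w hw hwx hlt
      have hloc := h.sim.loc v₀ hD
      obtain ⟨t, ht, hx, hb⟩ := h.sim.locView v₀ hD x hact ⟨w, hw, hwx, h.sim.mem_right v₀ hD,
        w, hw, by rw [hwx, hloc, hr.1.2.1], hlt, Or.inl rfl⟩
      exact (h.core.isLast_iff.1 hlast).2.2 t ht hx (h.core.below_lt (mem_ids_of_writes ht) hb)
    · refine or_iff_not_imp_left.2 fun hx => ?_
      rw [h.sim.val v₀ hD (by rw [hr.1.2.1]; exact hx), hv.resolve_left hx]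
    · have h1 := h.readRaw hD hr.1.2.2.1 hr.1.2.2.2
      have hr' := h1.core.notMem_redundant_of_isLast (readRaw_isLast.2 hlast) hp
      have h2 := (h1.gc hL hn hflag).fence M hp
      exact ⟨_, _, ((h2.consume ⟨hD, (mem_gc_writes _ _ _).2
        ⟨hr.1.1, p, hp, hr'⟩⟩).writeRaw hL M hp v hact).gc hL hn hflag⟩

/-- If the message seen has no counterpart, the permissive side simply waits. -/
theorem update (h : Related n L L' flag post b a) (hL : ∀ x, L x → L' x) (hflag : L' flag)
    (hp : p < n) (hv : v ∈ b.writes) (hr : p ∉ (b.msg v).redundant) :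
    Related n L L' flag post (b.update n p v) a ∨
      ∃ w ∈ a.writes, p ∉ (a.msg w).redundant ∧
        Related n L L' flag post (b.update n p v) (a.update n p w) := by
  have hn : 0 < n := by omega
  obtain ⟨D, f, h⟩ := h
  by_cases hD : v ∈ D
  · exact Or.inr ⟨f v, h.sim.mem_right v hD, fun h' => hr (h.sim.redundant v hD p hp h'), _, _,
      (h.updateRaw hD hr).gc hL hn hflag⟩
  · exact Or.inl ⟨_, _, (h.updateRaw_left hv hD hr).gc_left hL hn hflag⟩

/-- The read inside the RMW takes the last message to `flag`. Every message without a counterpart is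
overwritten below it and becomes redundant to the reader. The permissive side does not move. -/
theorem rmw_flag (h : Related n L L' flag post b a) (hL : ∀ x, L x → L' x) (hflag : L' flag)
    (hflag' : ¬ L flag) (hp : p < n) (hr : b.RmwReadable p flag v) (w : ℕ) :
    Related n L L' flag (insert p post) (b.rmw M n p flag v w) a := by
  have hn : 0 < n := by omega
  obtain ⟨D, f, h⟩ := h
  exact ⟨_, _, ((((h.readRaw_flag (hr.isLast h.core) hr.1.2.2.1 hr.1.2.2.2).gc_left hL hn
    hflag).fence_left M hp).consume_left v |>.writeRaw_left M p w hflag' hflag).gc_left hL hn hflag⟩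

/-- Messages to distinct locations are related to messages with the same contents, if the latter
are the only ones to their locations. -/
theorem of_unique (hcore : Core n L' b) {D : Set ℕ} (hDlast : ∀ u ∈ D, ∃ x, L x ∧ b.IsLast x u)
    (hold : ∀ v ∈ b.writes, L (b.msg v).loc → v ∉ D →
      b.LocView flag v ∧ ∀ p < n, p ∈ post → p ∈ (b.msg v).redundant)
    (ha : ∀ x, L x → ∃ v ∈ a.writes, (a.msg v).loc = x ∧ (a.msg v).source = true ∧
      (∀ p < n, p ∈ (a.msg v).seen ∧ p ∉ (a.msg v).redundant) ∧
      (∀ u ∈ D, b.IsLast x u → x ≠ none → (a.msg v).val = (b.msg u).val))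
    (hlt : ∀ u ∈ a.writes, ∀ v ∈ a.writes, L (a.msg u).loc → (a.msg u).loc = (a.msg v).loc →
      ¬ a.lt u v) :
    Related n L L' flag post b a := by
  classical
  choose! g hg using ha
  -- On the permissive side nothing is overwritten, so all conditions on views hold vacuously.
  have hbelow : ∀ u, L (a.msg u).loc → ∀ t, ¬ a.Below u t := by
    rintro u hu t ⟨h1, w, hw, h2, h3, -⟩
    exact hlt u h1 w hw hu h2 h3
  have hx : ∀ u ∈ D, L (b.msg u).loc ∧ b.IsLast (b.msg u).loc u := fun u hu => by
    obtain ⟨x, hx, h⟩ := hDlast u hu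
    rw [h.2.1]; exact ⟨hx, h⟩
  have hb : ∀ u ∈ D, ∀ t, ¬ a.Below (g (b.msg u).loc) t := fun u hu =>
    hbelow _ ((hg _ (hx u hu).1).2.1.symm ▸ (hx u hu).1)
  refine ⟨D, fun u => g (b.msg u).loc, hcore, ⟨fun u hu => (hx u hu).2.1,
    fun u hu => (hg _ (hx u hu).1).1, fun u hu w hw he => ?_, fun u hu => (hx u hu).1,
    fun u hu => (hg _ (hx u hu).1).2.1,
    fun u hu hne => (hg _ (hx u hu).1).2.2.2.2 u hu (hx u hu).2 hne,
    fun u hu _ => (hg _ (hx u hu).1).2.2.1,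
    fun u hu p hp _ => ((hg _ (hx u hu).1).2.2.2.1 p hp).1,
    fun u hu p hp h => absurd h ((hg _ (hx u hu).1).2.2.2.1 p hp).2,
    fun u hu w hw h => absurd h (hb u hu _),
    fun u hu p hp => fun ⟨t, _, _, h⟩ => absurd h (hb u hu _),
    fun u hu p hp => fun ⟨t, _, _, h⟩ => absurd h (hb u hu _),
    fun u hu x hx => fun ⟨t, _, _, h⟩ => absurd h (hb u hu _)⟩, hold⟩
  have hl : (b.msg u).loc = (b.msg w).loc := by
    rw [← (hg _ (hx u hu).1).2.1, ← (hg _ (hx w hw).1).2.1]; exact congrArg _ (congrArg _ he)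
  exact hcore.isLast_unique (hx u hu).2 (hl ▸ (hx w hw).2)

end Related

end Mem

/-! ## Steps of a single process -/

/-- The steps of a process with code `code`, up to their effect on the propagation unit. -/
inductive Proc.Act (code : List Instr) (q : Proc) : MemAction → Proc → Prop
  | fetch (ins : Instr) (l : ℕ) (hi : code[q.tracker]? = some ins)
      (hl : l ∈ ins.successors q.tracker) :
      Proc.Act code q .tau (Proc.settled { q with spec := q.spec ++ [⟨q.tracker, ins, l, none⟩] })
  | cross (q' : Proc) (hq : q.Cross q') : Proc.Act code q .tau q'.settled
  | readLocal (l l' : List Entry) (e : Entry) (m : ReadMode) (r : ℕ) (a : Expr) (x v : ℕ)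
      (hs : q.spec = l ++ e :: l') (hi : e.ins = .read m r a) (hd : e.done = none)
      (hx : a.eval (envAfter q.reg (q.past ++ l)) = some x)
      (hpass : PassesAll (ReadPasses q.reg m x) (q.past ++ l))
      (hv : LocalValue q.reg x v (q.past ++ l)) :
      Proc.Act code q .tau (Proc.settled { q with spec := l ++ { e with done := some v } :: l' })
  | readMemory (l l' : List Entry) (e : Entry) (m : ReadMode) (r : ℕ) (a : Expr) (x v : ℕ)
      (hs : q.spec = l ++ e :: l') (hi : e.ins = .read m r a) (hd : e.done = none)
      (hx : a.eval (envAfter q.reg (q.past ++ l)) = some x)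
      (hpass : PassesAll (ReadPasses q.reg m x) (q.past ++ l))
      (hloc : NoLocalWrite q.reg x [] (q.past ++ l)) :
      Proc.Act code q (.read x v)
        (Proc.settled { q with spec := l ++ { e with done := some v } :: l' })
  | flushWrite (pre : List Entry) (e : Entry) (q' : Proc) (m : WriteMode) (a ex : Expr) (x v : ℕ)
      (hq : q.Flush pre e q') (hi : e.ins = .write m a ex)
      (hx : a.eval (envAfter q.reg pre) = some x) (hv : ex.eval (envAfter q.reg pre) = some v)
      (hpass : PassesAll (WritePasses q.reg m x) pre) : Proc.Act code q (.write x v) q'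
  | flushFence (pre : List Entry) (e : Entry) (q' : Proc) (hq : q.Flush pre e q')
      (hi : e.ins = .lwsync) (hpass : PassesAll (FencePasses q.reg) pre) :
      Proc.Act code q .fence q'
  | dropBarrier (e : Entry) (l : List Entry) (rr rw wr ww : Bool) (h : q.past = e :: l)
      (hi : e.ins = .membar rr rw wr ww) : Proc.Act code q .tau { q with past := l }
  | rmw (e : Entry) (l : List Entry) (r : ℕ) (a ex : Expr) (x w v : ℕ)
      (hpast : q.past = []) (hs : q.spec = e :: l) (hi : e.ins = .rmw r a ex)
      (hx : a.eval (fun s => some (q.reg s)) = some x)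
      (hv : ex.eval (fun s => some (Function.update q.reg r w s)) = some v) :
      Proc.Act code q (.rmw (some x) w v)
        (Proc.settled ⟨e.next, Function.update q.reg r w, [], l⟩)
  | fullFence (e : Entry) (l : List Entry) (hpast : q.past = []) (hs : q.spec = e :: l)
      (hi : e.ins = .fullFence) :
      Proc.Act code q (.rmw none 0 0) (Proc.settled ⟨e.next, q.reg, [], l⟩)

section Step

variable {M : Propagation} {P : Program} {γ γ' : Config}

/-- Together with `Step.exists_act`, this splits a transition into a step of one process and a
matching action of the propagation unit. Processes and memories can then be simulated independently.
-/
theorem step_of_act {p : ℕ} (hp : p < P.procs.length) {act : MemAction} {q : Proc} {m : Mem}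
    (hq : (γ.proc p).Act (P.code p) act q) (hm : γ.mem.Act M P.procs.length p act m) :
    Step M P γ (γ.set p q m) := by
  cases hq with
  | fetch ins l hi hl => cases hm; exact .fetch p hp ins l hi hl
  | cross q' hq => cases hm; exact .cross p hp q' hq
  | readLocal l l' e m r a x v hs hi hd hx hpass hv =>
    cases hm; exact .readLocal p hp l l' e m r a x v hs hi hd hx hpass hv
  | readMemory l l' e m r a x v hs hi hd hx hpass hloc =>
    obtain ⟨v₀, h1, rfl, rfl⟩ := hm
    exact .readMemory p hp l l' e m r a x v₀ hs hi hd hx hpass hloc h1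
  | flushWrite pre e q' m a ex x v hq hi hx hv hpass =>
    cases hm; exact .flushWrite p hp pre e _ m a ex x v hq hi hx hv hpass
  | flushFence pre e q' hq hi hpass => cases hm; exact .flushFence p hp pre e _ hq hi hpass
  | dropBarrier e l rr rw wr ww h hi => cases hm; exact .dropBarrier p hp e l rr rw wr ww h hi
  | rmw e l r a ex x w v hpast hs hi hx hv =>
    obtain ⟨v₀, h1, h2, rfl⟩ := hm
    obtain rfl := h2.resolve_left (by simp)
    exact .rmw p hp e l r a ex x v₀ v hpast hs hi hx h1 hv
  | fullFence e l hpast hs hi =>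
    obtain ⟨v₀, h1, -, rfl⟩ := hm
    exact .fullFence p hp e l v₀ hpast hs hi h1

theorem Step.exists_act (h : Step M P γ γ') :
    (∃ p < P.procs.length, ∃ act q m, (γ.proc p).Act (P.code p) act q ∧
      γ.mem.Act M P.procs.length p act m ∧ γ' = γ.set p q m) ∨
    ∃ p < P.procs.length, ∃ v ∈ γ.mem.writes, p ∉ (γ.mem.msg v).redundant ∧
      γ' = ⟨γ.proc, γ.mem.update P.procs.length p v⟩ := by
  cases h with
  | fetch p hp ins l hi hl => exact Or.inl ⟨p, hp, _, _, _, .fetch ins l hi hl, rfl, rfl⟩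
  | cross p hp q hq => exact Or.inl ⟨p, hp, _, _, _, .cross q hq, rfl, rfl⟩
  | readLocal p hp l l' e m r a x v hs hi hd hx hpass hv =>
    exact Or.inl ⟨p, hp, _, _, _, .readLocal l l' e m r a x v hs hi hd hx hpass hv, rfl, rfl⟩
  | readMemory p hp l l' e m r a x v₀ hs hi hd hx hpass hloc hv =>
    exact Or.inl ⟨p, hp, _, _, _, .readMemory l l' e m r a x _ hs hi hd hx hpass hloc,
      ⟨v₀, hv, rfl, rfl⟩, rfl⟩
  | flushWrite p hp pre e q m a ex x v hq hi hx hv hpass =>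
    exact Or.inl ⟨p, hp, _, _, _, .flushWrite pre e q m a ex x v hq hi hx hv hpass, rfl, rfl⟩
  | flushFence p hp pre e q hq hi hpass =>
    exact Or.inl ⟨p, hp, _, _, _, .flushFence pre e q hq hi hpass, rfl, rfl⟩
  | dropBarrier p hp e l rr rw wr ww h hi =>
    exact Or.inl ⟨p, hp, _, _, _, .dropBarrier e l rr rw wr ww h hi, rfl, rfl⟩
  | rmw p hp e l r a ex x v₀ v hpast hs hi hx h₀ hv =>
    exact Or.inl ⟨p, hp, _, _, _, .rmw e l r a ex x _ v hpast hs hi hx hv,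
      ⟨v₀, h₀, Or.inr rfl, rfl⟩, rfl⟩
  | fullFence p hp e l v₀ hpast hs hi h₀ =>
    exact Or.inl ⟨p, hp, _, _, _, .fullFence e l hpast hs hi, ⟨v₀, h₀, Or.inl rfl, rfl⟩, rfl⟩
  | update p hp v hv hr => exact Or.inr ⟨p, hp, v, hv, hr, rfl⟩

end Step

/-! ### Misprediction -/

/-- The label speculated to follow the entry agrees with what is known in `env`. -/
def Entry.WellPredicted (env : ℕ → Option ℕ) (e : Entry) : Prop :=
  ∀ c t b, e.ins = .branch c t → c.eval env = some b → e.next = if b = 0 then e.label + 1 else t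

theorem settle_cons_of_wellPredicted {env : ℕ → Option ℕ} {e : Entry} (h : e.WellPredicted env)
    (l : List Entry) : settle env (e :: l) = e :: settle (e.effect env) l := by
  rw [settle]
  split
  next c t hi =>
    have he : e.effect env = env := by simp [Entry.effect, hi]
    rw [he]
    split
    next => rfl
    next b hb => rw [if_pos (h c t b hi hb)]
  next => rfl

theorem settle_cons_of_not_wellPredicted {env : ℕ → Option ℕ} {e : Entry}
    (h : ¬ e.WellPredicted env) (l : List Entry) :
    ∃ c t b, e.ins = .branch c t ∧ c.eval env = some b ∧
      settle env (e :: l) = [{ e with next := if b = 0 then e.label + 1 else t }] := by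
  simp only [Entry.WellPredicted, not_forall] at h
  obtain ⟨c, t, b, hi, hb, hne⟩ := h
  refine ⟨c, t, b, hi, hb, ?_⟩
  rw [settle]
  simp only [hi, hb]
  rw [if_neg hne]

theorem settle_cons_eq_self {env : ℕ → Option ℕ} {e : Entry} {l : List Entry} :
    settle env (e :: l) = e :: l ↔ e.WellPredicted env ∧ settle (e.effect env) l = l := by
  by_cases h : e.WellPredicted env
  · rw [settle_cons_of_wellPredicted h]; simp [h]
  · refine iff_of_false (fun he => ?_) (fun h' => h h'.1)
    obtain ⟨c, t, b, hi, hb, hs⟩ := settle_cons_of_not_wellPredicted h l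
    rw [hs] at he
    refine h fun c' t' b' hi' hb' => ?_
    rw [hi] at hi'
    cases hi'
    rw [hb] at hb'
    cases hb'
    have := congrArg Entry.next (List.cons.inj he).1
    simpa using this.symm

/-- If something is discarded, the remaining list ends in the corrected branch, and a second pass
finds nothing to correct. -/
theorem settle_settle (env : ℕ → Option ℕ) (l : List Entry) :
    settle env (settle env l) = settle env l := by
  induction l generalizing env with
  | nil => rfl
  | cons e l ih =>
    by_cases h : e.WellPredicted env
    · rw [settle_cons_of_wellPredicted h, settle_cons_eq_self]
      exact ⟨h, ih _⟩
    · obtain ⟨c, t, b, hi, hb, hs⟩ := settle_cons_of_not_wellPredicted h l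
      rw [hs, settle_cons_eq_self]
      refine ⟨fun c' t' b' hi' hb' => ?_, rfl⟩
      simp only [hi] at hi'
      cases hi'
      rw [hb] at hb'
      cases hb'
      rfl

theorem settle_append_eq_self {env : ℕ → Option ℕ} {l₁ l₂ : List Entry} :
    settle env (l₁ ++ l₂) = l₁ ++ l₂ ↔
      settle env l₁ = l₁ ∧ settle (l₁.foldl Entry.effect env) l₂ = l₂ := by
  induction l₁ generalizing env with
  | nil => simp [settle]
  | cons e l ih => simp [settle_cons_eq_self, ih, and_assoc]

/-- Settling changes no instruction. -/
theorem exists_of_mem_settle {env : ℕ → Option ℕ} {l : List Entry} {e : Entry}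
    (h : e ∈ settle env l) : ∃ e' ∈ l, e'.ins = e.ins := by
  induction l generalizing env with
  | nil => simp [settle] at h
  | cons f l ih =>
    by_cases hf : f.WellPredicted env
    · rw [settle_cons_of_wellPredicted hf] at h
      rcases List.mem_cons.1 h with rfl | h
      · exact ⟨e, by simp, rfl⟩
      · obtain ⟨e', h1, h2⟩ := ih h
        exact ⟨e', by simp [h1], h2⟩
    · obtain ⟨c, t, b, hi, hb, hs⟩ := settle_cons_of_not_wellPredicted hf l
      rw [hs, List.mem_singleton] at h
      exact ⟨f, by simp, by rw [h]⟩

/-- Flushing does not affect predictions. -/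
theorem settle_replace_eq_self {env : ℕ → Option ℕ} {l l' : List Entry} {e e' : Entry}
    (hi : e'.ins = e.ins) (he : ∀ env, e.effect env = env)
    (he' : ∀ env, e'.effect env = env) (hb : ∀ c t, e.ins ≠ .branch c t)
    (h : settle env (l ++ e :: l') = l ++ e :: l') :
    settle env (l ++ e' :: l') = l ++ e' :: l' := by
  rw [settle_append_eq_self, settle_cons_eq_self] at h ⊢
  refine ⟨h.1, fun c t b hi' => absurd (hi ▸ hi') (hb c t), ?_⟩
  rw [he']
  rw [he] at h
  exact h.2.2

theorem Proc.settled_settled (q : Proc) : q.settled.settled = q.settled := by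
  simp [Proc.settled, settle_settle]

theorem Proc.settled_eq_self {q : Proc} :
    q.settled = q ↔ settle (fun r => some (q.reg r)) q.spec = q.spec :=
  ⟨fun h => congrArg Proc.spec h, fun h => by simp only [Proc.settled, h]⟩

theorem Proc.Flush.settled {q q' : Proc} {pre : List Entry} {e : Entry} (h : q.Flush pre e q')
    (hi : (∃ m a ex, e.ins = .write m a ex) ∨ e.ins = .lwsync) (hq : q.settled = q) :
    q'.settled = q' := by
  rw [Proc.settled_eq_self] at hq ⊢
  cases h with
  | crossed => exact hq
  | uncrossed l e l' h ha =>
    rw [h] at hq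
    have he : ∀ (d : Option ℕ) env, ({ e with done := d } : Entry).effect env = env := by
      rcases hi with ⟨m, a, ex, hi⟩ | hi <;> simp [Entry.effect, hi]
    refine settle_replace_eq_self (e := e) rfl (fun env => he e.done env)
      (fun env => he _ env) ?_ hq
    rcases hi with ⟨m, a, ex, hi⟩ | hi <;> simp [hi]

theorem Proc.Act.settled {code : List Instr} {q q' : Proc} {act : MemAction}
    (h : q.Act code act q') (hq : q.settled = q) : q'.settled = q' := by
  cases h with
  | flushWrite pre e q' m a ex x v h hi => exact h.settled (Or.inl ⟨m, a, ex, hi⟩) hq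
  | flushFence pre e q' h hi => exact h.settled (Or.inr hi) hq
  | dropBarrier => rw [Proc.settled_eq_self] at hq ⊢; exact hq
  | _ => exact Proc.settled_settled _

/-! ### Addresses -/

theorem Expr.eval_const (v : ℕ) (env : ℕ → Option ℕ) : (Expr.const v).eval env = some v := by
  simp [Expr.eval, Expr.const, List.lookup]

theorem mem_of_lookup {α β : Type*} [BEq α] [LawfulBEq α] {a : α} {b : β} {l : List (α × β)}
    (h : l.lookup a = some b) : (a, b) ∈ l := by
  induction l with
  | nil => simp at h
  | cons x l ih =>
    obtain ⟨a', b'⟩ := x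
    rw [List.lookup_cons] at h
    split at h
    next heq => cases h; simp [eq_of_beq heq]
    next => simp [ih h]

theorem Expr.IsAddress.eval_lt {N : ℕ} {a : Expr} (ha : a.IsAddress N) {env : ℕ → Option ℕ}
    {x : ℕ} (h : a.eval env = some x) : x < N := by
  obtain ⟨vs, -, rfl⟩ := Option.map_eq_some_iff.1 h
  cases hl : a.table.lookup vs with
  -- A tuple that is missing from the table yields `0`; for this reason `IsAddress` requires `0 <
  -- N`.
  | none => exact ha.1
  | some y => exact ha.2 _ (mem_of_lookup hl)

theorem Expr.isAddress_const {N v : ℕ} (h : v < N) : (Expr.const v).IsAddress N :=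
  ⟨by omega, by simp [Expr.const, h]⟩

/-- All addresses in the buffer are among `0, …, N - 1`. -/
def Proc.AddressesIn (N : ℕ) (q : Proc) : Prop := ∀ e ∈ q.past ++ q.spec, e.ins.AddressesIn N

theorem Proc.AddressesIn.mono {N : ℕ} {q q' : Proc} (h : q.AddressesIn N)
    (h' : ∀ e ∈ q'.past ++ q'.spec, ∃ e' ∈ q.past ++ q.spec, e'.ins = e.ins) :
    q'.AddressesIn N := fun e he =>
  let ⟨e', h1, h2⟩ := h' e he
  h2 ▸ h e' h1

theorem Proc.AddressesIn.settled {N : ℕ} {q : Proc} (h : q.AddressesIn N) :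
    q.settled.AddressesIn N := h.mono fun e he => by
  rcases List.mem_append.1 he with he | he
  · exact ⟨e, List.mem_append_left _ he, rfl⟩
  · obtain ⟨e', h1, h2⟩ := exists_of_mem_settle he
    exact ⟨e', List.mem_append_right _ h1, h2⟩

theorem Proc.AddressesIn.flush {N : ℕ} {q q' : Proc} {pre : List Entry} {e : Entry}
    (h : q.AddressesIn N) (hf : q.Flush pre e q') :
    e.ins.AddressesIn N ∧ q'.AddressesIn N := by
  cases hf with
  | crossed l e l' hp ha =>
    refine ⟨h e (by simp [hp]), h.mono fun f hf => ⟨f, ?_, rfl⟩⟩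
    simp only [hp, List.mem_append, List.mem_cons] at hf ⊢
    tauto
  | uncrossed l e l' hp ha =>
    refine ⟨h e (by simp [hp]), h.mono fun f hf => ?_⟩
    simp only [hp, List.mem_append, List.mem_cons] at hf ⊢
    rcases hf with hf | hf | rfl | hf
    · exact ⟨f, by tauto, rfl⟩
    · exact ⟨f, by tauto, rfl⟩
    · exact ⟨e, by tauto, rfl⟩
    · exact ⟨f, by tauto, rfl⟩

theorem Proc.AddressesIn.cross {N : ℕ} {q q' : Proc} (h : q.AddressesIn N) (hc : q.Cross q') :
    q'.AddressesIn N := by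
  cases hc with
  | write e l m a ex x v hs hi hd hx hv =>
    intro f hf
    simp only [List.mem_append, List.mem_singleton] at hf
    rcases hf with (hf | rfl) | hf
    · exact h f (by simp [hf])
    · have := h e (by simp [hs])
      rw [hi] at this
      exact Expr.isAddress_const (Expr.IsAddress.eval_lt this hx)
    · exact h f (by simp [hs, hf])
  | lwsync e l hs | membar e l _ _ _ _ hs =>
    refine h.mono fun f hf => ⟨f, ?_, rfl⟩
    simp only [hs, List.mem_append, List.mem_cons] at hf ⊢
    simp at hf
    tauto
  | assign e l _ _ _ hs | branch e l _ _ hs | choose e l _ hs | read e l _ _ _ _ hs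
  | flushed e l hs | isync e l hs =>
    refine h.mono fun f hf => ⟨f, ?_, rfl⟩
    simp only [hs, List.mem_append, List.mem_cons] at hf ⊢
    tauto

/-- Resolved addresses remain within the declared variables of the original program. This keeps its
relocated code away from the flag. -/
theorem Proc.Act.addressesIn {P : Program} {p : ℕ} {q q' : Proc} {act : MemAction}
    (hP : P.WellFormed) (h : q.Act (P.code p) act q') (hq : q.AddressesIn P.vars) :
    q'.AddressesIn P.vars ∧ act.LocsIn P.IsLoc := by
  have hread : ∀ l e l' v, q.spec = l ++ e :: l' →
      Proc.AddressesIn P.vars { q with spec := l ++ { e with done := v } :: l' } :=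
    fun l e l' v hs => hq.mono fun f hf => by
      simp only [hs, List.mem_append, List.mem_cons] at hf ⊢
      rcases hf with hf | hf | rfl | hf
      · exact ⟨f, by tauto, rfl⟩
      · exact ⟨f, by tauto, rfl⟩
      · exact ⟨e, by tauto, rfl⟩
      · exact ⟨f, by tauto, rfl⟩
  have htail : ∀ e l pc reg, q.spec = e :: l → Proc.AddressesIn P.vars ⟨pc, reg, [], l⟩ :=
    fun e l pc reg hs => hq.mono fun f hf => ⟨f, by
      simp only [hs, List.mem_append, List.mem_cons] at hf ⊢
      simp at hf
      tauto, rfl⟩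
  cases h with
  | fetch ins l hi hl =>
    refine ⟨Proc.AddressesIn.settled fun e he => ?_, trivial⟩
    simp only [List.mem_append, List.mem_singleton] at he
    rcases he with he | he | rfl
    · exact hq e (by simp [he])
    · exact hq e (by simp [he])
    · have hmem := List.mem_of_getElem? hi
      have hcode : P.code p ∈ P.procs := by
        rw [Program.code, List.getD_eq_getElem?_getD] at hmem ⊢
        cases hp : P.procs[p]? with
        | none => simp [hp] at hmem
        | some c => exact List.mem_of_getElem? hp
      exact hP.2 _ hcode _ hmem
  | cross q' hc => exact ⟨(hq.cross hc).settled, trivial⟩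
  | readLocal l l' e m r a x v hs => exact ⟨(hread l e l' _ hs).settled, trivial⟩
  | readMemory l l' e m r a x v hs hi hd hx =>
    refine ⟨(hread l e l' _ hs).settled, fun y hy => ?_⟩
    cases hy
    have := hq e (by simp [hs])
    rw [hi] at this
    exact Expr.IsAddress.eval_lt this hx
  | flushWrite pre e q' m a ex x v hf hi hx =>
    obtain ⟨h1, h2⟩ := hq.flush hf
    refine ⟨h2, fun y hy => ?_⟩
    cases hy
    rw [hi] at h1
    exact Expr.IsAddress.eval_lt h1 hx
  | flushFence pre e q' hf => exact ⟨(hq.flush hf).2, trivial⟩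
  | dropBarrier e l _ _ _ _ hp =>
    refine ⟨hq.mono fun f hf => ⟨f, ?_, rfl⟩, trivial⟩
    simp only [hp, List.mem_append, List.mem_cons] at hf ⊢
    tauto
  | rmw e l r a ex x w v hpast hs hi hx =>
    refine ⟨(htail e l _ _ hs).settled, fun y hy => ?_⟩
    cases hy
    have := hq e (by simp [hs])
    rw [hi] at this
    exact Expr.IsAddress.eval_lt this hx
  | fullFence e l hpast hs =>
    exact ⟨(htail e l _ _ hs).settled, fun y hy => by cases hy⟩

/-! ## Relocated processes -/

/-- Relocate an entry by `k` labels. -/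
def Entry.shift (k : ℕ) (e : Entry) : Entry := ⟨e.label + k, e.ins.shift k, e.next + k, e.done⟩

/-- A list of resolved local instructions, started with the registers `env`. -/
def Transparent (env : ℕ → Option ℕ) : List Entry → Prop
  | [] => True
  | e :: l => ((∃ r ex, e.ins = .assign r ex ∧ e.next = e.label + 1) ∨
      ∃ c t b, e.ins = .branch c t ∧ c.eval env = some b ∧
        e.next = if b = 0 then e.label + 1 else t) ∧ Transparent (e.effect env) l

theorem Transparent.of_append {env : ℕ → Option ℕ} {l₁ l₂ : List Entry}
    (h : Transparent env (l₁ ++ l₂)) :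
    Transparent env l₁ ∧ Transparent (l₁.foldl Entry.effect env) l₂ := by
  induction l₁ generalizing env with
  | nil => exact ⟨trivial, h⟩
  | cons e l ih => exact ⟨⟨h.1, (ih h.2).1⟩, (ih h.2).2⟩

theorem Transparent.ins {env : ℕ → Option ℕ} {l : List Entry} (h : Transparent env l)
    {e : Entry} (he : e ∈ l) :
    (∃ r ex, e.ins = .assign r ex) ∨ ∃ c t, e.ins = .branch c t := by
  obtain ⟨l₁, l₂, rfl⟩ := List.append_of_mem he
  rcases h.of_append.2.1 with ⟨r, ex, h, -⟩ | ⟨c, t, b, h, -⟩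
  · exact Or.inl ⟨r, ex, h⟩
  · exact Or.inr ⟨c, t, h⟩

/-- The branches of a resolved list are predicted correctly, so misprediction can occur only behind
it, where the registers are those that the list computes. -/
theorem Transparent.settle {env : ℕ → Option ℕ} {l : List Entry} (h : Transparent env l)
    (l' : List Entry) : settle env (l ++ l') = l ++ settle (l.foldl Entry.effect env) l' := by
  induction l generalizing env with
  | nil => rfl
  | cons e l ih =>
    have hw : e.WellPredicted env := fun c t b hi hb => by
      rcases h.1 with ⟨r, ex, hi', -⟩ | ⟨c', t', b', hi', hb', hn⟩
      · rw [hi] at hi'; cases hi'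
      · rw [hi] at hi'; cases hi'
        rw [hb] at hb'; cases hb'
        exact hn
    rw [List.cons_append, settle_cons_of_wellPredicted hw, ih h.2]
    rfl

section Shift

variable {k : ℕ}

@[simp] theorem Entry.shift_done (e : Entry) : (e.shift k).done = e.done := rfl

theorem Entry.shift_effect (env : ℕ → Option ℕ) (e : Entry) :
    (e.shift k).effect env = e.effect env := by
  rcases e with ⟨l, i, n, d⟩
  cases i <;> rfl

theorem foldl_effect_shift (l : List Entry) (env : ℕ → Option ℕ) :
    (l.map (Entry.shift k)).foldl Entry.effect env = l.foldl Entry.effect env := by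
  simp [List.foldl_map, Entry.shift_effect]

theorem Entry.shift_wellPredicted {e : Entry} {env : ℕ → Option ℕ} :
    (e.shift k).WellPredicted env ↔ e.WellPredicted env := by
  rcases e with ⟨l, i, n, d⟩
  cases i <;> simp only [WellPredicted, shift, Instr.shift, reduceCtorEq, false_imp_iff,
    implies_true, Instr.branch.injEq]
  constructor
  · rintro h c t b ⟨rfl, rfl⟩ hb
    have := h _ _ b ⟨rfl, rfl⟩ hb
    split_ifs at this ⊢ <;> omega
  · rintro h c t b ⟨rfl, rfl⟩ hb
    have := h _ _ b ⟨rfl, rfl⟩ hb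
    split_ifs at this ⊢ <;> omega

theorem settle_shift (env : ℕ → Option ℕ) (l : List Entry) :
    settle env (l.map (Entry.shift k)) = (settle env l).map (Entry.shift k) := by
  induction l generalizing env with
  | nil => rfl
  | cons e l ih =>
    rw [List.map_cons]
    by_cases h : e.WellPredicted env
    · rw [settle_cons_of_wellPredicted h,
        settle_cons_of_wellPredicted (Entry.shift_wellPredicted.2 h), ih, Entry.shift_effect]
      rfl
    · obtain ⟨c, t, b, hi, hb, hs⟩ := settle_cons_of_not_wellPredicted h l
      obtain ⟨c', t', b', hi', hb', hs'⟩ := settle_cons_of_not_wellPredicted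
        (mt Entry.shift_wellPredicted.1 h) (l.map (Entry.shift k))
      rw [hs, hs']
      rcases e with ⟨la, i, n, d⟩
      simp only [Entry.shift] at hi hi'
      subst hi
      simp only [Instr.shift, Instr.branch.injEq] at hi'
      obtain ⟨rfl, rfl⟩ := hi'
      rw [hb] at hb'
      cases hb'
      simp only [Entry.shift, Instr.shift, List.map_cons, List.map_nil, List.cons.injEq,
        Entry.mk.injEq, true_and, and_true]
      split_ifs <;> omega

end Shift

/-! ### Instructions behind a resolved prelude -/

/-- With the registers `reg'`, the instructions `C` are resolved and lead to the registers `reg`. -/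
structure Prelude (reg' reg : ℕ → ℕ) (C : List Entry) : Prop where
  transparent : Transparent (fun r => some (reg' r)) C
  env : envAfter reg' C = fun r => some (reg r)

theorem Prelude.nil (reg : ℕ → ℕ) : Prelude reg reg [] := ⟨trivial, rfl⟩

theorem passesAll_nil (R : List Entry → Entry → Prop) : PassesAll R [] := fun l f l' h => by
  simp at h

theorem passesAll_concat {R : List Entry → Entry → Prop} {l : List Entry} {f : Entry} :
    PassesAll R (l ++ [f]) ↔ PassesAll R l ∧ R l f := by
  constructor
  · intro h
    exact ⟨fun l₁ g l₂ he => h l₁ g (l₂ ++ [f]) (by simp [he]), h l f [] rfl⟩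
  · rintro ⟨h1, h2⟩ l₁ g l₂ he
    rcases List.eq_nil_or_concat l₂ with rfl | ⟨l₃, f', rfl⟩
    · obtain ⟨rfl, h⟩ := List.append_inj' he rfl
      cases h
      exact h2
    · have he' : l ++ [f] = (l₁ ++ g :: l₃) ++ [f'] := by simpa using he
      obtain ⟨rfl, -⟩ := List.append_inj' he' rfl
      exact h1 _ _ _ rfl

/-- Whether an entry can be overtaken depends on the entry and on what precedes it, so the
comparison extends one entry at a time, from the front. -/
theorem passesAll_lift {k : ℕ} {R R' : List Entry → Entry → Prop} {C : List Entry}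
    (hC : PassesAll R' C)
    (h : ∀ l f, R' (C ++ l.map (Entry.shift k)) (f.shift k) ↔ R l f) (pre : List Entry) :
    PassesAll R' (C ++ pre.map (Entry.shift k)) ↔ PassesAll R pre := by
  induction pre using List.reverseRecOn with
  | nil => simp [hC, passesAll_nil]
  | append_singleton l f ih =>
    rw [List.map_append, ← List.append_assoc, List.map_singleton, passesAll_concat,
      passesAll_concat, ih, h]

theorem noLocalWrite_iff {reg : ℕ → ℕ} {x : ℕ} {base l : List Entry} :
    NoLocalWrite reg x base l ↔ PassesAll (fun k f => ∀ m a v, f.ins = .write m a v →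
      f.done = none → Differs reg (base ++ k) a x) l := by
  constructor
  · exact fun h k f k' he m a v hi hd => h k f k' m a v he hi hd
  · exact fun h k f k' m a v he hi hd => h k f k' he m a v hi hd

theorem Instr.shift_eq_iff {k : ℕ} {i j : Instr} (hb : ∀ c t, j ≠ .branch c t)
    (hc : ∀ t, j ≠ .choose t) : i.shift k = j ↔ i = j := by
  cases i with
  | branch c t =>
    simp only [Instr.shift]
    exact iff_of_false (fun h => hb _ _ h.symm) (fun h => hb _ _ h.symm)
  | choose t =>
    simp only [Instr.shift]
    exact iff_of_false (fun h => hc _ h.symm) (fun h => hc _ h.symm)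
  | _ => rfl

namespace Prelude

variable {k : ℕ} {reg' reg : ℕ → ℕ} {C : List Entry}

theorem envAfter_append (h : Prelude reg' reg C) (l : List Entry) :
    envAfter reg' (C ++ l.map (Entry.shift k)) = envAfter reg l := by
  have := h.env
  simp only [envAfter] at this ⊢
  rw [List.foldl_append, this, foldl_effect_shift]

theorem differs (h : Prelude reg' reg C) (l : List Entry) (a : Expr) (x : ℕ) :
    Differs reg' (C ++ l.map (Entry.shift k)) a x ↔ Differs reg l a x := by
  rw [Differs, h.envAfter_append, Differs]

theorem readsDone (h : Prelude reg' reg C) (l : List Entry) :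
    ReadsDone (C ++ l.map (Entry.shift k)) ↔ ReadsDone l := by
  constructor
  · intro h' e he m r a hi
    exact h' (e.shift k) (by simp only [List.mem_append, List.mem_map]; exact Or.inr ⟨e, he, rfl⟩)
      m r a (by simp [Entry.shift, hi, Instr.shift])
  · intro h' e he m r a hi
    rcases List.mem_append.1 he with he | he
    · rcases h.transparent.ins he with ⟨_, _, hi'⟩ | ⟨_, _, hi'⟩ <;> simp [hi] at hi'
    · obtain ⟨e₀, he₀, rfl⟩ := List.mem_map.1 he
      exact h' e₀ he₀ m r a ((Instr.shift_eq_iff (by simp) (by simp)).1 hi)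

theorem writesDone (h : Prelude reg' reg C) (l : List Entry) :
    WritesDone (C ++ l.map (Entry.shift k)) ↔ WritesDone l := by
  constructor
  · intro h' e he m r a hi
    exact h' (e.shift k) (by simp only [List.mem_append, List.mem_map]; exact Or.inr ⟨e, he, rfl⟩)
      m r a (by simp [Entry.shift, hi, Instr.shift])
  · intro h' e he m r a hi
    rcases List.mem_append.1 he with he | he
    · rcases h.transparent.ins he with ⟨_, _, hi'⟩ | ⟨_, _, hi'⟩ <;> simp [hi] at hi'
    · obtain ⟨e₀, he₀, rfl⟩ := List.mem_map.1 he
      exact h' e₀ he₀ m r a ((Instr.shift_eq_iff (by simp) (by simp)).1 hi)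

/-- No overtaking rule is blocked by an assignment or by a resolved branch. The prelude is thus
invisible to the instructions behind it. -/
theorem passesAll_self {R : List Entry → Entry → Prop} (h : Prelude reg' reg C)
    (ha : ∀ l f r ex, f.ins = .assign r ex → R l f)
    (hb : ∀ l f c t, f.ins = .branch c t → c.eval (envAfter reg' l) ≠ none → R l f) :
    PassesAll R C := by
  rintro l f l' rfl
  rcases h.transparent.of_append.2.1 with ⟨r, ex, hi, -⟩ | ⟨c, t, b, hi, hb', -⟩
  · exact ha l f r ex hi
  · exact hb l f c t hi (by rw [envAfter, hb']; simp)

theorem readPasses (h : Prelude reg' reg C) (m : ReadMode) (x : ℕ) (pre : List Entry) :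
    PassesAll (ReadPasses reg' m x) (C ++ pre.map (Entry.shift k)) ↔
      PassesAll (ReadPasses reg m x) pre := by
  refine passesAll_lift (h.passesAll_self (fun l f r ex hi => ?_) fun l f c t hi _ => ?_)
    (fun l f => ?_) pre
  · simp [ReadPasses, hi]
  · simp [ReadPasses, hi]
  · rcases f with ⟨la, i, n, d⟩
    cases i <;> simp [ReadPasses, Entry.shift, Instr.shift, h.differs, h.readsDone, h.writesDone]

theorem writePasses (h : Prelude reg' reg C) (m : WriteMode) (x : ℕ) (pre : List Entry) :
    PassesAll (WritePasses reg' m x) (C ++ pre.map (Entry.shift k)) ↔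
      PassesAll (WritePasses reg m x) pre := by
  refine passesAll_lift (h.passesAll_self (fun l f r ex hi => ?_) fun l f c t hi hb => ?_)
    (fun l f => ?_) pre
  · simp [WritePasses, hi]
  · simpa [WritePasses, hi] using hb
  · rcases f with ⟨la, i, n, d⟩
    cases i <;> simp [WritePasses, Entry.shift, Instr.shift, h.differs, h.readsDone, h.writesDone,
      h.envAfter_append]

theorem fencePasses (h : Prelude reg' reg C) (pre : List Entry) :
    PassesAll (FencePasses reg') (C ++ pre.map (Entry.shift k)) ↔
      PassesAll (FencePasses reg) pre := by
  refine passesAll_lift (h.passesAll_self (fun l f r ex hi => ?_) fun l f c t hi hb => ?_)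
    (fun l f => ?_) pre
  · simp [FencePasses, hi]
  · simpa [FencePasses, hi] using hb
  · rcases f with ⟨la, i, n, d⟩
    cases i <;> simp [FencePasses, Entry.shift, Instr.shift, h.envAfter_append]

theorem noLocalWrite (h : Prelude reg' reg C) (x : ℕ) (base l : List Entry) :
    NoLocalWrite reg' x (C ++ base.map (Entry.shift k)) (l.map (Entry.shift k)) ↔
      NoLocalWrite reg x base l := by
  rw [noLocalWrite_iff, noLocalWrite_iff]
  refine passesAll_lift (C := []) (passesAll_nil _) (fun l f => ?_) l
  simp only [List.nil_append, List.append_assoc, ← List.map_append, h.differs, Entry.shift_done]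
  simp only [Entry.shift, Instr.shift_eq_iff, ne_eq, reduceCtorEq, not_false_eq_true,
    implies_true]

theorem noLocalWrite_nil (h : Prelude reg' reg C) (x : ℕ) (l : List Entry) :
    NoLocalWrite reg' x [] (C ++ l.map (Entry.shift k)) ↔ NoLocalWrite reg x [] l := by
  rw [noLocalWrite_iff, noLocalWrite_iff]
  refine passesAll_lift (h.passesAll_self (fun l f r ex hi => ?_) fun l f c t hi hb => ?_)
    (fun l f => ?_) l
  · simp [hi]
  · simp [hi]
  simp only [List.nil_append, h.differs, Entry.shift_done]
  simp only [Entry.shift, Instr.shift_eq_iff, ne_eq, reduceCtorEq, not_false_eq_true,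
    implies_true]

/-- An entry that is not local lies behind the prelude. -/
theorem split (h : Prelude reg' reg C) {l pre l' : List Entry} {e : Entry}
    (he : C ++ pre.map (Entry.shift k) = l ++ e :: l')
    (ha : ∀ r ex, e.ins ≠ .assign r ex) (hb : ∀ c t, e.ins ≠ .branch c t) :
    ∃ l₀ e₀ l₀', pre = l₀ ++ e₀ :: l₀' ∧ l = C ++ l₀.map (Entry.shift k) ∧ e = e₀.shift k ∧
      l' = l₀'.map (Entry.shift k) := by
  have hmem : e ∉ C := fun hm => by
    rcases h.transparent.ins hm with ⟨_, _, hi⟩ | ⟨_, _, hi⟩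
    · exact ha _ _ hi
    · exact hb _ _ hi
  rcases List.append_eq_append_iff.1 he with ⟨l₁, rfl, h2⟩ | ⟨l₁, h1, h2⟩
  · obtain ⟨l₀, l₂, rfl, rfl, h3⟩ := List.map_eq_append_iff.1 h2
    obtain ⟨e₀, l₀', rfl, rfl, rfl⟩ := List.map_eq_cons_iff.1 h3
    exact ⟨l₀, e₀, l₀', rfl, rfl, rfl, rfl⟩
  · rcases l₁ with _ | ⟨e', l₁⟩
    · rw [List.append_nil] at h1
      subst h1
      obtain ⟨e₀, l₀', rfl, rfl, rfl⟩ := List.map_eq_cons_iff.1 h2.symm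
      exact ⟨[], e₀, l₀', rfl, by simp, rfl, rfl⟩
    · cases h2
      exact absurd (by simp [h1]) hmem

theorem localValue (h : Prelude reg' reg C) (x v : ℕ) (pre : List Entry) :
    LocalValue reg' x v (C ++ pre.map (Entry.shift k)) ↔ LocalValue reg x v pre := by
  constructor
  · rintro ⟨l, w, l', m, a, e, h1, h2, h3, h4, h5, h6⟩
    obtain ⟨l₀, w₀, l₀', rfl, rfl, rfl, rfl⟩ := h.split h1 (by simp [h2]) (by simp [h2])
    rw [h.envAfter_append] at h4 h5
    have h7 : C ++ l₀.map (Entry.shift k) ++ [w₀.shift k] =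
      C ++ (l₀ ++ [w₀]).map (Entry.shift k) := by simp
    rw [h7, h.noLocalWrite] at h6
    exact ⟨l₀, w₀, l₀', m, a, e, rfl, (Instr.shift_eq_iff (by simp) (by simp)).1 h2, h3, h4, h5,
      h6⟩
  · rintro ⟨l, w, l', m, a, e, rfl, h2, h3, h4, h5, h6⟩
    refine ⟨C ++ l.map (Entry.shift k), w.shift k, l'.map (Entry.shift k), m, a, e, by simp,
      (Instr.shift_eq_iff (by simp) (by simp)).2 h2, h3, ?_, ?_, ?_⟩
    · rwa [h.envAfter_append]
    · rwa [h.envAfter_append]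
    · have h7 : C ++ l.map (Entry.shift k) ++ [w.shift k] =
        C ++ (l ++ [w]).map (Entry.shift k) := by simp
      rwa [h7, h.noLocalWrite]

end Prelude

/-- Relocate a process by `k` labels. -/
def Proc.shift (k : ℕ) (q : Proc) : Proc :=
  ⟨q.pc + k, q.reg, q.past.map (Entry.shift k), q.spec.map (Entry.shift k)⟩

theorem Proc.Cross.shift {k : ℕ} {q q₂ : Proc} (h : q.Cross q₂) :
    (q.shift k).Cross (q₂.shift k) := by
  cases h with
  | assign e l r ex v h hi hv =>
    exact .assign (q := q.shift k) (e.shift k) (l.map (Entry.shift k)) r ex v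
      (by simp [Proc.shift, h]) (by simp [Entry.shift, hi, Instr.shift]) hv
  | branch e l c t h hi =>
    exact .branch (q := q.shift k) (e.shift k) (l.map (Entry.shift k)) c (t + k)
      (by simp [Proc.shift, h]) (by simp [Entry.shift, hi, Instr.shift])
  | choose e l t h hi =>
    exact .choose (q := q.shift k) (e.shift k) (l.map (Entry.shift k)) (t + k)
      (by simp [Proc.shift, h]) (by simp [Entry.shift, hi, Instr.shift])
  | read e l m r a v h hi hv =>
    exact .read (q := q.shift k) (e.shift k) (l.map (Entry.shift k)) m r a v
      (by simp [Proc.shift, h]) (by simp [Entry.shift, hi, Instr.shift]) hv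
  | flushed e l h hi hd =>
    refine .flushed (q := q.shift k) (e.shift k) (l.map (Entry.shift k))
      (by simp [Proc.shift, h]) ?_ hd
    simpa [Entry.shift, Instr.shift_eq_iff] using hi
  | write e l m a ex x v h hi hd hx hv =>
    have := Proc.Cross.write (q := q.shift k) (e.shift k) (l.map (Entry.shift k)) m a ex x v
      (by simp [Proc.shift, h]) (by simp [Entry.shift, hi, Instr.shift]) hd hx hv
    simpa [Proc.shift, Entry.shift, Instr.shift] using this
  | lwsync e l h hi hd =>
    have := Proc.Cross.lwsync (q := q.shift k) (e.shift k) (l.map (Entry.shift k))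
      (by simp [Proc.shift, h]) (by simp [Entry.shift, hi, Instr.shift]) hd
    simpa [Proc.shift, Entry.shift] using this
  | isync e l h hi =>
    exact .isync (q := q.shift k) (e.shift k) (l.map (Entry.shift k))
      (by simp [Proc.shift, h]) (by simp [Entry.shift, hi, Instr.shift])
  | membar e l rr rw wr ww h hi =>
    have := Proc.Cross.membar (q := q.shift k) (e.shift k) (l.map (Entry.shift k)) rr rw wr ww
      (by simp [Proc.shift, h]) (by simp [Entry.shift, hi, Instr.shift])
    simpa [Proc.shift, Entry.shift] using this

theorem Instr.of_shift_eq_branch {k t : ℕ} {i : Instr} {c : Expr} (h : i.shift k = .branch c t) :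
    ∃ t₀, i = .branch c t₀ := by
  cases i <;> simp [Instr.shift] at h
  exact ⟨_, by rw [h.1]⟩

theorem Instr.of_shift_eq_choose {k t : ℕ} {i : Instr} (h : i.shift k = .choose t) :
    ∃ t₀, i = .choose t₀ := by
  cases i <;> simp [Instr.shift] at h
  exact ⟨_, rfl⟩

theorem Proc.Cross.of_shift {k : ℕ} {q q' : Proc} (h : (q.shift k).Cross q') :
    ∃ q₂, q' = q₂.shift k ∧ q.Cross q₂ := by
  have hsplit : ∀ e l, (q.shift k).spec = e :: l → ∃ e₀ l₀, q.spec = e₀ :: l₀ ∧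
      e₀.shift k = e ∧ l₀.map (Entry.shift k) = l := fun e l h => List.map_eq_cons_iff.1 h
  cases h with
  | assign e l r ex v h hi hv =>
    obtain ⟨e, l, hs, rfl, rfl⟩ := hsplit _ _ h
    exact ⟨_, rfl, .assign e l r ex v hs ((Instr.shift_eq_iff (by simp) (by simp)).1 hi) hv⟩
  | branch e l c t h hi =>
    obtain ⟨e, l, hs, rfl, rfl⟩ := hsplit _ _ h
    obtain ⟨t₀, hi⟩ := Instr.of_shift_eq_branch hi
    exact ⟨_, rfl, .branch e l c t₀ hs hi⟩
  | choose e l t h hi =>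
    obtain ⟨e, l, hs, rfl, rfl⟩ := hsplit _ _ h
    obtain ⟨t₀, hi⟩ := Instr.of_shift_eq_choose hi
    exact ⟨_, rfl, .choose e l t₀ hs hi⟩
  | read e l m r a v h hi hv =>
    obtain ⟨e, l, hs, rfl, rfl⟩ := hsplit _ _ h
    exact ⟨_, rfl, .read e l m r a v hs ((Instr.shift_eq_iff (by simp) (by simp)).1 hi) hv⟩
  | flushed e l h hi hd =>
    obtain ⟨e, l, hs, rfl, rfl⟩ := hsplit _ _ h
    exact ⟨_, rfl, .flushed e l hs (by simpa [Entry.shift, Instr.shift_eq_iff] using hi) hd⟩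
  | write e l m a ex x v h hi hd hx hv =>
    obtain ⟨e, l, hs, rfl, rfl⟩ := hsplit _ _ h
    refine ⟨_, ?_, .write e l m a ex x v hs ((Instr.shift_eq_iff (by simp) (by simp)).1 hi) hd
      hx hv⟩
    simp [Proc.shift, Entry.shift, Instr.shift]
  | lwsync e l h hi hd =>
    obtain ⟨e, l, hs, rfl, rfl⟩ := hsplit _ _ h
    refine ⟨_, ?_, .lwsync e l hs ((Instr.shift_eq_iff (by simp) (by simp)).1 hi) hd⟩
    simp [Proc.shift, Entry.shift]
  | isync e l h hi =>
    obtain ⟨e, l, hs, rfl, rfl⟩ := hsplit _ _ h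
    exact ⟨_, rfl, .isync e l hs ((Instr.shift_eq_iff (by simp) (by simp)).1 hi)⟩
  | membar e l rr rw wr ww h hi =>
    obtain ⟨e, l, hs, rfl, rfl⟩ := hsplit _ _ h
    refine ⟨_, ?_, .membar e l rr rw wr ww hs ((Instr.shift_eq_iff (by simp) (by simp)).1 hi)⟩
    simp [Proc.shift, Entry.shift]

/-- The label reached after speculating the entries `C` from the label `l`. -/
def exitLabel (l : ℕ) (C : List Entry) : ℕ := (C.getLast?.map Entry.next).getD l

@[simp] theorem exitLabel_nil (l : ℕ) : exitLabel l [] = l := rfl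

@[simp] theorem exitLabel_cons (l : ℕ) (e : Entry) (C : List Entry) :
    exitLabel l (e :: C) = exitLabel e.next C := by
  rw [exitLabel, exitLabel, List.getLast?_cons]
  cases C.getLast? <;> rfl

/-- Crossing a resolved local instruction. -/
theorem Proc.Cross.of_transparent {q q' : Proc} {e : Entry} {C l : List Entry} (h : q.Cross q')
    (ht : Transparent (fun r => some (q.reg r)) (e :: C)) (hs : q.spec = e :: l) :
    ∃ reg, q' = ⟨e.next, reg, q.past, l⟩ ∧
      e.effect (fun r => some (q.reg r)) = fun r => some (reg r) := by
  have hins := ht.ins (List.mem_cons_self ..)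
  cases h with
  | assign f l r ex v hf hi hv =>
    obtain ⟨rfl, rfl⟩ := List.cons.inj (hs.symm.trans hf)
    refine ⟨_, rfl, ?_⟩
    funext s
    simp only [Entry.effect, hi, hv, Function.update_apply]
    split_ifs <;> rfl
  | branch f l c t hf hi =>
    obtain ⟨rfl, rfl⟩ := List.cons.inj (hs.symm.trans hf)
    exact ⟨_, rfl, by simp [Entry.effect, hi]⟩
  | flushed f l hf hi =>
    obtain ⟨rfl, rfl⟩ := List.cons.inj (hs.symm.trans hf)
    rcases hins with ⟨_, _, hi'⟩ | ⟨_, _, hi'⟩ <;> simp [hi'] at hi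
  | choose f l t hf hi | read f l m r a v hf hi | write f l m a ex x v hf hi
  | lwsync f l hf hi | isync f l hf hi | membar f l rr rw wr ww hf hi =>
    obtain ⟨rfl, rfl⟩ := List.cons.inj (hs.symm.trans hf)
    rcases hins with ⟨_, _, hi'⟩ | ⟨_, _, hi'⟩ <;> simp [hi'] at hi

/-- `q'` is the process `q` relocated by `k` labels, behind the resolved prelude `C`, which starts
at labels below `k`. -/
structure Lifted (k : ℕ) (C : List Entry) (q' q : Proc) : Prop where
  past : q'.past = q.past.map (Entry.shift k)
  spec : q'.spec = C ++ q.spec.map (Entry.shift k)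
  prelude : Prelude q'.reg q.reg C
  -- Entries get into `past` by being crossed, and nothing behind the prelude is crossed before the
  -- prelude is.
  empty : C = [] ∨ q.past = []
  next : exitLabel q'.pc C = q.pc + k
  -- As long as some of the prelude is left, the program counter is inside the preamble. A relocated
  -- control state therefore certifies that the prelude has been crossed.
  low : ∀ l₁ e l₂, C = l₁ ++ e :: l₂ → exitLabel q'.pc l₁ < k

/-- `code'` contains `code`, relocated by `k` labels. -/
def CodeShift (k : ℕ) (code' code : List Instr) : Prop :=
  ∀ l, code'[l + k]? = code[l]?.map (Instr.shift k)

theorem Lifted.shift (k : ℕ) (q : Proc) : Lifted k [] (q.shift k) q :=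
  ⟨rfl, rfl, .nil _, Or.inl rfl, rfl, by simp⟩

theorem Lifted.eq_shift {k : ℕ} {q' q : Proc} (h : Lifted k [] q' q) : q' = q.shift k := by
  obtain ⟨h1, h2, h3, -, h4, -⟩ := h
  obtain ⟨pc', reg', past', spec'⟩ := q'
  obtain ⟨pc, reg, past, spec⟩ := q
  simp only [Proc.shift, Proc.mk.injEq]
  refine ⟨h4, ?_, h1, h2⟩
  funext r
  exact Option.some.inj (congrFun h3.env r)

theorem Instr.mem_successors_shift {k l n : ℕ} {i : Instr} :
    n ∈ (i.shift k).successors (l + k) ↔ ∃ n₀ ∈ i.successors l, n = n₀ + k := by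
  cases i with
  | branch c t =>
    simp only [Instr.shift, successors, Set.mem_insert_iff, Set.mem_singleton_iff]
    constructor
    · rintro (rfl | rfl)
      · exact ⟨l + 1, by simp, by omega⟩
      · exact ⟨t, by simp, rfl⟩
    · rintro ⟨_, rfl | rfl, rfl⟩ <;> omega
  | choose t =>
    simp only [Instr.shift, successors, Set.mem_insert_iff, Set.mem_singleton_iff]
    constructor
    · rintro (rfl | rfl)
      · exact ⟨l + 1, by simp, by omega⟩
      · exact ⟨t, by simp, rfl⟩
    · rintro ⟨_, rfl | rfl, rfl⟩ <;> omega
  | _ =>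
    simp only [Instr.shift, successors, Set.mem_singleton_iff, exists_eq_left]
    omega

namespace Lifted

variable {k : ℕ} {C : List Entry} {q' q : Proc}

theorem tracker (h : Lifted k C q' q) : q'.tracker = q.tracker + k := by
  have hn := h.next
  unfold exitLabel at hn
  rcases List.eq_nil_or_concat q.spec with hs | ⟨l, e, hs⟩
  · simp only [Proc.tracker, h.spec, hs, List.map_nil, List.append_nil, hn]
    simp
  · simp [Proc.tracker, h.spec, hs, Entry.shift]

/-- Either there is no prelude or nothing has been crossed, so the prelude may be regarded as the
front of the whole buffer. -/
theorem base (h : Lifted k C q' q) (l : List Entry) :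
    q'.past ++ (C ++ l.map (Entry.shift k)) = C ++ (q.past ++ l).map (Entry.shift k) := by
  rcases h.empty with rfl | hp
  · simp [h.past]
  · simp [h.past, hp]

theorem settled (h : Lifted k C q' q) : Lifted k C q'.settled q.settled where
  past := h.past
  spec := by
    have henv : C.foldl Entry.effect (fun r => some (q'.reg r)) = fun r => some (q.reg r) :=
      h.prelude.env
    simp only [Proc.settled, h.spec, h.prelude.transparent.settle, settle_shift, henv]
  prelude := h.prelude
  empty := h.empty
  next := h.next
  low := h.low

theorem with_spec (h : Lifted k C q' q) (s : List Entry) :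
    Lifted k C { q' with spec := C ++ s.map (Entry.shift k) } { q with spec := s } where
  past := h.past
  spec := rfl
  prelude := h.prelude
  empty := h.empty
  next := h.next
  low := h.low

theorem flush_up (h : Lifted k C q' q) {pre : List Entry} {e : Entry} {q₂ : Proc}
    (hf : q.Flush pre e q₂) :
    ∃ q₂', q'.Flush (C ++ pre.map (Entry.shift k)) (e.shift k) q₂' ∧ Lifted k C q₂' q₂ := by
  cases hf with
  | crossed pre e l' hp ha =>
    obtain rfl : C = [] := h.empty.resolve_right (by simp [hp])
    refine ⟨_, .crossed (pre.map (Entry.shift k)) (e.shift k) (l'.map (Entry.shift k))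
      (by simp [h.past, hp]) ha, ?_, h.spec, h.prelude, Or.inl rfl, h.next, h.low⟩
    simp
  | uncrossed l e l' hp ha =>
    rw [← h.base]
    refine ⟨_, .uncrossed (C ++ l.map (Entry.shift k)) (e.shift k) (l'.map (Entry.shift k))
      (by simp [h.spec, hp]) ha, ?_⟩
    have := h.with_spec (l ++ { e with done := some 0 } :: l')
    simpa [Entry.shift] using this

theorem flush_down (h : Lifted k C q' q) {pre' : List Entry} {e' : Entry} {q₂' : Proc}
    (hf : q'.Flush pre' e' q₂') (ha : ∀ r ex, e'.ins ≠ .assign r ex)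
    (hb : ∀ c t, e'.ins ≠ .branch c t) :
    ∃ pre e q₂, q.Flush pre e q₂ ∧ pre' = C ++ pre.map (Entry.shift k) ∧ e' = e.shift k ∧
      Lifted k C q₂' q₂ := by
  cases hf with
  | crossed l' e' l₁' hp hd =>
    rw [h.past] at hp
    obtain rfl : C = [] := h.empty.resolve_right fun h' => by simp [h'] at hp
    obtain ⟨l, s, hq, rfl, hs⟩ := List.map_eq_append_iff.1 hp
    obtain ⟨e, l₁, rfl, rfl, rfl⟩ := List.map_eq_cons_iff.1 hs
    refine ⟨_, _, _, .crossed l e l₁ hq hd, rfl, rfl, ?_, h.spec, h.prelude, Or.inl rfl, h.next, h.low⟩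
    simp
  | uncrossed l' e' l₁' hp hd =>
    rw [h.spec] at hp
    obtain ⟨l, e, l₁, hq, rfl, rfl, rfl⟩ := h.prelude.split hp ha hb
    refine ⟨_, _, _, .uncrossed l e l₁ hq hd, h.base l, rfl, ?_⟩
    have := h.with_spec (l ++ { e with done := some 0 } :: l₁)
    simpa [Entry.shift] using this

variable {code' code : List Instr} {act : MemAction}

/-- A relocated process can do what the process does. -/
theorem act_up (hcode : CodeShift k code' code) {q₂ : Proc} (hact : q.Act code act q₂) :
    (q.shift k).Act code' act (q₂.shift k) := by
  have h := Lifted.shift k q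
  suffices H : ∃ q₂', (q.shift k).Act code' act q₂' ∧ Lifted k [] q₂' q₂ by
    obtain ⟨q₂', h1, h2⟩ := H
    exact h2.eq_shift ▸ h1
  have hb := fun l => (h.base l).symm
  simp only [List.nil_append] at hb
  cases hact with
  | fetch ins l hi hl =>
    refine ⟨_, .fetch (ins.shift k) (l + k) ?_ ?_, ?_⟩
    · rw [h.tracker, hcode, hi]; rfl
    · rw [h.tracker]; exact Instr.mem_successors_shift.2 ⟨l, hl, rfl⟩
    · have := (h.with_spec (q.spec ++ [⟨q.tracker, ins, l, none⟩])).settled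
      rw [h.tracker]
      simpa [Entry.shift, Proc.shift] using this
  | cross q₁ hc => exact ⟨_, .cross _ hc.shift, (Lifted.shift k q₁).settled⟩
  | readLocal l l' e m r a x v hs hi hd hx hpass hv =>
    refine ⟨_, .readLocal (l.map (Entry.shift k)) (l'.map (Entry.shift k)) (e.shift k) m r a x v
      (by simp [Proc.shift, hs]) ((Instr.shift_eq_iff (by simp) (by simp)).2 hi) hd ?_ ?_ ?_, ?_⟩
    · rw [← hb]; exact (h.prelude.envAfter_append _).symm ▸ hx
    · rw [← hb]; exact (h.prelude.readPasses m x _).2 hpass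
    · rw [← hb]; exact (h.prelude.localValue x v _).2 hv
    · have := (h.with_spec (l ++ { e with done := some v } :: l')).settled
      simpa [Entry.shift, Proc.shift] using this
  | readMemory l l' e m r a x v hs hi hd hx hpass hv =>
    refine ⟨_, .readMemory (l.map (Entry.shift k)) (l'.map (Entry.shift k)) (e.shift k) m r a x v
      (by simp [Proc.shift, hs]) ((Instr.shift_eq_iff (by simp) (by simp)).2 hi) hd ?_ ?_ ?_, ?_⟩
    · rw [← hb]; exact (h.prelude.envAfter_append _).symm ▸ hx
    · rw [← hb]; exact (h.prelude.readPasses m x _).2 hpass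
    · rw [← hb]; exact (h.prelude.noLocalWrite_nil x _).2 hv
    · have := (h.with_spec (l ++ { e with done := some v } :: l')).settled
      simpa [Entry.shift, Proc.shift] using this
  | flushWrite pre e q₁ m a ex x v hf hi hx hv hpass =>
    obtain ⟨q₂', h1, h2⟩ := h.flush_up hf
    exact ⟨q₂', .flushWrite _ _ _ m a ex x v h1 ((Instr.shift_eq_iff (by simp) (by simp)).2 hi)
      ((h.prelude.envAfter_append _).symm ▸ hx) ((h.prelude.envAfter_append _).symm ▸ hv)
      ((h.prelude.writePasses m x _).2 hpass), h2⟩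
  | flushFence pre e q₁ hf hi hpass =>
    obtain ⟨q₂', h1, h2⟩ := h.flush_up hf
    exact ⟨q₂', .flushFence _ _ _ h1 ((Instr.shift_eq_iff (by simp) (by simp)).2 hi)
      ((h.prelude.fencePasses _).2 hpass), h2⟩
  | dropBarrier e l rr rw wr ww hp hi =>
    exact ⟨_, .dropBarrier (e.shift k) (l.map (Entry.shift k)) rr rw wr ww
      (by simp [Proc.shift, hp]) ((Instr.shift_eq_iff (by simp) (by simp)).2 hi),
      rfl, rfl, .nil _, Or.inl rfl, rfl, by simp⟩
  | rmw e l r a ex x w v hpast hs hi hx hv =>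
    refine ⟨_, .rmw (e.shift k) (l.map (Entry.shift k)) r a ex x w v
      (by simp [Proc.shift, hpast]) (by simp [Proc.shift, hs])
      ((Instr.shift_eq_iff (by simp) (by simp)).2 hi) hx hv, ?_⟩
    exact (Lifted.shift k ⟨e.next, Function.update q.reg r w, [], l⟩).settled
  | fullFence e l hpast hs hi =>
    refine ⟨_, .fullFence (e.shift k) (l.map (Entry.shift k))
      (by simp [Proc.shift, hpast]) (by simp [Proc.shift, hs])
      ((Instr.shift_eq_iff (by simp) (by simp)).2 hi), ?_⟩
    exact (Lifted.shift k ⟨e.next, q.reg, [], l⟩).settled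

/-- The program counter crosses the first entry of the prelude. -/
theorem cross_prelude {e : Entry} (h : Lifted k (e :: C) q' q) {q₂' : Proc} (hc : q'.Cross q₂') :
    Lifted k C q₂' q := by
  have hpast : q.past = [] := h.empty.resolve_left (by simp)
  obtain ⟨reg, rfl, heff⟩ := hc.of_transparent h.prelude.transparent h.spec
  have henv := h.prelude.env
  have htr := h.prelude.transparent.2
  rw [envAfter, List.foldl_cons, heff] at henv
  rw [heff] at htr
  exact ⟨h.past, rfl, ⟨htr, henv⟩, Or.inr hpast, by simpa using h.next,
    fun l₁ f l₂ hC => by simpa using h.low (e :: l₁) f l₂ (by simp [hC])⟩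

/-- What a relocated process does comes from the process or crosses the prelude. -/
theorem act_down (h : Lifted k C q' q) (hcode : CodeShift k code' code)
    (hq : q.settled = q) {q₂' : Proc} (hact : q'.Act code' act q₂') :
    (∃ e C', C = e :: C' ∧ act = .tau ∧ Lifted k C' q₂' q) ∨
      ∃ q₂, q.Act code act q₂ ∧ Lifted k C q₂' q₂ := by
  have hb := h.base
  have hspec := h.spec
  -- RMWs and full fences execute only at the front of `spec`, which means that the prelude has been
  -- used up.
  have hhead : ∀ e l, q'.spec = e :: l → (∀ r ex, e.ins ≠ .assign r ex) →
      (∀ c t, e.ins ≠ .branch c t) → C = [] := fun e l hs h1 h2 => by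
    rcases C with _ | ⟨f, C⟩
    · rfl
    · obtain ⟨rfl, -⟩ := List.cons.inj (hspec.symm.trans hs)
      rcases h.prelude.transparent.ins (List.mem_cons_self ..) with ⟨_, _, hi⟩ | ⟨_, _, hi⟩
      · exact absurd hi (h1 _ _)
      · exact absurd hi (h2 _ _)
  cases hact with
  | fetch ins' l' hi hl =>
    rw [h.tracker, hcode] at hi
    obtain ⟨ins, hi', rfl⟩ := Option.map_eq_some_iff.1 hi
    rw [h.tracker] at hl
    obtain ⟨l, hl', rfl⟩ := Instr.mem_successors_shift.1 hl
    refine Or.inr ⟨_, .fetch ins l hi' hl', ?_⟩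
    have := (h.with_spec (q.spec ++ [⟨q.tracker, ins, l, none⟩])).settled
    rw [h.tracker, h.spec]
    simpa [Entry.shift, Proc.shift] using this
  | cross q₁ hc =>
    rcases C with _ | ⟨e, C⟩
    · obtain rfl := h.eq_shift
      obtain ⟨q₂, rfl, hc'⟩ := hc.of_shift
      exact Or.inr ⟨_, .cross _ hc', (Lifted.shift k q₂).settled⟩
    · refine Or.inl ⟨e, C, rfl, rfl, ?_⟩
      have := (h.cross_prelude hc).settled
      -- Since `q` is settled, the settling that follows the crossing does not affect it.
      rwa [hq] at this
  | readLocal l l' e m r a x v hs hi hd hx hpass hv =>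
    rw [hspec] at hs
    obtain ⟨l, e, l', hs', rfl, rfl, rfl⟩ := h.prelude.split hs (by simp [hi]) (by simp [hi])
    rw [hb] at hx hpass hv
    rw [h.prelude.envAfter_append] at hx
    refine Or.inr ⟨_, .readLocal l l' e m r a x v hs'
      ((Instr.shift_eq_iff (by simp) (by simp)).1 hi) hd hx ((h.prelude.readPasses m x _).1 hpass)
      ((h.prelude.localValue x v _).1 hv), ?_⟩
    have := (h.with_spec (l ++ { e with done := some v } :: l')).settled
    simpa [Entry.shift] using this
  | readMemory l l' e m r a x v hs hi hd hx hpass hv =>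
    rw [hspec] at hs
    obtain ⟨l, e, l', hs', rfl, rfl, rfl⟩ := h.prelude.split hs (by simp [hi]) (by simp [hi])
    rw [hb] at hx hpass hv
    rw [h.prelude.envAfter_append] at hx
    refine Or.inr ⟨_, .readMemory l l' e m r a x v hs'
      ((Instr.shift_eq_iff (by simp) (by simp)).1 hi) hd hx ((h.prelude.readPasses m x _).1 hpass)
      ((h.prelude.noLocalWrite_nil x _).1 hv), ?_⟩
    have := (h.with_spec (l ++ { e with done := some v } :: l')).settled
    simpa [Entry.shift] using this
  | flushWrite pre e q₁ m a ex x v hf hi hx hv hpass =>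
    obtain ⟨pre, e, q₂, hf', rfl, rfl, hl⟩ := h.flush_down hf (by simp [hi]) (by simp [hi])
    rw [h.prelude.envAfter_append] at hx hv
    exact Or.inr ⟨q₂, .flushWrite pre e q₂ m a ex x v hf'
      ((Instr.shift_eq_iff (by simp) (by simp)).1 hi) hx hv
      ((h.prelude.writePasses m x _).1 hpass), hl⟩
  | flushFence pre e q₁ hf hi hpass =>
    obtain ⟨pre, e, q₂, hf', rfl, rfl, hl⟩ := h.flush_down hf (by simp [hi]) (by simp [hi])
    exact Or.inr ⟨q₂, .flushFence pre e q₂ hf'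
      ((Instr.shift_eq_iff (by simp) (by simp)).1 hi) ((h.prelude.fencePasses _).1 hpass), hl⟩
  | dropBarrier e l rr rw wr ww hp hi =>
    rw [h.past] at hp
    obtain ⟨e, l, hq', rfl, rfl⟩ := List.map_eq_cons_iff.1 hp
    obtain rfl : C = [] := h.empty.resolve_right fun h' => by simp [h'] at hp
    exact Or.inr ⟨_, .dropBarrier e l rr rw wr ww hq'
      ((Instr.shift_eq_iff (by simp) (by simp)).1 hi), rfl, hspec, h.prelude, Or.inl rfl, h.next, h.low⟩
  | rmw e l r a ex x w v hpast hs hi hx hv =>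
    obtain rfl := hhead e l hs (by simp [hi]) (by simp [hi])
    obtain rfl := h.eq_shift
    obtain ⟨e, l, hs', rfl, rfl⟩ := List.map_eq_cons_iff.1 hs
    refine Or.inr ⟨_, .rmw e l r a ex x w v (List.map_eq_nil_iff.1 hpast) hs'
      ((Instr.shift_eq_iff (by simp) (by simp)).1 hi) hx hv, ?_⟩
    exact (Lifted.shift k ⟨e.next, Function.update q.reg r w, [], l⟩).settled
  | fullFence e l hpast hs hi =>
    obtain rfl := hhead e l hs (by simp [hi]) (by simp [hi])
    obtain rfl := h.eq_shift
    obtain ⟨e, l, hs', rfl, rfl⟩ := List.map_eq_cons_iff.1 hs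
    refine Or.inr ⟨_, .fullFence e l (List.map_eq_nil_iff.1 hpast) hs'
      ((Instr.shift_eq_iff (by simp) (by simp)).1 hi), ?_⟩
    exact (Lifted.shift k ⟨e.next, q.reg, [], l⟩).settled

end Lifted

/-! ## Speculation along the code -/

/-- The active entries `C` can be speculated along the code from the label `l` to `l'`. -/
def CodePath (code : List Instr) (l : ℕ) : List Entry → ℕ → Prop
  | [], l' => l' = l
  | e :: C, l' => e.label = l ∧ code[l]? = some e.ins ∧ e.next ∈ e.ins.successors l ∧
      e.done = none ∧ CodePath code e.next C l'

section CodePath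

variable {code : List Instr} {l l' : ℕ} {C C₁ C₂ : List Entry} {env : ℕ → Option ℕ}

theorem codePath_append :
    CodePath code l (C₁ ++ C₂) l' ↔ ∃ l₁, CodePath code l C₁ l₁ ∧ CodePath code l₁ C₂ l' := by
  induction C₁ generalizing l with
  | nil => simp [CodePath]
  | cons e C ih => simp [CodePath, ih, and_assoc]

theorem CodePath.exitLabel_eq (h : CodePath code l C l') : exitLabel l C = l' := by
  induction C generalizing l with
  | nil => exact h.symm
  | cons e C ih => rw [exitLabel_cons]; exact ih h.2.2.2.2

/-- Redirecting a branch leaves a path, because the corrected label is also one of its successors.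
-/
theorem CodePath.exists_settle (h : CodePath code l C l') (env : ℕ → Option ℕ) :
    ∃ l'', CodePath code l (settle env C) l'' := by
  induction C generalizing l env with
  | nil => exact ⟨l, rfl⟩
  | cons e C ih =>
    obtain ⟨h1, h2, h3, h4, h5⟩ := h
    by_cases hw : e.WellPredicted env
    · rw [settle_cons_of_wellPredicted hw]
      obtain ⟨l'', h6⟩ := ih h5 (e.effect env)
      exact ⟨l'', h1, h2, h3, h4, h6⟩
    · obtain ⟨c, t, b, hi, hb, hs⟩ := settle_cons_of_not_wellPredicted hw C
      rw [hs]
      refine ⟨_, h1, h2, ?_, h4, rfl⟩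
      simp only [hi, Instr.successors, h1]
      split_ifs <;> simp

/-- A fetched local instruction that is resolved settles. -/
theorem settle_singleton {e : Entry} (h : Transparent env [e]) (hd : e.done = none) {n : ℕ}
    (hn : n ∈ e.ins.successors e.label) :
    settle env [⟨e.label, e.ins, n, none⟩] = [e] := by
  obtain ⟨la, i, nx, d⟩ := e
  simp only at hd hn
  subst hd
  rcases h.1 with ⟨r, ex, hi, hx⟩ | ⟨c, t, b, hi, hb, hx⟩
  · simp only at hi hx
    subst hi hx
    simp only [Instr.successors, Set.mem_singleton_iff] at hn
    subst hn
    rfl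
  · simp only at hi hx
    subst hi
    by_cases hw : (⟨la, .branch c t, n, none⟩ : Entry).WellPredicted env
    · have := hw c t b rfl hb
      simp only at this
      rw [settle_cons_of_wellPredicted hw, this, hx]
      rfl
    · obtain ⟨c', t', b', hi', hb', hs⟩ := settle_cons_of_not_wellPredicted hw []
      rw [hs]
      cases hi'
      rw [hb] at hb'
      cases hb'
      rw [hx]

/-- Two paths from the same label, one of which is resolved: one extends the other. -/
theorem CodePath.compare {l₁ l₂ : ℕ} (h₁ : CodePath code l C₁ l₁) (hs : settle env C₁ = C₁)
    (h₂ : CodePath code l C₂ l₂) (ht : Transparent env C₂) :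
    (∃ rest, rest ≠ [] ∧ C₂ = C₁ ++ rest) ∨ ∃ s, C₁ = C₂ ++ s := by
  induction C₂ generalizing C₁ l env with
  | nil => exact Or.inr ⟨C₁, rfl⟩
  | cons e C ih =>
    rcases C₁ with _ | ⟨f, C₁⟩
    · exact Or.inl ⟨e :: C, by simp, rfl⟩
    rw [settle_cons_eq_self] at hs
    obtain ⟨h1, h2, h3, h4, h5⟩ := h₁
    obtain ⟨h6, h7, h8, h9, h10⟩ := h₂
    have hi : f.ins = e.ins := Option.some.inj (h2.symm.trans h7)
    -- An assignment has only one successor. For a resolved branch, settledness of the one path and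
    -- resolution of the other dictate the same label.
    have hn : f.next = e.next := by
      rcases ht.1 with ⟨r, ex, hi', hx⟩ | ⟨c, t, b, hi', hb, hx⟩
      · rw [hi, hi'] at h3
        rw [hx, h6]; exact h3
      · rw [hs.1 c t b (hi.trans hi') hb, hx, h1, h6]
    obtain rfl : f = e := by
      cases f; cases e; simp_all
    rcases ih h5 hs.2 h10 ht.2 with ⟨rest, h11, rfl⟩ | ⟨s, rfl⟩
    · exact Or.inl ⟨rest, h11, rfl⟩
    · exact Or.inr ⟨s, rfl⟩

theorem Instr.shift_injective (k : ℕ) : Function.Injective (Instr.shift k) := by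
  intro i j h
  cases i <;> cases j <;> simp_all [Instr.shift]

theorem Entry.shift_injective (k : ℕ) : Function.Injective (Entry.shift k) := by
  rintro ⟨l, i, n, d⟩ ⟨l', i', n', d'⟩ h
  simp only [Entry.shift, Entry.mk.injEq, Nat.add_right_cancel_iff] at h ⊢
  exact ⟨h.1, Instr.shift_injective k h.2.1, h.2.2⟩

/-- From label `k` on there is only relocated code, whose jump targets are relocated with it. A path
that starts there never gets back into the preamble. -/
theorem CodePath.of_shift {k : ℕ} {code' : List Instr} (hcode : CodeShift k code' code)
    (h : CodePath code' (l + k) C l') :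
    ∃ C₀ l₀, C = C₀.map (Entry.shift k) ∧ CodePath code l C₀ l₀ := by
  induction C generalizing l with
  | nil => exact ⟨[], l, rfl, rfl⟩
  | cons e C ih =>
    obtain ⟨h1, h2, h3, h4, h5⟩ := h
    rw [hcode] at h2
    obtain ⟨i, hi, hi'⟩ := Option.map_eq_some_iff.1 h2
    rw [← hi'] at h3
    obtain ⟨n, hn, hn'⟩ := Instr.mem_successors_shift.1 h3
    rw [hn'] at h5
    obtain ⟨C₀, l₀, rfl, h6⟩ := ih h5
    refine ⟨⟨l, i, n, none⟩ :: C₀, l₀, ?_, rfl, hi, hn, rfl, h6⟩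
    obtain ⟨la, j, nx, d⟩ := e
    simp_all [Entry.shift]

/-- The steps of a process that do not involve the propagation unit. -/
def Proc.TauReach (code : List Instr) : Proc → Proc → Prop :=
  Relation.ReflTransGen fun q q' => q.Act code .tau q'

/-- A settled path can be fetched. -/
theorem CodePath.tauReach {pc : ℕ} {reg : ℕ → ℕ} {s : List Entry} (h : CodePath code pc s l')
    (hs : settle (fun r => some (reg r)) s = s) :
    Proc.TauReach code ⟨pc, reg, [], []⟩ ⟨pc, reg, [], s⟩ := by
  induction s using List.reverseRecOn generalizing l' with
  | nil => exact .refl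
  | append_singleton s e ih =>
    obtain ⟨l₁, h1, h2, h3, h4, h5, -⟩ := codePath_append.1 h
    refine .tail (ih h1 (settle_append_eq_self.1 hs).1) ?_
    have ht : (⟨pc, reg, [], s⟩ : Proc).tracker = l₁ := h1.exitLabel_eq
    have := Proc.Act.fetch (code := code) (q := ⟨pc, reg, [], s⟩) e.ins e.next
      (by rw [ht]; exact h3) (by rw [ht]; exact h4)
    have he : (⟨l₁, e.ins, e.next, none⟩ : Entry) = e := by
      cases e; simp_all
    simpa only [ht, he, Proc.settled, hs] using this

end CodePath

/-! ### Processes that have passed the synchronization of their preamble -/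

/-- `q'` has passed the synchronization of its preamble, but may still have to cross or even to
fetch some of the local instructions that prepare the registers for the code of `q`, which
starts at `pc` with the registers `reg`. -/
inductive Post (k : ℕ) (code' : List Instr) (pc : ℕ) (reg : ℕ → ℕ) (q' : Proc) : Proc → Prop
  | lifted (C : List Entry) (q : Proc) (h : Lifted k C q' q) (hq : q.settled = q) :
      Post k code' pc reg q' q
  | fetching (rest : List Entry) (hrest : rest ≠ []) (past : q'.past = [])
      (prelude : Prelude q'.reg reg (q'.spec ++ rest))
      (path : CodePath code' q'.pc (q'.spec ++ rest) (pc + k))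
      (low : ∀ l₁ e l₂, q'.spec ++ rest = l₁ ++ e :: l₂ → exitLabel q'.pc l₁ < k) :
      Post k code' pc reg q' ⟨pc, reg, [], []⟩

namespace Post

variable {k pc : ℕ} {code code' : List Instr} {reg : ℕ → ℕ} {q' q : Proc}

/-- A process in the state `fetching` has only assignments and resolved branches in its buffer, so
it can do nothing but fetch and cross. To the original process, which has not started, these steps
are invisible. -/
theorem act (h : Post k code' pc reg q' q) (hcode : CodeShift k code' code) {act : MemAction}
    {q₂' : Proc} (hact : q'.Act code' act q₂') :
    (act = .tau ∧ Post k code' pc reg q₂' q) ∨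
      ∃ q₂, q.Act code act q₂ ∧ Post k code' pc reg q₂' q₂ := by
  cases h with
  | lifted C q h hq =>
    rcases h.act_down hcode hq hact with ⟨e, C', -, h1, h2⟩ | ⟨q₂, h1, h2⟩
    · exact Or.inl ⟨h1, .lifted C' q h2 hq⟩
    · exact Or.inr ⟨q₂, h1, .lifted C q₂ h2 (h1.settled hq)⟩
  | fetching rest hrest hpast hpre hpath hlow =>
    left
    have hins := fun e he => hpre.transparent.ins (e := e) he
    have hno : ∀ l e l', q'.spec = l ++ e :: l' → (∀ r ex, e.ins ≠ .assign r ex) →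
        (∀ c t, e.ins ≠ .branch c t) → False := fun l e l' hs ha hb => by
      rcases hins e (by simp [hs]) with ⟨_, _, hi⟩ | ⟨_, _, hi⟩
      · exact ha _ _ hi
      · exact hb _ _ hi
    have hnof : ∀ pre e q₂, q'.Flush pre e q₂ → (∀ r ex, e.ins ≠ .assign r ex) →
        (∀ c t, e.ins ≠ .branch c t) → False := fun pre e q₂ hf ha hb => by
      cases hf with
      | crossed l e l' hp => simp [hpast] at hp
      | uncrossed l e l' hs => exact hno l e l' hs ha hb
    cases hact with
    | fetch ins n hi hn =>
      refine ⟨rfl, ?_⟩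
      obtain ⟨e, rest, rfl⟩ := List.exists_cons_of_ne_nil hrest
      obtain ⟨l₁, h1, h2⟩ := codePath_append.1 hpath
      have ht : q'.tracker = l₁ := h1.exitLabel_eq
      obtain ⟨h3, h4, h5, h6, h7⟩ := h2
      rw [ht, h4] at hi
      cases hi
      rw [ht, ← h3] at hn
      have htr := hpre.transparent.of_append
      -- A wrong guess at a resolved branch is corrected by the settling that is part of the fetch.
      have hset : Proc.settled
          { q' with spec := q'.spec ++ [⟨q'.tracker, e.ins, n, none⟩] } =
          { q' with spec := q'.spec ++ [e] } := by
        simp only [Proc.settled, Proc.mk.injEq, true_and]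
        rw [htr.1.settle, ht, ← h3, settle_singleton ⟨htr.2.1, trivial⟩ h6 hn]
      rw [hset]
      have happ : q'.spec ++ e :: rest = (q'.spec ++ [e]) ++ rest := by simp
      rw [happ] at hpre hpath hlow
      -- When the last entry of the resolved path has been fetched, the buffer is a complete prelude
      -- and the tracker is at the first label of the original run.
      by_cases hr : rest = []
      · subst hr
        rw [List.append_nil] at hpre hpath hlow
        exact .lifted (q'.spec ++ [e]) _
          ⟨hpast, by simp, hpre, Or.inr rfl, hpath.exitLabel_eq, hlow⟩ rfl
      · exact .fetching rest hr hpast hpre hpath hlow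
    | cross q₁ hc =>
      refine ⟨rfl, ?_⟩
      rcases hs : q'.spec with _ | ⟨e, s⟩
      · cases hc <;> simp_all
      rw [hs] at hpre hpath hlow
      obtain ⟨reg₁, rfl, heff⟩ := hc.of_transparent hpre.transparent hs
      have henv := hpre.env
      have htr := hpre.transparent.2
      simp only [envAfter, List.cons_append, List.foldl_cons, heff] at henv htr
      have hset : Proc.settled ⟨e.next, reg₁, q'.past, s⟩ = ⟨e.next, reg₁, q'.past, s⟩ := by
        have := htr.of_append.1.settle []
        rw [Proc.settled_eq_self]
        simpa [settle] using this
      rw [hset]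
      exact .fetching rest hrest hpast ⟨htr, henv⟩ hpath.2.2.2.2
        fun l₁ f l₂ hl => by simpa using hlow (e :: l₁) f l₂ (by simpa using hl)
    | readLocal l l' e m r a x v hs hi =>
      exact (hno l e l' hs (by simp [hi]) (by simp [hi])).elim
    | readMemory l l' e m r a x v hs hi =>
      exact (hno l e l' hs (by simp [hi]) (by simp [hi])).elim
    | flushWrite pre e q₁ m a ex x v hf hi =>
      exact (hnof pre e _ hf (by simp [hi]) (by simp [hi])).elim
    | flushFence pre e q₁ hf hi => exact (hnof pre e _ hf (by simp [hi]) (by simp [hi])).elim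
    | dropBarrier e l rr rw wr ww hp => simp [hpast] at hp
    | rmw e l r a ex x w v hp hs hi => exact (hno [] e l hs (by simp [hi]) (by simp [hi])).elim
    | fullFence e l hp hs hi => exact (hno [] e l hs (by simp [hi]) (by simp [hi])).elim

/-- Beyond the preamble, the control states correspond. -/
theorem control (h : Post k code' pc reg q' q) (hk : k ≤ q'.pc) :
    q'.pc = q.pc + k ∧ q'.reg = q.reg := by
  cases h with
  | lifted C q h hq =>
    rcases C with _ | ⟨e, C⟩
    · rw [h.eq_shift]; exact ⟨rfl, rfl⟩
    · have := h.low [] e C rfl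
      simp at this
      omega
  | fetching rest hrest hpast hpre hpath hlow =>
    obtain ⟨e, l, he⟩ := List.exists_cons_of_ne_nil (l := q'.spec ++ rest) (by simp [hrest])
    have := hlow [] e l he
    simp at this
    omega

/-- A process that enters the final part `C` of its preamble is related to a process that
has fetched what has been speculated of its code. -/
theorem of_codePath (hcode : CodeShift k code' code) (hpast : q'.past = []) {l' : ℕ}
    (hpath : CodePath code' q'.pc q'.spec l') (hset : q'.settled = q') {C : List Entry}
    (hpre : Prelude q'.reg reg C) (hC : CodePath code' q'.pc C (pc + k))
    (low : ∀ l₁ e l₂, C = l₁ ++ e :: l₂ → exitLabel q'.pc l₁ < k) :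
    ∃ q, Proc.TauReach code ⟨pc, reg, [], []⟩ q ∧ Post k code' pc reg q' q := by
  rw [Proc.settled_eq_self] at hset
  -- What has been speculated is either a proper initial part of the resolved path or continues it
  -- into the relocated code. In the second case the original process fetches the continuation.
  rcases hpath.compare hset hC hpre.transparent with ⟨rest, hr, rfl⟩ | ⟨s, hs⟩
  · exact ⟨_, .refl, .fetching rest hr hpast hpre hC low⟩
  · rw [hs, settle_append_eq_self] at hset
    have h1 : settle (fun r => some (reg r)) s = s := by
      have := hset.2
      rwa [show C.foldl Entry.effect (fun r => some (q'.reg r)) = _ from hpre.env] at this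
    rw [hs, codePath_append] at hpath
    obtain ⟨l₁, h2, h3⟩ := hpath
    obtain rfl : l₁ = pc + k := by rw [← h2.exitLabel_eq, hC.exitLabel_eq]
    obtain ⟨s₀, l₀, rfl, h4⟩ := h3.of_shift hcode
    rw [settle_shift] at h1
    have h5 := List.map_injective_iff.2 (Entry.shift_injective k) h1
    exact ⟨_, h4.tauReach h5, .lifted C _ ⟨hpast, hs, hpre, Or.inr rfl, hC.exitLabel_eq, low⟩
      (Proc.settled_eq_self.2 h5)⟩

end Post

/-! ### Processes that have not passed the synchronization of their preamble -/

/-- Nothing but speculation along the code has happened so far, and no register is in use, except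
for the register `0`. -/
structure Speculating (code : List Instr) (q : Proc) : Prop where
  past : q.past = []
  path : ∃ l', CodePath code q.pc q.spec l'
  settled : q.settled = q
  reg : ∀ r, r ≠ 0 → q.reg r = 0

namespace Speculating

variable {code : List Instr} {q q' : Proc} {act : MemAction}

theorem settled_of {pc : ℕ} {reg : ℕ → ℕ} {s : List Entry} {l' : ℕ} (h : CodePath code pc s l')
    (hreg : ∀ r, r ≠ 0 → reg r = 0) :
    Speculating code (Proc.settled ⟨pc, reg, [], s⟩) :=
  ⟨rfl, h.exists_settle _, Proc.settled_settled _, hreg⟩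

theorem fetch (h : Speculating code q) {ins : Instr} {l : ℕ} (hi : code[q.tracker]? = some ins)
    (hl : l ∈ ins.successors q.tracker) :
    Speculating code (Proc.settled { q with spec := q.spec ++ [⟨q.tracker, ins, l, none⟩] }) := by
  obtain ⟨l', hp⟩ := h.path
  have ht : q.tracker = l' := hp.exitLabel_eq
  obtain rfl := ht
  have hnew : CodePath code q.tracker [⟨q.tracker, ins, l, none⟩] l := ⟨rfl, hi, hl, rfl, rfl⟩
  have := settled_of (codePath_append.2 ⟨_, hp, hnew⟩) h.reg
  simpa only [Proc.settled, h.past] using this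

/-- If a read-modify-write precedes everything else, apart from branches, then only fetching,
crossing, and executing the first entry are possible. -/
theorem act_cases (h : Speculating code q)
    (hspec : ∀ l e l', q.spec = l ++ e :: l' → (∃ c t, e.ins = .branch c t) ∨
      (∃ r a ex, e.ins = .rmw r a ex) ∨ ∃ f ∈ l, ∃ r a ex, f.ins = .rmw r a ex)
    (hact : q.Act code act q') :
    (act = .tau ∧ Speculating code q' ∧ q'.pc = q.pc ∧ q'.reg = q.reg) ∨
    (∃ q₁, act = .tau ∧ q.Cross q₁ ∧ q' = q₁.settled) ∨
    ∃ e l r a ex x w v, q.spec = e :: l ∧ e.ins = .rmw r a ex ∧ act = .rmw (some x) w v ∧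
      a.eval (fun s => some (q.reg s)) = some x ∧
      ex.eval (fun s => some (Function.update q.reg r w s)) = some v ∧
      q' = Proc.settled ⟨e.next, Function.update q.reg r w, [], l⟩ := by
  have hmem : ∀ (l : List Entry) (R : List Entry → Entry → Prop), PassesAll R (q.past ++ l) →
      (∃ f ∈ l, ∃ r a ex, f.ins = .rmw r a ex) → ∃ l' f, (∃ r a ex, f.ins = .rmw r a ex) ∧
        R l' f := by
    rintro l R hR ⟨f, hf, hf'⟩
    obtain ⟨l₁, l₂, rfl⟩ := List.append_of_mem hf
    exact ⟨_, f, hf', hR (q.past ++ l₁) f l₂ (by simp)⟩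
  cases hact with
  | fetch ins l hi hl => exact Or.inl ⟨rfl, h.fetch hi hl, rfl, rfl⟩
  | cross q₁ hc => exact Or.inr (Or.inl ⟨q₁, rfl, hc, rfl⟩)
  | readLocal l l' e m r a x v hs hi hd hx hpass | readMemory l l' e m r a x v hs hi hd hx hpass =>
    rcases hspec l e l' hs with ⟨_, _, h1⟩ | ⟨_, _, _, h1⟩ | h1
    · simp [hi] at h1
    · simp [hi] at h1
    · obtain ⟨l', f, ⟨_, _, _, hf⟩, hR⟩ := hmem l _ hpass h1
      simp [ReadPasses, hf] at hR
  | flushWrite pre e q₁ m a ex x v hf hi hx hv hpass =>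
    cases hf with
    | crossed l e l' hp => simp [h.past] at hp
    | uncrossed l e l' hs =>
      rcases hspec l e l' hs with ⟨_, _, h1⟩ | ⟨_, _, _, h1⟩ | h1
      · simp [hi] at h1
      · simp [hi] at h1
      · obtain ⟨l', f, ⟨_, _, _, hf⟩, hR⟩ := hmem l _ hpass h1
        simp [WritePasses, hf] at hR
  | flushFence pre e q₁ hf hi hpass =>
    cases hf with
    | crossed l e l' hp => simp [h.past] at hp
    | uncrossed l e l' hs =>
      rcases hspec l e l' hs with ⟨_, _, h1⟩ | ⟨_, _, _, h1⟩ | h1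
      · simp [hi] at h1
      · simp [hi] at h1
      · obtain ⟨l', f, ⟨_, _, _, hf⟩, hR⟩ := hmem l _ hpass h1
        simp [FencePasses, hf] at hR
  | dropBarrier e l rr rw wr ww hp => simp [h.past] at hp
  | rmw e l r a ex x w v hp hs hi hx hv =>
    exact Or.inr (Or.inr ⟨e, l, r, a, ex, x, w, v, hs, hi, rfl, hx, hv, rfl⟩)
  | fullFence e l hp hs hi =>
    rcases hspec [] e l hs with ⟨_, _, h1⟩ | ⟨_, _, _, h1⟩ | ⟨f, hf, -⟩
    · simp [hi] at h1
    · simp [hi] at h1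
    · simp at hf

/-- The possible steps in front of a read-modify-write. -/
theorem act_rmw (h : Speculating code q) {a ex : Expr}
    (hcode : code[q.pc]? = some (.rmw 0 a ex)) (hact : q.Act code act q') :
    (act = .tau ∧ Speculating code q' ∧ q'.pc = q.pc ∧ q'.reg = q.reg) ∨
    ∃ x w v, act = .rmw (some x) w v ∧ a.eval (fun s => some (q.reg s)) = some x ∧
      ex.eval (fun s => some (Function.update q.reg 0 w s)) = some v ∧
      Speculating code q' ∧ q'.pc = q.pc + 1 ∧ q'.reg = Function.update q.reg 0 w := by
  obtain ⟨l', hp⟩ := h.path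
  have hhead : ∀ e l, q.spec = e :: l → e.ins = .rmw 0 a ex := fun e l hs => by
    rw [hs] at hp
    exact (Option.some.inj (hcode.symm.trans hp.2.1)).symm
  have hsp : ∀ l e l', q.spec = l ++ e :: l' → (∃ c t, e.ins = .branch c t) ∨
      (∃ r a ex, e.ins = .rmw r a ex) ∨ ∃ f ∈ l, ∃ r a ex, f.ins = .rmw r a ex := by
    intro l e l₂ hs
    rcases l with _ | ⟨f, l⟩
    · exact Or.inr (Or.inl ⟨_, _, _, hhead e l₂ hs⟩)
    · exact Or.inr (Or.inr ⟨f, by simp, _, _, _, hhead f _ hs⟩)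
  rcases h.act_cases hsp hact with
    h1 | ⟨q₁, -, hc, -⟩ | ⟨e, l, r, a', ex', x, w, v, hs, hi, rfl, hx, hv, rfl⟩
  · exact Or.inl h1
  -- The program counter passes an RMW by executing it; no crossing rule applies.
  · exfalso
    cases hc with
    | flushed e l hs hi => rw [hhead e l hs] at hi; simp at hi
    | assign e l _ _ _ hs hi | branch e l _ _ hs hi | choose e l _ hs hi | read e l _ _ _ _ hs hi
    | write e l _ _ _ _ _ hs hi | lwsync e l hs hi | isync e l hs hi
    | membar e l _ _ _ _ hs hi => rw [hhead e l hs] at hi; cases hi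
  · rw [hhead e l hs] at hi
    cases hi
    refine Or.inr ⟨x, w, v, rfl, hx, hv, ?_⟩
    rw [hs] at hp
    obtain ⟨-, -, h3, -, h5⟩ := hp
    rw [hhead e l hs] at h3
    have hn : e.next = q.pc + 1 := h3
    refine ⟨settled_of h5 fun r hr => ?_, hn, rfl⟩
    rw [Function.update_of_ne hr]; exact h.reg r hr

/-- The possible steps in front of a resolved branch to a read-modify-write. -/
theorem act_branch (h : Speculating code q) {c : Expr} {t b t' r : ℕ} {a ex : Expr}
    (hcode : code[q.pc]? = some (.branch c t))
    (hb : c.eval (fun s => some (q.reg s)) = some b) (ht' : t' = if b = 0 then q.pc + 1 else t)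
    (hcode' : code[t']? = some (.rmw r a ex)) (hact : q.Act code act q') :
    act = .tau ∧ Speculating code q' ∧ q'.reg = q.reg ∧ (q'.pc = q.pc ∨ q'.pc = t') := by
  obtain ⟨l', hp⟩ := h.path
  have hset := Proc.settled_eq_self.1 h.settled
  have hhead : ∀ e l, q.spec = e :: l → e.ins = .branch c t ∧ e.next = t' ∧
      CodePath code t' l l' := fun e l hs => by
    rw [hs] at hp hset
    have h1 := (Option.some.inj (hcode.symm.trans hp.2.1)).symm
    have h2 := (settle_cons_eq_self.1 hset).1 c t b h1 hb
    rw [hp.1, ← ht'] at h2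
    exact ⟨h1, h2, h2 ▸ hp.2.2.2.2⟩
  have hsp : ∀ l e l', q.spec = l ++ e :: l' → (∃ c t, e.ins = .branch c t) ∨
      (∃ r a ex, e.ins = .rmw r a ex) ∨ ∃ f ∈ l, ∃ r a ex, f.ins = .rmw r a ex := by
    intro l e l₂ hs
    rcases l with _ | ⟨f, l⟩
    · exact Or.inl ⟨_, _, (hhead e l₂ hs).1⟩
    · obtain ⟨h1, h2, h3⟩ := hhead f _ hs
      -- The resolved branch is followed by the RMW at `t'`, which holds back everything after it.
      rcases l with _ | ⟨g, l⟩
      · exact Or.inr (Or.inl ⟨_, _, _, (Option.some.inj (hcode'.symm.trans h3.2.1)).symm⟩)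
      · exact Or.inr (Or.inr ⟨g, by simp, _, _, _,
          (Option.some.inj (hcode'.symm.trans h3.2.1)).symm⟩)
  rcases h.act_cases hsp hact with
    ⟨h1, h2, h3, h4⟩ | ⟨q₁, rfl, hc, rfl⟩ | ⟨e, l, r, a', ex', x, w, v, hs, hi, rfl, hx, hv, rfl⟩
  · exact ⟨h1, h2, h4, Or.inl h3⟩
  · cases hc with
    | branch e l c' t hs hi =>
      obtain ⟨h1, h2, h3⟩ := hhead e l hs
      rw [h2, h.past]
      exact ⟨rfl, settled_of h3 h.reg, rfl, Or.inr rfl⟩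
    | flushed e l hs hi => rw [(hhead e l hs).1] at hi; simp at hi
    | assign e l _ _ _ hs hi | choose e l _ hs hi | read e l _ _ _ _ hs hi
    | write e l _ _ _ _ _ hs hi | lwsync e l hs hi | isync e l hs hi
    | membar e l _ _ _ _ hs hi => rw [(hhead e l hs).1] at hi; cases hi
  · rw [(hhead e l hs).1] at hi
    cases hi

end Speculating

/-! ### Last messages, their values and their visibility -/

namespace Mem

/-- The last message to `x` has the value `v` and is seen by the processes in `A`. -/
def LastMsg (m : Mem) (x : Loc) (v : ℕ) (A : Set ℕ) : Prop :=
  ∃ i, m.IsLast x i ∧ (m.msg i).val = v ∧ A ⊆ (m.msg i).seen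

/-- There is at most one message per location. -/
def Unique (m : Mem) : Prop :=
  ∀ u ∈ m.writes, ∀ v ∈ m.writes, (m.msg u).loc = (m.msg v).loc → u = v

/-- The last messages can be the source of a read-modify-write. -/
def Sourced (m : Mem) : Prop := ∀ x i, m.IsLast x i → (m.msg i).source = true

/-- The garbage has been collected. -/
def Clean (n : ℕ) (m : Mem) : Prop := m.gc n = m

section Preservation

variable {n p v w : ℕ} {L : Loc → Prop} {m m' : Mem} {M : Propagation} {x y : Loc} {A : Set ℕ}

theorem gc_clean (n : ℕ) (m : Mem) : Clean n (m.gc n) := by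
  have h1 : ((m.gc n).gc n).writes = (m.gc n).writes := by
    ext i
    rw [mem_gc_writes]
    exact and_iff_left_of_imp fun h => ((mem_gc_writes m n i).1 h).2
  have h2 : ((m.gc n).gc n).fences = (m.gc n).fences := by
    ext i
    rw [mem_gc_fences]
    refine and_iff_left_of_imp fun h => ?_
    obtain ⟨-, v, h3, h4⟩ := (mem_gc_fences m n i).1 h
    exact ⟨v, (mem_gc_writes m n v).2 ⟨h3, h4.1⟩, h4⟩
  calc (m.gc n).gc n = ⟨((m.gc n).gc n).writes, ((m.gc n).gc n).fences, m.msg, m.issuer, m.lt⟩ := rfl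
    _ = m.gc n := by rw [h1, h2]; rfl

theorem Core.read (h : Core n L m) (hp : p < n) (hr : m.Readable p x v) :
    Core n L (m.read n p v) :=
  (h.readRaw hr.1 hr.2.2.1 hr.2.2.2).gc (by omega)

theorem Core.update (h : Core n L m) (hp : p < n) (hv : v ∈ m.writes)
    (hr : p ∉ (m.msg v).redundant) : Core n L (m.update n p v) :=
  (h.updateRaw hv hr).gc (by omega)

theorem Core.write (h : Core n L m) (hp : p < n) (hx : L x) (v : ℕ) :
    Core n L (m.write M n p x v) :=
  (h.writeRaw M hx v).gc (by omega)

theorem Core.act (h : Core n L m) (hp : p < n) {act : MemAction} (hact : act.LocsIn L)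
    (ha : m.Act M n p act m') : Core n L m' := by
  cases act with
  | tau => cases ha; exact h
  | read x v => obtain ⟨v₀, hr, -, rfl⟩ := ha; exact h.read hp hr
  | write x v => cases ha; exact h.write hp hact v
  | fence => cases ha; exact h.fence M hp
  | rmw x r v =>
    obtain ⟨v₀, hr, -, rfl⟩ := ha
    exact (((h.read hp hr.1).fence M hp).consume v₀).write hp hact v

theorem LastMsg.mono (h : m.LastMsg x v A) {B : Set ℕ} (hB : B ⊆ A) : m.LastMsg x v B :=
  let ⟨i, h1, h2, h3⟩ := h
  ⟨i, h1, h2, hB.trans h3⟩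

theorem LastMsg.update (h : m.LastMsg x v A) (hm : Core n L m) (hp : p < n) (hw : w ∈ m.writes)
    (hr : p ∉ (m.msg w).redundant) : (m.update n p w).LastMsg x v A := by
  obtain ⟨i, h1, h2, h3⟩ := h
  refine ⟨i, (updateRaw_isLast.2 h1).gc (hm.updateRaw hw hr) (by omega), ?_, fun q hq => ?_⟩
  · rw [update_eq, gc_msg, updateRaw_val]; exact h2
  · rw [update_eq, gc_msg, mem_updateRaw_seen]; exact Or.inl (h3 hq)

theorem LastMsg.read (h : m.LastMsg x v A) (hm : Core n L m) (hp : p < n)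
    (hr : m.Readable p y w) : (m.read n p w).LastMsg x v A := by
  obtain ⟨i, h1, h2, h3⟩ := h
  refine ⟨i, (readRaw_isLast.2 h1).gc (hm.readRaw hr.1 hr.2.2.1 hr.2.2.2) (by omega), ?_, ?_⟩
  · rw [read_eq, gc_msg, readRaw_val]; exact h2
  · rw [read_eq, gc_msg, readRaw_seen]; exact h3

theorem LastMsg.fence (h : m.LastMsg x v A) (M : Propagation) (p : ℕ) :
    (m.fence M p).LastMsg x v A := by
  simpa [LastMsg, fence_isLast] using h

theorem LastMsg.consume (h : m.LastMsg x v A) (w : ℕ) : (m.consume w).LastMsg x v A := by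
  simpa [LastMsg] using h

theorem LastMsg.write (h : m.LastMsg x v A) (hm : Core n L m) (hp : p < n) (hy : L y)
    (hxy : x ≠ y) (w : ℕ) : (m.write M n p y w).LastMsg x v A := by
  obtain ⟨i, h1, h2, h3⟩ := h
  have hi := ne_fresh_of_mem_writes h1.1
  refine ⟨i, (writeRaw_isLast_of_ne hxy h1).gc (hm.writeRaw M hy w) (by omega), ?_, ?_⟩
  · rw [write_eq, gc_msg, writeRaw_val _ _ _ _ _ hi]; exact h2
  · rw [write_eq, gc_msg, writeRaw_seen _ _ _ _ _ hi]; exact h3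

theorem lastMsg_write (hm : Core n L m) (hp : p < n) (hx : L x) (v : ℕ) :
    (m.write M n p x v).LastMsg x v {p} := by
  refine ⟨m.fresh, (writeRaw_isLast_fresh ..).gc (hm.writeRaw M hx v) (by omega), ?_, ?_⟩
  · rw [write_eq, gc_msg, writeRaw_msg_fresh]
  · rw [write_eq, gc_msg, writeRaw_msg_fresh]
    exact Set.singleton_subset_iff.2 (mem_audience M hp)

/-- The location written by the action. -/
def _root_.MemAction.target : MemAction → Option Loc
  | .write x _ => some (some x)
  | .rmw x _ _ => some x
  | _ => none

theorem LastMsg.act (h : m.LastMsg x v A) (hm : Core n L m) (hp : p < n) {act : MemAction}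
    (hact : act.LocsIn L) (hx : act.target ≠ some x) (ha : m.Act M n p act m') :
    m'.LastMsg x v A := by
  cases act with
  | tau => cases ha; exact h
  | read x v => obtain ⟨v₀, hr, -, rfl⟩ := ha; exact h.read hm hp hr
  | write x v => cases ha; exact h.write hm hp hact (fun h' => hx (by rw [h']; rfl)) v
  | fence => cases ha; exact h.fence M p
  | rmw x r v =>
    obtain ⟨v₀, hr, -, rfl⟩ := ha
    exact (((h.read hm hp hr.1).fence M p).consume v₀).write
      (((hm.read hp hr.1).fence M hp).consume v₀) hp hact (fun h' => hx (by rw [h']; rfl)) v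

theorem Act.lastMsg {r : ℕ} (ha : m.Act M n p (.rmw x r v) m') (hm : Core n L m) (hp : p < n)
    (hx : L x) : m'.LastMsg x v {p} := by
  obtain ⟨v₀, hr, -, rfl⟩ := ha
  exact lastMsg_write (((hm.read hp hr.1).fence M hp).consume v₀) hp hx v

/-- An RMW reads the last message, never a stale one. Hence a waiting process finds `0` before the
flag is set and `1` afterwards. -/
theorem Act.eq_of_lastMsg {r : ℕ} (ha : m.Act M n p (.rmw x r v) m') (hm : Core n L m)
    (hx : x ≠ none) (h : m.LastMsg x w A) : r = w := by
  obtain ⟨v₀, hr, hv, rfl⟩ := ha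
  obtain ⟨i, h1, h2, -⟩ := h
  rw [← hm.isLast_unique (hr.isLast hm) h1] at h2
  exact (hv.resolve_left hx).symm.trans h2

theorem Unique.gc (h : m.Unique) (n : ℕ) : (m.gc n).Unique := fun u hu v hv =>
  h u (mem_writes_of_gc hu) v (mem_writes_of_gc hv)

theorem Unique.update (h : m.Unique) (n p v : ℕ) : (m.update n p v).Unique := by
  refine Unique.gc (m := m.updateRaw p v) ?_ n
  simpa [Unique] using h

/-- In a multi-copy-atomic unit a write makes the earlier messages to its location redundant to
every process, and garbage collection removes them at once. -/
theorem Unique.rmw (h : m.Unique) (n p v₀ v : ℕ) :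
    (m.rmw .multiCopyAtomic n p x v₀ v).Unique := by
  have h1 : (m.read n p v₀).Unique := by
    refine Unique.gc (m := m.readRaw p v₀) ?_ n
    simpa [Unique] using h
  have h2 : (((m.read n p v₀).fence .multiCopyAtomic p).consume v₀).Unique := by
    simpa [Unique] using h1
  rw [Mem.rmw]
  generalize ((m.read n p v₀).fence .multiCopyAtomic p).consume v₀ = k at h2
  have key : ∀ u ∈ (k.write .multiCopyAtomic n p x v).writes, u ≠ k.fresh →
      u ∈ k.writes ∧ (k.msg u).loc ≠ x := fun u hu hne => by
    rw [write_eq, mem_gc_writes] at hu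
    obtain ⟨h3, q, hq, h4⟩ := hu
    have h5 := (Finset.mem_insert.1 h3).resolve_left hne
    rw [mem_writeRaw_redundant _ _ _ _ _ _ hne, not_or] at h4
    exact ⟨h5, fun h6 => h4.2 ⟨⟨h5, h6⟩, hq⟩⟩
  intro u hu w hw hl
  rw [write_eq, gc_msg] at hl
  by_cases h3 : u = k.fresh <;> by_cases h4 : w = k.fresh
  · rw [h3, h4]
  · subst h3
    rw [writeRaw_loc _ _ _ _ _ h4, writeRaw_msg_fresh] at hl
    exact absurd hl.symm (key w hw h4).2
  · subst h4
    rw [writeRaw_loc _ _ _ _ _ h3, writeRaw_msg_fresh] at hl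
    exact absurd hl (key u hu h3).2
  · rw [writeRaw_loc _ _ _ _ _ h3, writeRaw_loc _ _ _ _ _ h4] at hl
    exact h2 u (key u hu h3).1 w (key w hw h4).1 hl

theorem IsLast.of_gc {i : ℕ} (h : (m.gc n).IsLast x i) (hm : Core n L m) (hn : 0 < n) (hx : L x) :
    m.IsLast x i := by
  obtain ⟨j, hj, -⟩ := hm.last x hx
  rwa [(hm.gc hn).isLast_unique h (hj.gc hm hn)]

theorem Sourced.update (h : m.Sourced) (hm : Core n L m) (hp : p < n) (hv : v ∈ m.writes)
    (hr : p ∉ (m.msg v).redundant) : (m.update n p v).Sourced := fun x i hi => by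
  have hx : L x := hi.2.1 ▸ (hm.update hp hv hr).locations i hi.1
  have := h x i (updateRaw_isLast.1 (hi.of_gc (hm.updateRaw hv hr) (by omega) hx))
  rwa [update_eq, gc_msg, updateRaw_source]

/-- The consumed source is no longer last, since the new message is above it; the new message can
itself be a source. -/
theorem Sourced.rmw (h : m.Sourced) (hm : Core n L m) (hp : p < n) {v₀ : ℕ} (hx : L x)
    (hr : m.RmwReadable p x v₀) (v : ℕ) : (m.rmw M n p x v₀ v).Sourced := fun y i hi => by
  have hn : 0 < n := by omega
  have hread := hm.readRaw hr.1.1 hr.1.2.2.1 hr.1.2.2.2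
  have hcore := ((hm.read hp hr.1).fence M hp).consume v₀
  have hy : L y := hi.2.1 ▸ (hcore.write hp hx v).locations i hi.1
  have hi' := hi.of_gc (hcore.writeRaw M hx v) hn hy
  rw [Mem.rmw, write_eq, gc_msg]
  by_cases hyx : y = x
  · subst hyx
    rw [(hcore.writeRaw M hx v).isLast_unique hi' (writeRaw_isLast_fresh ..), writeRaw_msg_fresh]
  · obtain ⟨j, hj, -⟩ := hcore.last y hy
    have hij := (hcore.writeRaw M hx v).isLast_unique hi' (writeRaw_isLast_of_ne hyx hj)
    subst hij
    rw [writeRaw_source _ _ _ _ _ (ne_fresh_of_mem_writes hj.1), consume_source_eq_true]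
    rw [consume_isLast, fence_isLast] at hj
    have hj' := readRaw_isLast.1 (hj.of_gc hread hn hy)
    refine ⟨?_, ?_⟩
    · rintro rfl; exact hyx (hj'.2.1.symm.trans hr.1.2.1)
    · rw [fence_msg, read_eq, gc_msg, readRaw_source]; exact h y i hj'

end Preservation

/-! ### Plain configurations -/

section Plain

variable {P : Program} {γ : Config}

/-- The unique message to a location in a plain configuration. -/
theorem _root_.Config.IsPlain.exists_msg (h : γ.IsPlain P) (hn : 0 < P.procs.length) {x : Loc}
    (hx : P.IsLoc x) : ∃ v ∈ γ.mem.writes, (γ.mem.msg v).loc = x ∧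
      (γ.mem.msg v).source = true ∧ ∀ p < P.procs.length,
        p ∈ (γ.mem.msg v).seen ∧ p ∉ (γ.mem.msg v).redundant := by
  obtain ⟨v, hv, h1, h2, -⟩ := h.invariants.enabledRead 0 hn x hx
  refine ⟨v, hv, h1, h2, fun p hp => ⟨h.seen v hv p hp, ?_⟩⟩
  obtain ⟨w, hw, h3, -, h4⟩ := h.invariants.enabledRead p hp x hx
  rwa [← (h.oneMessage x hx).unique ⟨hw, h3⟩ ⟨hv, h1⟩]

theorem _root_.Config.IsPlain.unique (h : γ.IsPlain P) : γ.mem.Unique := fun _ hu v hv hl =>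
  (h.oneMessage _ (h.invariants.locations v hv)).unique ⟨hu, hl⟩ ⟨hv, rfl⟩

theorem _root_.Config.IsPlain.core (h : γ.IsPlain P) (hn : 0 < P.procs.length) :
    Core P.procs.length P.IsLoc γ.mem where
  disjoint := h.invariants.disjoint
  irrefl := h.invariants.irrefl
  trans := h.invariants.trans
  locations := h.invariants.locations
  issuers := h.invariants.issuers
  coherence := h.invariants.coherence
  causalPropagation := h.invariants.causalPropagation
  coherentObservation := h.invariants.coherentObservation
  last x hx := by
    obtain ⟨v, hv, h1, -, h3⟩ := h.exists_msg hn hx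
    exact ⟨v, ⟨hv, h1, fun u hu hux => Or.inl (h.unique u hu v hv (hux.trans h1.symm))⟩,
      fun p hp => (h3 p hp).2⟩
  acquired p hp t ht hr := by
    obtain ⟨v, hv, h1, -, h3⟩ := h.exists_msg hn (h.invariants.locations t ht)
    rw [h.unique t ht v hv h1.symm] at hr
    exact absurd hr (h3 p hp).2

/-- The memory of a plain configuration is at least as permissive as any other memory with
the same last values, once the other messages are redundant. -/
theorem Related.of_isPlain {n : ℕ} {L L' : Loc → Prop} {flag : Loc} {post : Set ℕ} {b : Mem}
    (h : γ.IsPlain P) (hn : 0 < n) (hP : P.procs.length = n) (hL : ∀ x, L x → P.IsLoc x)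
    (hb : Core n L' b)
    (hval : ∀ x, L (some x) → ∀ u, b.IsLast (some x) u → ∀ v ∈ γ.mem.writes,
      (γ.mem.msg v).loc = some x → (γ.mem.msg v).val = (b.msg u).val)
    (hold : ∀ v ∈ b.writes, L (b.msg v).loc → ¬ b.IsLast (b.msg v).loc v →
      b.LocView flag v ∧ ∀ p < n, p ∈ post → p ∈ (b.msg v).redundant) :
    Related n L L' flag post b γ.mem := by
  subst hP
  refine Related.of_unique hb (D := {u | ∃ x, L x ∧ b.IsLast x u}) (fun _ hu => hu)
    (fun v hv hl hD => hold v hv hl fun h' => hD ⟨_, hl, h'⟩) (fun x hx => ?_)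
    (fun u hu v hv hl he hlt => ?_)
  · obtain ⟨v, hv, h1, h2, h3⟩ := h.exists_msg hn (hL x hx)
    refine ⟨v, hv, h1, h2, h3, fun u hu hl hne => ?_⟩
    obtain ⟨y, rfl⟩ := Option.ne_none_iff_exists'.1 hne
    exact hval y hx u hl v hv h1
  · have := h.unique u hu v hv he
    subst this
    exact h.invariants.irrefl u (mem_ids_of_writes hu) hlt

end Plain

/-- The read-modify-write that signals to the other processes that the last messages, which the
process `p` has seen, are in place. -/
theorem rmw_signal {n : ℕ} {L L' : Loc → Prop} {flag : Loc} {m : Mem} {M : Propagation}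
    {p v₀ v : ℕ} (hm : Core n L' m) (hp : p < n) (hflag : L' flag)
    (hflag' : ¬ L flag) (hseen : ∀ x, L x → ∃ w, m.LastMsg x w {p})
    (hM : M = .multiCopyAtomic → m.Unique) (hr : m.RmwReadable p flag v₀) :
    ∀ u ∈ (m.rmw M n p flag v₀ v).writes, L ((m.rmw M n p flag v₀ v).msg u).loc →
      ¬ (m.rmw M n p flag v₀ v).IsLast ((m.rmw M n p flag v₀ v).msg u).loc u →
      (m.rmw M n p flag v₀ v).LocView flag u ∧
        p ∈ ((m.rmw M n p flag v₀ v).msg u).redundant := by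
  have hn : 0 < n := by omega
  have hcore₁ := hm.read hp hr.1
  have hcore₃ := (hcore₁.fence M hp).consume v₀
  have hlast : ∀ x i, (m.read n p v₀).IsLast x i →
      (((m.read n p v₀).fence M p).consume v₀).IsLast x i := fun x i hi => by
    rwa [consume_isLast, fence_isLast]
  have hview : M = .causal → ∀ u, (m.read n p v₀).SeenView p u →
      (((m.read n p v₀).fence M p).consume v₀).FenceView p u := fun hM u hu => by
    rw [consume_fenceView, fence_fenceView]
    exact Or.inr ⟨hM, rfl, hu⟩
  have hloc : ∀ u, ((((m.read n p v₀).fence M p).consume v₀).msg u).loc =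
      ((m.read n p v₀).msg u).loc := fun u => by rw [consume_loc, fence_msg]
  have hwrites : (((m.read n p v₀).fence M p).consume v₀).writes = (m.read n p v₀).writes := by
    simp
  have hseen₁ : ∀ x, L x → ∃ w, (m.read n p v₀).LastMsg x w {p} := fun x hx =>
    let ⟨w, hw⟩ := hseen x hx
    ⟨w, hw.read hm hp hr.1⟩
  have hseen₃ : ∀ x, L x → ∃ w, (((m.read n p v₀).fence M p).consume v₀).LastMsg x w {p} :=
    fun x hx =>
    let ⟨w, hw⟩ := hseen₁ x hx
    ⟨w, (hw.fence M p).consume v₀⟩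
  have hM' : M = .multiCopyAtomic → (m.rmw M n p flag v₀ v).Unique := fun h => by
    have := hM h
    subst h
    exact this.rmw n p v₀ v
  rw [Mem.rmw] at hM' ⊢
  generalize ((m.read n p v₀).fence M p).consume v₀ = k at *
  have hraw := hcore₃.writeRaw M (p := p) hflag v
  have hcore := hraw.gc hn
  rw [write_eq] at hM' ⊢
  intro u hu hl hnl
  have hu' := mem_writes_of_gc hu
  rw [gc_msg] at hl hnl ⊢
  have hne : u ≠ k.fresh := by
    rintro rfl
    rw [writeRaw_msg_fresh] at hl
    exact hflag' hl
  have hu₃ := (Finset.mem_insert.1 hu').resolve_left hne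
  rw [writeRaw_loc _ _ _ _ _ hne] at hl hnl
  have hxf : (k.msg u).loc ≠ flag := fun h' => hflag' (h' ▸ hl)
  obtain ⟨w, hw⟩ := hseen₃ _ hl
  obtain ⟨j, hj, -, hjs⟩ := hw.write (M := M) hcore₃ hp hflag hxf v
  rw [write_eq] at hj hjs
  have hlu : (((k.writeRaw M n p flag v).gc n).msg u).loc = (k.msg u).loc := by
    rw [gc_msg, writeRaw_loc _ _ _ _ _ hne]
  have huj : ((k.writeRaw M n p flag v).gc n).lt u j := by
    rcases hj.2.2 u hu hlu with h1 | h1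
    · exact absurd (h1 ▸ hj) hnl
    · exact h1
  refine ⟨?_, ?_⟩
  -- In the multi-copy-atomic case there are no old messages. In the causal case the old message is
  -- overwritten by one that `p` has seen, so it enters the fence view of `p` through the fence of
  -- the RMW, and the flag message is placed above that fence.
  · cases M with
    | multiCopyAtomic =>
      have := hM' rfl u hu j hj.1 (hlu.trans hj.2.1.symm)
      exact absurd (this ▸ hj) hnl
    | causal =>
      obtain ⟨w, i, hi, -, his⟩ := hseen₁ _ hl
      rw [hwrites] at hu₃
      have hui : (m.read n p v₀).lt u i := by
        rcases hi.2.2 u hu₃ (hloc u).symm with h1 | h1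
        · exfalso
          subst h1
          have h2 : (k.writeRaw .causal n p flag v).IsLast (k.msg u).loc u :=
            writeRaw_isLast_of_ne hxf (hlast _ _ hi)
          exact hnl (h2.gc hraw hn)
        · exact h1
      have hsv : (m.read n p v₀).SeenView p u :=
        ⟨i, hi.1, his rfl, hu₃, i, hi.1, (hloc u).symm.trans hi.2.1.symm, hui, Or.inl rfl⟩
      have h3 : (k.writeRaw .causal n p flag v).LocView flag u :=
        (writeRaw_locView_self (hwrites ▸ hu₃)).2 (Or.inr (Or.inr (hview rfl u hsv)))
      exact h3.gc hraw hn hflag hu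
  -- The process `p` has seen the last message to the location of `u`, so coherent observation
  -- forces the older `u` to be redundant to it.
  · by_contra hred
    exact hcore.coherentObservation p hp u hu j hj.1 (hlu.trans hj.2.1.symm) hred
      (hcore.notMem_redundant_of_isLast hj hp) (hjs rfl) huj

theorem Core.invariants {P : Program} {m : Mem} (h : Core P.procs.length P.IsLoc m)
    (hs : m.Sourced) (hc : Clean P.procs.length m) : m.Invariants P where
  disjoint := h.disjoint
  irrefl := h.irrefl
  trans := h.trans
  locations := h.locations
  issuers := h.issuers
  enabledRead p hp x hx := by
    obtain ⟨v, h1, h2⟩ := h.last x hx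
    exact ⟨v, h1.1, h1.2.1, hs x v h1, h2 p hp⟩
  coherence := h.coherence
  causalPropagation := h.causalPropagation
  coherentObservation := h.coherentObservation
  noGarbageWrite v hv := by
    rw [← show m.gc P.procs.length = m from hc] at hv
    exact ((mem_gc_writes _ _ _).1 hv).2
  noGarbageFence f hf := by
    rw [← show m.gc P.procs.length = m from hc] at hf
    obtain ⟨-, v, h1, -, h2⟩ := (mem_gc_fences _ _ _).1 hf
    exact ⟨v, h1, h2⟩

end Mem

/-! ## The preambles -/

/-- Load the registers, up to one more than the listed ones. -/
def setupCode (regs : List ℕ) : List Instr :=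
  -- One more register than listed: register `0` is used by the synchronization and must be reset
  -- even if the list is empty.
  (List.range (regs.length + 1)).map fun i => .assign i (.const (regs.getD i 0))

/-- A preamble: synchronization, followed by the preparation of the control state `s`. -/
def preambleCode (head : List Instr) (s : ℕ × List ℕ) : List Instr :=
  -- The added offset is the length of the whole preamble, namely the head, the `s.2.length + 1`
  -- assignments and this jump. The condition is constant, so the jump is resolved as soon as it is
  -- fetched.
  head ++ (setupCode s.2 ++ [.branch (.const 1) (s.1 + (head.length + (s.2.length + 2)))])

/-- Store `vals` to the variables, then set the flag. -/
def storeCode (flag : ℕ) (vals : List ℕ) : List Instr :=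
  ((List.range vals.length).map fun x => .rmw 0 (.const x) (.const (vals.getD x 0))) ++
    [.rmw 0 (.const flag) (.const 1)]

/-- Wait until the flag is `1`. -/
def waitCode (flag : ℕ) : List Instr :=
  -- The waiting RMW has to write something, so it writes back what it read if this is `1`, and `0`
  -- otherwise. Spinning thus changes neither flag value.
  [.rmw 0 (.const flag) ⟨[0], [([1], 1)]⟩, .branch ⟨[0], [([0], 1)]⟩ 0]

/-- The preambles of all processes, and one fresh variable. -/
def preamble (P : Program) (c₀ : ControlState) (vals : List ℕ) : ℕ × List (List Instr) :=
  (1, match c₀ with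
    | [] => []
    | s :: cs => preambleCode (storeCode P.vars vals) s :: cs.map (preambleCode (waitCode P.vars)))

theorem preambleCode_length (head : List Instr) (s : ℕ × List ℕ) :
    (preambleCode head s).length = head.length + (s.2.length + 2) := by
  simp [preambleCode, setupCode]

theorem isStrong_of_mem_preambleCode {head : List Instr} {s : ℕ × List ℕ}
    (h : ∀ i ∈ head, i.IsStrong) : ∀ i ∈ preambleCode head s, i.IsStrong := by
  intro i hi
  simp only [preambleCode, setupCode, List.mem_append, List.mem_map, List.mem_singleton] at hi
  rcases hi with hi | ⟨j, -, rfl⟩ | rfl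
  · exact h i hi
  · trivial
  · trivial

theorem addressesIn_of_mem_preambleCode {N : ℕ} {head : List Instr} {s : ℕ × List ℕ}
    (h : ∀ i ∈ head, i.AddressesIn N) : ∀ i ∈ preambleCode head s, i.AddressesIn N := by
  intro i hi
  simp only [preambleCode, setupCode, List.mem_append, List.mem_map, List.mem_singleton] at hi
  rcases hi with hi | ⟨j, -, rfl⟩ | rfl
  · exact h i hi
  · trivial
  · trivial

theorem isStrong_of_mem_storeCode (flag : ℕ) (vals : List ℕ) :
    ∀ i ∈ storeCode flag vals, i.IsStrong := by
  intro i hi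
  simp only [storeCode, List.mem_append, List.mem_map, List.mem_singleton] at hi
  rcases hi with ⟨j, -, rfl⟩ | rfl <;> trivial

theorem isStrong_of_mem_waitCode (flag : ℕ) : ∀ i ∈ waitCode flag, i.IsStrong := by
  intro i hi
  simp only [waitCode, List.mem_cons, List.not_mem_nil, or_false] at hi
  rcases hi with rfl | rfl <;> trivial

theorem addressesIn_of_mem_storeCode {vals : List ℕ} {N : ℕ} (h : vals.length = N) :
    ∀ i ∈ storeCode N vals, i.AddressesIn (N + 1) := by
  intro i hi
  simp only [storeCode, List.mem_append, List.mem_map, List.mem_singleton, List.mem_range] at hi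
  rcases hi with ⟨j, hj, rfl⟩ | rfl
  · exact Expr.isAddress_const (by omega)
  · exact Expr.isAddress_const (by omega)

theorem addressesIn_of_mem_waitCode (N : ℕ) : ∀ i ∈ waitCode N, i.AddressesIn (N + 1) := by
  intro i hi
  simp only [waitCode, List.mem_cons, List.not_mem_nil, or_false] at hi
  rcases hi with rfl | rfl
  · exact Expr.isAddress_const (by omega)
  · trivial

theorem transparent_append {env : ℕ → Option ℕ} {l₁ l₂ : List Entry} :
    Transparent env (l₁ ++ l₂) ↔
      Transparent env l₁ ∧ Transparent (l₁.foldl Entry.effect env) l₂ := by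
  refine ⟨Transparent.of_append, fun h => ?_⟩
  induction l₁ generalizing env with
  | nil => exact h.2
  | cons e l ih => exact ⟨h.1.1, ih ⟨h.1.2, h.2⟩⟩

theorem CodePath.low {code : List Instr} {l l' k : ℕ} {C : List Entry} (h : CodePath code l C l')
    (hC : ∀ e ∈ C, e.label < k) : ∀ l₁ e l₂, C = l₁ ++ e :: l₂ → exitLabel l l₁ < k := by
  rintro l₁ e l₂ rfl
  obtain ⟨m, h1, h2⟩ := codePath_append.1 h
  rw [h1.exitLabel_eq, ← h2.1]
  exact hC e (by simp)

/-- The path through assignments of constants. -/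
theorem exists_codePath_assign {code : List Instr} {h : ℕ} {f : ℕ → ℕ} (m : ℕ)
    (hcode : ∀ i < m, code[h + i]? = some (.assign i (.const (f i)))) (reg : ℕ → ℕ) :
    ∃ C, Prelude reg (fun r => if r < m then f r else reg r) C ∧ CodePath code h C (h + m) ∧
      ∀ e ∈ C, e.label < h + m := by
  induction m with
  | zero => exact ⟨[], by simpa using Prelude.nil reg, rfl, by simp⟩
  | succ m ih =>
    obtain ⟨C, h1, h2, h3⟩ := ih fun i hi => hcode i (by omega)
    refine ⟨C ++ [⟨h + m, .assign m (.const (f m)), h + m + 1, none⟩], ⟨?_, ?_⟩, ?_, ?_⟩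
    · exact transparent_append.2 ⟨h1.transparent, Or.inl ⟨_, _, rfl, rfl⟩, trivial⟩
    · have := h1.env
      simp only [envAfter] at this ⊢
      rw [List.foldl_append, this]
      funext r
      simp only [List.foldl_cons, List.foldl_nil, Entry.effect, Expr.eval_const,
        Function.update_apply]
      split_ifs <;> first | omega | simp_all
    · exact codePath_append.2 ⟨_, h2, rfl, hcode m (by omega), rfl, rfl, rfl⟩
    · intro e he
      rcases List.mem_append.1 he with he | he
      · have := h3 e he; omega
      · rw [List.mem_singleton.1 he]; simp

theorem preambleCode_getElem?_head {head rest : List Instr} {s : ℕ × List ℕ} {i : ℕ}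
    (hi : i < head.length) : (preambleCode head s ++ rest)[i]? = head[i]? := by
  rw [preambleCode, List.append_assoc, List.getElem?_append_left hi]

/-- The path through the final part of the preamble. -/
theorem exists_setup (head rest : List Instr) (s : ℕ × List ℕ) {reg : ℕ → ℕ}
    (hreg : ∀ r, r ≠ 0 → reg r = 0) :
    ∃ C, Prelude reg (fun r => s.2.getD r 0) C ∧
      CodePath (preambleCode head s ++ rest) head.length C
        (s.1 + (preambleCode head s).length) ∧
      ∀ e ∈ C, e.label < (preambleCode head s).length := by
  obtain ⟨C, h1, h2, h3⟩ := exists_codePath_assign (code := preambleCode head s ++ rest)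
    (h := head.length) (f := fun i => s.2.getD i 0) (s.2.length + 1) (fun i hi => by
      rw [preambleCode, List.append_assoc, List.getElem?_append_right (by omega),
        List.append_assoc, List.getElem?_append_left (by simp [setupCode]; omega)]
      simp [setupCode, hi]) reg
  rw [preambleCode_length]
  have henv : (fun r => if r < s.2.length + 1 then s.2.getD r 0 else reg r) =
      fun r => s.2.getD r 0 := by
    funext r
    split_ifs with hr
    · rfl
    -- Beyond the assigned range lie only registers other than `0`, which still hold their initial
    -- `0`.
    · rw [hreg r (by omega), List.getD_eq_getElem?_getD, List.getElem?_eq_none (by omega)]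
      rfl
  rw [henv] at h1
  refine ⟨C ++ [⟨head.length + (s.2.length + 1), .branch (.const 1)
    (s.1 + (head.length + (s.2.length + 2))), s.1 + (head.length + (s.2.length + 2)), none⟩],
    ⟨?_, ?_⟩, ?_, ?_⟩
  · exact transparent_append.2 ⟨h1.transparent,
      Or.inr ⟨_, _, 1, rfl, Expr.eval_const _ _, by simp⟩, trivial⟩
  · have := h1.env
    simp only [envAfter] at this ⊢
    rw [List.foldl_append, this]
    rfl
  · refine codePath_append.2 ⟨_, h2, rfl, ?_, ?_, rfl, rfl⟩
    · rw [preambleCode, List.append_assoc, List.getElem?_append_right (by omega),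
        List.append_assoc, List.getElem?_append_right (by simp [setupCode])]
      simp [setupCode]
    · simp [Instr.successors]
  · intro e he
    rcases List.mem_append.1 he with he | he
    · have := h3 e he; omega
    · rw [List.mem_singleton.1 he]; simp

/-- The path through the rest of the preamble of a process that has seen the flag. -/
theorem exists_setup_wait (flag : ℕ) (rest : List Instr) (s : ℕ × List ℕ) {reg : ℕ → ℕ}
    (hreg : ∀ r, r ≠ 0 → reg r = 0) (h0 : reg 0 = 1) :
    ∃ C, Prelude reg (fun r => s.2.getD r 0) C ∧
      CodePath (preambleCode (waitCode flag) s ++ rest) 1 C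
        (s.1 + (preambleCode (waitCode flag) s).length) ∧
      ∀ e ∈ C, e.label < (preambleCode (waitCode flag) s).length := by
  obtain ⟨C, h1, h2, h3⟩ := exists_setup (waitCode flag) rest s hreg
  refine ⟨⟨1, .branch ⟨[0], [([0], 1)]⟩ 0, 2, none⟩ :: C, ⟨⟨?_, h1.transparent⟩, h1.env⟩,
    ⟨rfl, ?_, ?_, rfl, h2⟩, ?_⟩
  · refine Or.inr ⟨_, _, 0, rfl, ?_, rfl⟩
    simp [Expr.eval, h0, List.lookup]
  · rw [preambleCode_getElem?_head (by simp [waitCode])]; rfl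
  · simp [Instr.successors]
  · intro e he
    rcases List.mem_cons.1 he with rfl | he
    · simp only [preambleCode_length, waitCode, List.length_cons, List.length_nil]; omega
    · exact h3 e he

/-! ### The augmented program -/

section Augment

variable {P : Program} {c₀ : ControlState} {vals : List ℕ}

theorem preamble_length (P : Program) (c₀ : ControlState) (vals : List ℕ) :
    (preamble P c₀ vals).2.length = c₀.length := by
  cases c₀ <;> simp [preamble]

/-- The synchronization part of the preamble of the process `p`. -/
def headCode (P : Program) (vals : List ℕ) (p : ℕ) : List Instr :=
  if p = 0 then storeCode P.vars vals else waitCode P.vars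

theorem preamble_getElem? (p : ℕ) :
    (preamble P c₀ vals).2[p]? = c₀[p]?.map (preambleCode (headCode P vals p)) := by
  rcases c₀ with _ | ⟨s, cs⟩
  · simp [preamble]
  · cases p <;> simp [preamble, headCode]

theorem augment_procs_length (hc : c₀.length = P.procs.length) :
    (P.augment (preamble P c₀ vals)).procs.length = P.procs.length := by
  simp [Program.augment, preamble_length, hc]

theorem augment_vars : (P.augment (preamble P c₀ vals)).vars = P.vars + 1 := rfl

theorem code_augment (hc : c₀.length = P.procs.length) {p : ℕ} (hp : p < c₀.length) :
    (P.augment (preamble P c₀ vals)).code p = preambleCode (headCode P vals p) c₀[p] ++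
      (P.code p).map (Instr.shift (preambleCode (headCode P vals p) c₀[p]).length) := by
  have h2 : P.procs[p]? = some P.procs[p] := List.getElem?_eq_getElem (by omega)
  simp [Program.code, Program.augment, List.getD_eq_getElem?_getD, List.getElem?_zipWith,
    preamble_getElem?, hp, h2]

theorem codeShift_augment (hc : c₀.length = P.procs.length) {p : ℕ} (hp : p < c₀.length) :
    CodeShift (preambleCode (headCode P vals p) c₀[p]).length
      ((P.augment (preamble P c₀ vals)).code p) (P.code p) := by
  intro l
  rw [code_augment hc hp, List.getElem?_append_right (by omega), Nat.add_sub_cancel,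
    List.getElem?_map]

theorem Instr.shift_addressesIn {N N' k : ℕ} (h : N ≤ N') {i : Instr} (hi : i.AddressesIn N) :
    (i.shift k).AddressesIn N' := by
  have mono : ∀ a : Expr, a.IsAddress N → a.IsAddress N' := fun a ha =>
    ⟨by have := ha.1; omega, fun row hr => (ha.2 row hr).trans_le h⟩
  cases i <;> first | trivial | exact mono _ hi

theorem isStrong_of_mem_preamble :
    ∀ code ∈ (preamble P c₀ vals).2, ∀ i ∈ code, i.IsStrong := by
  intro code hcode
  obtain ⟨p, hp⟩ := List.mem_iff_getElem?.1 hcode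
  rw [preamble_getElem?] at hp
  obtain ⟨s, -, rfl⟩ := Option.map_eq_some_iff.1 hp
  refine isStrong_of_mem_preambleCode ?_
  unfold headCode
  split_ifs
  · exact isStrong_of_mem_storeCode _ _
  · exact isStrong_of_mem_waitCode _

theorem wellFormed_augment (hP : P.WellFormed) (hc : c₀.length = P.procs.length)
    (hv : vals.length = P.vars) : (P.augment (preamble P c₀ vals)).WellFormed := by
  refine ⟨fun h => hP.1 ?_, fun code hcode i hi => ?_⟩
  · rw [← List.length_eq_zero_iff, ← augment_procs_length (vals := vals) hc, h]; rfl
  · obtain ⟨p, hp⟩ := List.mem_iff_getElem?.1 hcode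
    obtain ⟨hp', rfl⟩ := List.getElem?_eq_some_iff.1 hp
    have hp₀ : p < P.procs.length := (augment_procs_length (vals := vals) hc) ▸ hp'
    have h1 : (P.augment (preamble P c₀ vals)).code p = (P.augment (preamble P c₀ vals)).procs[p] := by
      simp [Program.code, hp']
    rw [← h1, code_augment hc (by omega)] at hi
    rw [augment_vars]
    rcases List.mem_append.1 hi with hi | hi
    · refine addressesIn_of_mem_preambleCode ?_ i hi
      unfold headCode
      split_ifs
      · exact addressesIn_of_mem_storeCode hv
      · exact addressesIn_of_mem_waitCode _
    · obtain ⟨j, hj, rfl⟩ := List.mem_map.1 hi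
      refine Instr.shift_addressesIn (Nat.le_succ _) (hP.2 _ ?_ j hj)
      simp only [Program.code, List.getD_eq_getElem?_getD, List.getElem?_eq_getElem hp₀,
        Option.getD_some]
      exact List.getElem_mem _

/-- The label at which the code of the process `p` starts in the augmented program. -/
def offset (P : Program) (c₀ : ControlState) (vals : List ℕ) (p : ℕ) : ℕ :=
  ((preamble P c₀ vals).2.getD p []).length

theorem offset_eq {p : ℕ} (hp : p < c₀.length) :
    offset P c₀ vals p = (preambleCode (headCode P vals p) c₀[p]).length := by
  simp [offset, List.getD_eq_getElem?_getD, preamble_getElem?, hp]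

theorem hasControl_augment {γ' : Config} {s : ControlState} (hc : c₀.length = s.length) :
    γ'.HasControl (ControlState.augment s (preamble P c₀ vals)) ↔
      ∀ p (h : p < s.length), (γ'.proc p).pc = s[p].1 + offset P c₀ vals p ∧
        ∀ r, (γ'.proc p).reg r = s[p].2.getD r 0 := by
  have hlen : (ControlState.augment s (preamble P c₀ vals)).length = s.length := by
    simp [ControlState.augment, preamble_length, hc]
  have hget : ∀ p (h : p < s.length)
      (h' : p < (ControlState.augment s (preamble P c₀ vals)).length),
      (ControlState.augment s (preamble P c₀ vals))[p] =
        (s[p].1 + offset P c₀ vals p, s[p].2) := fun p h h' => by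
    have hp : p < (preamble P c₀ vals).2.length := by rw [preamble_length]; omega
    simp [ControlState.augment, offset, hp]
  constructor
  · intro h p hp
    have := h p (by omega)
    rw [hget p hp] at this
    exact this
  · intro h p hp
    rw [hget p (by omega)]
    exact h p (by omega)

end Augment

/-! ## Executing the preambles -/

theorem Expr.exists_eval (e : Expr) (reg : ℕ → ℕ) :
    ∃ v, e.eval (fun s => some (reg s)) = some v := by
  have h : ∀ l : List ℕ, l.mapM (fun s => some (reg s)) = some (l.map reg) := fun l => by
    induction l with
    | nil => rfl
    | cons a l ih => simp [ih]
  exact ⟨_, by rw [Expr.eval, h]; rfl⟩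

/-- Resolved local instructions can be crossed. -/
theorem Prelude.tauReach {code : List Instr} {l' : ℕ} {reg' : ℕ → ℕ} {C : List Entry} {pc : ℕ}
    {reg : ℕ → ℕ} (h : Prelude reg reg' C) (hC : CodePath code pc C l') :
    Proc.TauReach code ⟨pc, reg, [], C⟩ ⟨l', reg', [], []⟩ := by
  induction C generalizing pc reg with
  | nil =>
    have h1 : reg = reg' := funext fun r => Option.some.inj (congrFun h.env r)
    have h2 : l' = pc := hC
    rw [h1, h2]
    exact .refl
  | cons e C ih =>
    have hcross : ∃ q, (⟨pc, reg, [], e :: C⟩ : Proc).Cross q := by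
      rcases h.transparent.1 with ⟨r, ex, hi, -⟩ | ⟨c, t, b, hi, -⟩
      · obtain ⟨v, hv⟩ := ex.exists_eval reg
        exact ⟨_, .assign e C r ex v rfl hi hv⟩
      · exact ⟨_, .branch e C c t rfl hi⟩
    obtain ⟨q, hq⟩ := hcross
    have hact := Proc.Act.cross (code := code) q hq
    obtain ⟨reg₁, rfl, heff⟩ := hq.of_transparent h.transparent rfl
    have henv := h.env
    have htr := h.transparent.2
    simp only [envAfter, List.foldl_cons, heff] at henv htr
    have hset : Proc.settled ⟨e.next, reg₁, [], C⟩ = ⟨e.next, reg₁, [], C⟩ := by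
      have := htr.settle []
      rw [Proc.settled_eq_self]
      simpa [settle] using this
    rw [hset] at hact
    exact .head hact (ih ⟨htr, henv⟩ hC.2.2.2.2)

theorem CodePath.tauReach_of_prelude {code : List Instr} {l' : ℕ} {reg' : ℕ → ℕ} {C : List Entry}
    {pc : ℕ} {reg : ℕ → ℕ} (hC : CodePath code pc C l') (h : Prelude reg reg' C) :
    Proc.TauReach code ⟨pc, reg, [], []⟩ ⟨l', reg', [], []⟩ := by
  refine (hC.tauReach ?_).trans (h.tauReach hC)
  simpa [settle] using h.transparent.settle []

theorem Config.set_set (γ : Config) (p : ℕ) (q q' : Proc) (m m' : Mem) :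
    (γ.set p q m).set p q' m' = γ.set p q' m' := by
  simp [Config.set]

theorem Config.set_proc_self (γ : Config) (p : ℕ) (q : Proc) (m : Mem) :
    (γ.set p q m).proc p = q := Function.update_self ..

theorem Config.set_proc_of_ne (γ : Config) {p p' : ℕ} (h : p' ≠ p) (q : Proc) (m : Mem) :
    (γ.set p q m).proc p' = γ.proc p' := Function.update_of_ne h ..

theorem Config.set_self (γ : Config) (p : ℕ) : γ.set p (γ.proc p) γ.mem = γ := by
  simp [Config.set]

/-! ### Executing an RMW and reaching a plain configuration -/

section Run

variable {M : Propagation} {P : Program} {γ : Config}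

theorem Proc.TauReach.steps {p : ℕ} {q : Proc} (h : Proc.TauReach (P.code p) (γ.proc p) q)
    (hp : p < P.procs.length) :
    Relation.ReflTransGen (Step M P) γ (γ.set p q γ.mem) := by
  induction h with
  | refl => rw [Config.set_self]
  | @tail q₁ q₂ _ hact ih =>
    have := step_of_act (M := M) (γ := γ.set p q₁ γ.mem) hp (act := .tau) (q := q₂)
      (m := γ.mem) (by simpa [Config.set] using hact) rfl
    rw [Config.set_set] at this
    exact ih.tail this

/-- The state of the propagation unit between steps other than lightweight fences. -/
structure Mem.Ready (P : Program) (m : Mem) : Prop where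
  core : m.Core P.procs.length P.IsLoc
  sourced : m.Sourced
  clean : m.Clean P.procs.length

theorem isPlain_initial (hn : 0 < P.procs.length) : (initial P).IsPlain P := by
  have hwrites : ∀ i ∈ (initial P).mem.writes, i < P.vars + 1 := fun i => Finset.mem_range.1
  have hinj : ∀ i j, ((initial P).mem.msg i).loc = ((initial P).mem.msg j).loc → i = j := by
    intro i j h
    simp only [initial] at h
    split_ifs at h with h1 h2 h2
    · rw [h1, h2]
    · have := Option.some.inj h
      omega
  have hex : ∀ x, P.IsLoc x → ∃ i ∈ (initial P).mem.writes, ((initial P).mem.msg i).loc = x := by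
    rintro (_ | y) hx
    · exact ⟨0, Finset.mem_range.2 (by omega), rfl⟩
    · have := hx y rfl
      exact ⟨y + 1, Finset.mem_range.2 (by omega), rfl⟩
  refine ⟨⟨Finset.disjoint_empty_right _, fun _ _ => id, fun _ _ _ _ _ _ => False.elim,
    fun v hv y hy => ?_, fun f hf => absurd hf (Finset.notMem_empty f), fun p hp x hx => ?_,
    fun u _ v _ h => Or.inr (Or.inl (hinj u v h)), fun _ _ _ _ _ _ _ => False.elim,
    fun _ _ _ _ _ _ _ _ _ _ => id, fun v _ => ?_,
    fun f hf => absurd hf (Finset.notMem_empty f)⟩, fun _ _ => ⟨rfl, rfl⟩, fun x hx => ?_,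
    fun _ _ _ => id⟩
  · have := hwrites v hv
    simp only [initial] at hy
    split_ifs at hy
    have := Option.some.inj hy
    omega
  · obtain ⟨i, h1, h2⟩ := hex x hx
    exact ⟨i, h1, h2, rfl, Set.notMem_empty p⟩
  · exact ⟨0, hn, Set.notMem_empty 0⟩
  · obtain ⟨i, h1, h2⟩ := hex x hx
    exact ⟨i, ⟨h1, h2⟩, fun j hj => hinj j i (hj.2.trans h2.symm)⟩

theorem Config.IsPlain.ready (h : γ.IsPlain P) (hn : 0 < P.procs.length) : γ.mem.Ready P where
  core := h.core hn
  sourced x i hi := by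
    obtain ⟨v, h1, h2, h3, -⟩ := h.exists_msg hn (h.invariants.locations i hi.1)
    rwa [← h.unique v h1 i hi.1 h2]
  clean := by
    have h1 : (γ.mem.gc P.procs.length).writes = γ.mem.writes := by
      ext i
      rw [Mem.mem_gc_writes]
      exact and_iff_left_of_imp (h.invariants.noGarbageWrite i)
    have h2 : (γ.mem.gc P.procs.length).fences = γ.mem.fences := by
      ext i
      rw [Mem.mem_gc_fences]
      refine and_iff_left_of_imp fun hi => ?_
      obtain ⟨v, hv, hlt⟩ := h.invariants.noGarbageFence i hi
      exact ⟨v, hv, h.invariants.noGarbageWrite v hv, hlt⟩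
    calc γ.mem.gc P.procs.length = ⟨(γ.mem.gc P.procs.length).writes,
          (γ.mem.gc P.procs.length).fences, γ.mem.msg, γ.mem.issuer, γ.mem.lt⟩ := rfl
      _ = γ.mem := by rw [h1, h2]

theorem Config.IsPlain.lastMsg (h : γ.IsPlain P) (hn : 0 < P.procs.length) {x : Loc}
    (hx : P.IsLoc x) {v : ℕ}
    (hv : ∀ i ∈ γ.mem.writes, (γ.mem.msg i).loc = x → (γ.mem.msg i).val = v) :
    γ.mem.LastMsg x v {p | p < P.procs.length} := by
  obtain ⟨i, h1, h2, -, h3⟩ := h.exists_msg hn hx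
  exact ⟨i, ⟨h1, h2, fun u hu hux => Or.inl (h.unique u hu i h1 (hux.trans h2.symm))⟩, hv i h1 h2,
    fun p hp => (h3 p hp).1⟩

namespace Mem

variable {m : Mem} {p : ℕ} {x : Loc} {i : ℕ}

theorem Ready.update (h : m.Ready P) (hp : p < P.procs.length) (hi : i ∈ m.writes)
    (hr : p ∉ (m.msg i).redundant) : (m.update P.procs.length p i).Ready P :=
  ⟨h.core.update hp hi hr, h.sourced.update h.core hp hi hr, gc_clean _ _⟩

theorem Ready.rmw (h : m.Ready P) (hp : p < P.procs.length) (hx : P.IsLoc x)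
    (hr : m.RmwReadable p x i) (v : ℕ) : (m.rmw M P.procs.length p x i v).Ready P :=
  ⟨h.core.act hp (act := .rmw x _ v) hx ⟨i, hr, Or.inr rfl, rfl⟩,
    h.sourced.rmw h.core hp hx hr v, gc_clean _ _⟩

/-- The last message is redundant to nobody, so any process may see it by a silent update and can
then use it as a source. -/
theorem Core.seen_update (h : m.Core P.procs.length P.IsLoc) (hp : p < P.procs.length)
    (hi : m.IsLast x i) : (m.update P.procs.length p i).IsLast x i ∧
      p ∈ ((m.update P.procs.length p i).msg i).seen ∧
      ((m.update P.procs.length p i).msg i).val = (m.msg i).val := by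
  have hr := h.notMem_redundant_of_isLast hi hp
  refine ⟨(updateRaw_isLast.2 hi).gc (h.updateRaw hi.1 hr) (by omega), ?_, ?_⟩
  · rw [update_eq, gc_msg, mem_updateRaw_seen]; exact Or.inr ⟨rfl, rfl⟩
  · rw [update_eq, gc_msg, updateRaw_val]

end Mem

/-- A read-modify-write of a process with an empty buffer. -/
theorem exists_rmw {p : ℕ} (hp : p < P.procs.length) {pc : ℕ} {reg : ℕ → ℕ}
    (hq : γ.proc p = ⟨pc, reg, [], []⟩) {a ex : Expr} {r x w v : ℕ} {A : Set ℕ}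
    (hcode : (P.code p)[pc]? = some (.rmw r a ex))
    (ha : a.eval (fun s => some (reg s)) = some x) (hx : x < P.vars)
    (hv : ex.eval (fun s => some (Function.update reg r w s)) = some v) (h : γ.mem.Ready P)
    (hw : γ.mem.LastMsg (some x) w A) :
    ∃ m', Relation.ReflTransGen (Step M P) γ
        (γ.set p ⟨pc + 1, Function.update reg r w, [], []⟩ m') ∧ m'.Ready P ∧
      m'.LastMsg (some x) v ∅ ∧
      ∀ y u, y ≠ some x → γ.mem.LastMsg y u ∅ → m'.LastMsg y u ∅ := by
  obtain ⟨i, hi, rfl, -⟩ := hw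
  have hxP : P.IsLoc (some x) := fun y hy => Option.some.inj hy ▸ hx
  have hr := h.core.notMem_redundant_of_isLast hi hp
  obtain ⟨h1, h2, h3⟩ := h.core.seen_update hp hi
  have hready := h.update hp hi.1 hr
  have hrmw : (γ.mem.update P.procs.length p i).RmwReadable p (some x) i :=
    ⟨⟨h1.1, h1.2.1, h2, hready.core.notMem_redundant_of_isLast h1 hp⟩, hready.sourced _ _ h1,
      (hready.core.isLast_iff.1 h1).2.2⟩
  have hact : (γ.mem.update P.procs.length p i).Act M P.procs.length p
      (.rmw (some x) (γ.mem.msg i).val v) _ := ⟨i, hrmw, Or.inr h3, rfl⟩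
  refine ⟨_, ?_, hready.rmw hp hxP hrmw v, hact.lastMsg hready.core hp hxP |>.mono (by simp),
    fun y u hy hu => (hu.update h.core hp hi.1 hr).act hready.core hp (act := .rmw _ _ _) hxP ?_
      hact⟩
  -- An RMW needs a source that the process has seen; hence the run consists of a silent update, a
  -- fetch and the execution.
  · have s1 : Step M P γ ⟨γ.proc, γ.mem.update P.procs.length p i⟩ := .update p hp i hi.1 hr
    have a2 := Proc.Act.fetch (code := P.code p) (q := γ.proc p) (.rmw r a ex) (pc + 1)
      (by rw [hq]; exact hcode) (by rw [hq]; rfl)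
    have s2 := step_of_act (M := M) (γ := ⟨γ.proc, γ.mem.update P.procs.length p i⟩) hp a2 rfl
    have e2 : Proc.settled { γ.proc p with
        spec := (γ.proc p).spec ++ [⟨(γ.proc p).tracker, .rmw r a ex, pc + 1, none⟩] } =
        ⟨pc, reg, [], [⟨pc, .rmw r a ex, pc + 1, none⟩]⟩ := by
      rw [hq]; rfl
    rw [e2] at s2
    have a3 := Proc.Act.rmw (code := P.code p) (q := ⟨pc, reg, [], [⟨pc, .rmw r a ex, pc + 1, none⟩]⟩)
      ⟨pc, .rmw r a ex, pc + 1, none⟩ [] r a ex x (γ.mem.msg i).val v rfl rfl rfl ha hv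
    have s3 := step_of_act (M := M) (γ := Config.set ⟨γ.proc, γ.mem.update P.procs.length p i⟩ p
      ⟨pc, reg, [], [⟨pc, .rmw r a ex, pc + 1, none⟩]⟩ (γ.mem.update P.procs.length p i)) hp
      (by simpa [Config.set] using a3) hact
    rw [Config.set_set] at s3
    exact ((Relation.ReflTransGen.single s1).tail s2).tail s3
  · simpa [MemAction.target] using hy.symm

/-- All processes can see the last messages. -/
theorem exists_seen (S : Finset (ℕ × Loc)) (hS : ∀ s ∈ S, s.1 < P.procs.length ∧ P.IsLoc s.2)
    (h : γ.mem.Ready P) :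
    ∃ m', Relation.ReflTransGen (Step M P) γ ⟨γ.proc, m'⟩ ∧ m'.Ready P ∧
      (∀ x v A, γ.mem.LastMsg x v A → m'.LastMsg x v A) ∧
      ∀ s ∈ S, ∃ v, m'.LastMsg s.2 v {s.1} := by
  induction S using Finset.induction with
  | empty => exact ⟨γ.mem, .refl, h, fun _ _ _ => id, by simp⟩
  | insert s S _ ih =>
    obtain ⟨m, h1, h2, h3, h4⟩ := ih fun t ht => hS t (Finset.mem_insert_of_mem ht)
    obtain ⟨hp, hx⟩ := hS s (Finset.mem_insert_self ..)
    obtain ⟨i, hi, hr⟩ := h2.core.last _ hx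
    obtain ⟨h5, h6, -⟩ := h2.core.seen_update hp hi
    refine ⟨m.update P.procs.length s.1 i, h1.tail (.update s.1 hp i hi.1 (hr _ hp)),
      h2.update hp hi.1 (hr _ hp),
      fun x v A hv => (h3 x v A hv).update h2.core hp hi.1 (hr _ hp), fun t ht => ?_⟩
    rcases Finset.mem_insert.1 ht with rfl | ht
    · exact ⟨_, i, h5, rfl, by simpa using h6⟩
    · obtain ⟨v, hv⟩ := h4 t ht
      exact ⟨v, hv.update h2.core hp hi.1 (hr _ hp)⟩

/-- A plain configuration is reached once all buffers are empty. -/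
theorem exists_isPlain (h : γ.mem.Ready P)
    (hbuf : ∀ p < P.procs.length, (γ.proc p).past = [] ∧ (γ.proc p).spec = []) :
    ∃ m', Relation.ReflTransGen (Step M P) γ ⟨γ.proc, m'⟩ ∧ Config.IsPlain P ⟨γ.proc, m'⟩ ∧
      ∀ x v, γ.mem.LastMsg x v ∅ → ∀ i ∈ m'.writes, (m'.msg i).loc = x → (m'.msg i).val = v := by
  obtain ⟨m, h1, h2, h3, h4⟩ := exists_seen (M := M) (Finset.range P.procs.length ×ˢ
    insert none ((Finset.range P.vars).image some)) (fun s hs => by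
      simp only [Finset.mem_product, Finset.mem_range, Finset.mem_insert, Finset.mem_image] at hs
      refine ⟨hs.1, fun y hy => ?_⟩
      rcases hs.2 with h' | ⟨z, hz, h'⟩
      · simp [h'] at hy
      · rw [← h'] at hy
        exact Option.some.inj hy ▸ hz) h
  have hseen : ∀ p < P.procs.length, ∀ x, P.IsLoc x → ∃ v, m.LastMsg x v {p} := fun p hp x hx =>
    h4 (p, x) (by
      simp only [Finset.mem_product, Finset.mem_range, Finset.mem_insert, Finset.mem_image]
      refine ⟨hp, ?_⟩
      rcases x with _ | y
      · exact Or.inl rfl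
      · exact Or.inr ⟨y, hx y rfl, rfl⟩)
  -- Once every process has seen the last messages, coherent observation makes all other messages
  -- redundant to all of them, and the garbage has been collected. Only last messages remain.
  have hlast : ∀ u ∈ m.writes, m.IsLast (m.msg u).loc u := fun u hu => by
    have hx := h2.core.locations u hu
    obtain ⟨p, hp, hr⟩ := (h2.core.invariants h2.sourced h2.clean).noGarbageWrite u hu
    obtain ⟨-, i, hi, -, his⟩ := hseen p hp _ hx
    rcases hi.2.2 u hu rfl with h5 | h5
    · exact h5 ▸ hi
    · exact absurd h5 (h2.core.coherentObservation p hp u hu i hi.1 hi.2.1.symm hr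
        (h2.core.notMem_redundant_of_isLast hi hp) (his rfl))
  refine ⟨m, h1, ⟨h2.core.invariants h2.sourced h2.clean, hbuf, fun x hx => ?_,
    fun u hu p hp => ?_⟩, fun x v hv i hi hix => ?_⟩
  · obtain ⟨i, hi, -⟩ := h2.core.last x hx
    exact ⟨i, ⟨hi.1, hi.2.1⟩, fun j hj => h2.core.isLast_unique (hj.2 ▸ hlast j hj.1) hi⟩
  · obtain ⟨-, i, hi, -, his⟩ := hseen p hp _ (h2.core.locations u hu)
    rw [h2.core.isLast_unique (hlast u hu) hi]
    exact his rfl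
  · obtain ⟨j, hj, hv', -⟩ := h3 x v ∅ hv
    rw [← hv', h2.core.isLast_unique (hix ▸ hlast i hi : m.IsLast x i) hj]

end Run

/-! ### Reaching the prescribed plain configuration -/

section Load

variable {M : Propagation} {P : Program} {c₀ : ControlState} {vals : List ℕ}

theorem storeCode_getElem?_of_lt {flag j : ℕ} (h : j < vals.length) :
    (storeCode flag vals)[j]? = some (.rmw 0 (.const j) (.const (vals.getD j 0))) := by
  rw [storeCode, List.getElem?_append_left (by simpa using h)]
  simp [h]

theorem storeCode_getElem?_length (flag : ℕ) :
    (storeCode flag vals)[vals.length]? = some (.rmw 0 (.const flag) (.const 1)) := by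
  rw [storeCode, List.getElem?_append_right (by simp)]
  simp

theorem storeCode_length (flag : ℕ) : (storeCode flag vals).length = vals.length + 1 := by
  simp [storeCode]

theorem code_augment_head (hc : c₀.length = P.procs.length) {p : ℕ} (hp : p < c₀.length) {i : ℕ}
    (hi : i < (headCode P vals p).length) :
    ((P.augment (preamble P c₀ vals)).code p)[i]? = (headCode P vals p)[i]? := by
  rw [code_augment hc hp, preambleCode_getElem?_head hi]

theorem code_augment_store (hc : c₀.length = P.procs.length) (hp : 0 < c₀.length) {i : ℕ}
    (hi : i ≤ vals.length) :
    ((P.augment (preamble P c₀ vals)).code 0)[i]? = (storeCode P.vars vals)[i]? :=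
  code_augment_head hc hp (by
    rw [headCode, if_pos rfl, storeCode_length]; omega)

theorem code_augment_wait (hc : c₀.length = P.procs.length) {p : ℕ} (hp : p < c₀.length)
    (hp₀ : p ≠ 0) :
    ((P.augment (preamble P c₀ vals)).code p)[0]? =
        some (.rmw 0 (.const P.vars) ⟨[0], [([1], 1)]⟩) ∧
      ((P.augment (preamble P c₀ vals)).code p)[1]? = some (.branch ⟨[0], [([0], 1)]⟩ 0) := by
  have h : headCode P vals p = waitCode P.vars := if_neg hp₀
  constructor
  · rw [code_augment_head hc hp (by rw [h]; simp [waitCode]), h]; rfl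
  · rw [code_augment_head hc hp (by rw [h]; simp [waitCode]), h]; rfl

/-- The last label of the synchronization of the process `p`. -/
def syncLabel (vals : List ℕ) (p : ℕ) : ℕ := if p = 0 then vals.length + 1 else 1

/-- The path through the rest of the preamble of the process `p`, after its synchronization. -/
theorem exists_setup_augment (hc : c₀.length = P.procs.length) {p : ℕ} (hp : p < c₀.length)
    {reg : ℕ → ℕ} (hreg : ∀ r, r ≠ 0 → reg r = 0) (h0 : p ≠ 0 → reg 0 = 1) :
    ∃ C, Prelude reg (fun r => c₀[p].2.getD r 0) C ∧
      CodePath ((P.augment (preamble P c₀ vals)).code p) (syncLabel vals p) C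
        (c₀[p].1 + offset P c₀ vals p) ∧
      ∀ e ∈ C, e.label < offset P c₀ vals p := by
  rw [code_augment hc hp, offset_eq hp, syncLabel]
  by_cases hp₀ : p = 0
  · rw [if_pos hp₀, ← storeCode_length P.vars, headCode, if_pos hp₀]
    exact exists_setup _ _ _ hreg
  · rw [if_neg hp₀, headCode, if_neg hp₀]
    exact exists_setup_wait _ _ _ hreg (h0 hp₀)

theorem isLoc_augment_iff {x : ℕ} :
    (P.augment (preamble P c₀ vals)).IsLoc (some x) ↔ x < P.vars + 1 :=
  ⟨fun h => h x rfl, fun h _ hy => Option.some.inj hy ▸ h⟩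

/-- The process `p` has executed its preamble. -/
def loaded (P : Program) (c₀ : ControlState) (vals : List ℕ) (p : ℕ) : Proc :=
  ⟨(c₀.getD p (0, [])).1 + offset P c₀ vals p, fun r => (c₀.getD p (0, [])).2.getD r 0, [], []⟩

theorem steps_loaded {γ : Config} (hc : c₀.length = P.procs.length) {p : ℕ} (hp : p < c₀.length)
    {reg : ℕ → ℕ} (hreg : ∀ r, r ≠ 0 → reg r = 0) (h0 : p ≠ 0 → reg 0 = 1)
    (hγ : γ.proc p = ⟨syncLabel vals p, reg, [], []⟩) :
    Relation.ReflTransGen (Step M (P.augment (preamble P c₀ vals))) γ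
      (γ.set p (loaded P c₀ vals p) γ.mem) := by
  obtain ⟨C, h1, h2, -⟩ := exists_setup_augment (vals := vals) hc hp hreg h0
  refine Proc.TauReach.steps ?_ (by rw [augment_procs_length hc]; omega)
  have := h2.tauReach_of_prelude h1
  rw [hγ, loaded]
  simpa [List.getD_eq_getElem?_getD, hp] using this

/-- The values to be stored in the variables, and the flag. -/
def Stored (P : Program) (vals : List ℕ) (m : Mem) : Prop :=
  (∀ x < P.vars, m.LastMsg (some x) (vals.getD x 0) ∅) ∧ m.LastMsg (some P.vars) 1 ∅

/-- Process `0` runs its preamble alone. None of its RMWs can get stuck, since the last message to a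
location is always available as a source. -/
theorem exists_stored (hc : c₀.length = P.procs.length) (hn : 0 < P.procs.length)
    (hv : vals.length = P.vars) :
    ∃ m, Relation.ReflTransGen (Step M (P.augment (preamble P c₀ vals)))
        (initial (P.augment (preamble P c₀ vals)))
        ((initial (P.augment (preamble P c₀ vals))).set 0 (loaded P c₀ vals 0) m) ∧
      m.Ready (P.augment (preamble P c₀ vals)) ∧ Stored P vals m := by
  have hn' : 0 < (P.augment (preamble P c₀ vals)).procs.length := by
    rw [augment_procs_length hc]; exact hn
  -- Induction on the number of stored variables. Label `j` of the preamble stores variable `j`, so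
  -- the program counter equals this number.
  have key : ∀ j ≤ vals.length, ∃ reg m, (∀ r, r ≠ 0 → reg r = 0) ∧
      Relation.ReflTransGen (Step M (P.augment (preamble P c₀ vals)))
        (initial (P.augment (preamble P c₀ vals)))
        ((initial (P.augment (preamble P c₀ vals))).set 0 ⟨j, reg, [], []⟩ m) ∧
      m.Ready (P.augment (preamble P c₀ vals)) ∧
      ∀ x < j, m.LastMsg (some x) (vals.getD x 0) ∅ := by
    intro j
    induction j with
    | zero =>
      intro _
      refine ⟨fun _ => 0, _, fun _ _ => rfl, ?_, (isPlain_initial hn').ready hn', by simp⟩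
      rw [show (initial (P.augment (preamble P c₀ vals))).set 0 ⟨0, fun _ => 0, [], []⟩ _ = _ from
        Config.set_self _ 0]
    | succ j ih =>
      intro hj
      obtain ⟨reg, m, h1, h2, h3, h4⟩ := ih (by omega)
      have hloc : (P.augment (preamble P c₀ vals)).IsLoc (some j) :=
        isLoc_augment_iff.2 (by omega)
      obtain ⟨i, hi, -⟩ := h3.core.last _ hloc
      obtain ⟨m', h5, h6, h7, h8⟩ := exists_rmw (M := M)
        (γ := (initial (P.augment (preamble P c₀ vals))).set 0 ⟨j, reg, [], []⟩ m)
        (v := vals.getD j 0) hn' (Config.set_proc_self ..)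
        ((code_augment_store hc (by omega) (by omega)).trans (storeCode_getElem?_of_lt (by omega)))
        (Expr.eval_const _ _) (hloc j rfl) (Expr.eval_const _ _) h3
        ⟨i, hi, rfl, Set.empty_subset _⟩
      rw [Config.set_set] at h5
      refine ⟨_, m', fun r hr => ?_, h2.trans h5, h6, fun x hx => ?_⟩
      · rw [Function.update_of_ne hr, h1 r hr]
      · rcases Nat.lt_succ_iff_lt_or_eq.1 hx with hx | rfl
        · exact h8 _ _ (fun h' => by cases h'; omega) (h4 x hx)
        · exact h7
  obtain ⟨reg, m, h1, h2, h3, h4⟩ := key _ le_rfl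
  have hloc : (P.augment (preamble P c₀ vals)).IsLoc (some P.vars) :=
    isLoc_augment_iff.2 (by omega)
  obtain ⟨w, hw⟩ : ∃ w, m.LastMsg (some P.vars) w ∅ :=
    let ⟨i, hi, _⟩ := h3.core.last _ hloc
    ⟨_, i, hi, rfl, Set.empty_subset _⟩
  obtain ⟨m', h5, h6, h7, h8⟩ := exists_rmw (M := M)
    (γ := (initial (P.augment (preamble P c₀ vals))).set 0 ⟨vals.length, reg, [], []⟩ m)
    (v := 1) hn' (Config.set_proc_self ..)
    ((code_augment_store hc (by omega) le_rfl).trans (storeCode_getElem?_length _))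
    (Expr.eval_const _ _) (hloc _ rfl) (Expr.eval_const _ _) h3 hw
  rw [Config.set_set] at h5
  have h9 := steps_loaded (M := M) (P := P) (vals := vals)
    (γ := (initial (P.augment (preamble P c₀ vals))).set 0
      ⟨vals.length + 1, Function.update reg 0 w, [], []⟩ m') hc (p := 0) (by omega)
    (reg := Function.update reg 0 w) (fun r hr => by rw [Function.update_of_ne hr, h1 r hr])
    (by simp) (Config.set_proc_self ..)
  rw [Config.set_set] at h9
  refine ⟨m', (h2.trans h5).trans h9, h6, fun x hx => h8 _ _ ?_ (h4 x (by omega)), h7⟩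
  intro h'
  cases h'
  omega

/-- After process `0` the others run in turn. Each reads `1` from the flag at the first attempt and
writes `1` back, which leaves the flag ready for the next one. -/
theorem exists_loaded (hc : c₀.length = P.procs.length) (hn : 0 < P.procs.length)
    (hv : vals.length = P.vars) (k : ℕ) (hk : k + 1 ≤ P.procs.length) :
    ∃ γ, Relation.ReflTransGen (Step M (P.augment (preamble P c₀ vals)))
        (initial (P.augment (preamble P c₀ vals))) γ ∧
      γ.mem.Ready (P.augment (preamble P c₀ vals)) ∧ Stored P vals γ.mem ∧
      (∀ p < k + 1, γ.proc p = loaded P c₀ vals p) ∧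
      ∀ p, k + 1 ≤ p → γ.proc p = ⟨0, fun _ => 0, [], []⟩ := by
  induction k with
  | zero =>
    obtain ⟨m, h1, h2, h3⟩ := exists_stored (M := M) hc hn hv
    refine ⟨_, h1, h2, h3, fun p hp => ?_, fun p hp => ?_⟩
    · obtain rfl : p = 0 := by omega
      exact Config.set_proc_self ..
    · rw [Config.set_proc_of_ne _ (by omega)]; rfl
  | succ k ih =>
    obtain ⟨γ, h1, h2, h3, h4, h5⟩ := ih (by omega)
    have hp : k + 1 < (P.augment (preamble P c₀ vals)).procs.length := by
      rw [augment_procs_length hc]; omega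
    obtain ⟨m', h6, h7, h8, h9⟩ := exists_rmw (M := M) (v := 1) hp (h5 (k + 1) le_rfl)
      (code_augment_wait hc (by omega) (by omega)).1 (Expr.eval_const _ _)
      (by rw [augment_vars]; omega) (by simp [Expr.eval, List.lookup]) h2 h3.2
    have h10 := steps_loaded (M := M) (P := P) (vals := vals) (γ := γ.set (k + 1) _ m') hc
      (p := k + 1) (by omega) (reg := Function.update (fun _ => 0) 0 1)
      (fun r hr => by rw [Function.update_of_ne hr]) (by simp)
      (Config.set_proc_self ..)
    rw [Config.set_set] at h10
    refine ⟨_, (h1.trans h6).trans h10, h7, ⟨fun x hx => h9 _ _ ?_ (h3.1 x hx), h8⟩,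
      fun p hp => ?_, fun p hp => ?_⟩
    · intro h'
      cases h'
      omega
    · by_cases hpk : p = k + 1
      · subst hpk; exact Config.set_proc_self ..
      · rw [Config.set_proc_of_ne _ hpk]
        exact h4 p (by omega)
    · rw [Config.set_proc_of_ne _ (by omega)]
      exact h5 p (by omega)

theorem exists_isPlain_augment (hc : c₀.length = P.procs.length) (hn : 0 < P.procs.length)
    (hv : vals.length = P.vars) :
    ∃ γ : Config, Relation.ReflTransGen (Step M (P.augment (preamble P c₀ vals)))
        (initial (P.augment (preamble P c₀ vals))) γ ∧
      γ.IsPlain (P.augment (preamble P c₀ vals)) ∧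
      γ.HasControl (ControlState.augment c₀ (preamble P c₀ vals)) ∧ γ.HasValues vals := by
  obtain ⟨γ, h1, h2, h3, h4, -⟩ := exists_loaded (M := M) (P := P) (c₀ := c₀) hc hn hv
    (P.procs.length - 1) (by omega)
  have hlen := augment_procs_length (vals := vals) hc
  obtain ⟨m, h5, h6, h7⟩ := exists_isPlain (M := M) h2 fun p hp => by
    rw [h4 p (by omega)]; exact ⟨rfl, rfl⟩
  refine ⟨_, h1.trans h5, h6, (hasControl_augment rfl).2 fun p hp => ?_, fun x hx i hi hix => ?_⟩
  · rw [show (⟨γ.proc, m⟩ : Config).proc p = loaded P c₀ vals p from h4 p (by omega)]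
    simp [loaded, List.getD_eq_getElem?_getD, hp]
  · rw [h7 _ _ (h3.1 x (by omega)) i hi hix]
    simp [List.getD_eq_getElem?_getD, hx]

end Load

/-! ### The augmented program simulates the original one -/

section Simulation

variable {M : Propagation} {P : Program} {c₀ : ControlState} {vals : List ℕ}

theorem Proc.eq_mk {q : Proc} {pc : ℕ} {reg : ℕ → ℕ} (hpc : q.pc = pc) (hreg : ∀ r, q.reg r = reg r)
    (hbuf : q.past = [] ∧ q.spec = []) : q = ⟨pc, reg, [], []⟩ := by
  obtain ⟨pc', reg', past, spec⟩ := q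
  obtain ⟨h1, h2⟩ := hbuf
  simp only at hpc hreg h1 h2
  rw [hpc, funext hreg, h1, h2]

/-- The configuration `γ'` of the augmented program does what `γ` does. -/
structure Shifted (P : Program) (c₀ : ControlState) (vals : List ℕ) (γ γ' : Config) : Prop where
  proc : ∀ p < P.procs.length, γ'.proc p = (γ.proc p).shift (offset P c₀ vals p)
  addresses : ∀ p < P.procs.length, (γ.proc p).AddressesIn P.vars
  -- Here the original memory is the restrictive side. Both runs start plain, so all processes take
  -- part from the outset, and the reserved location merely fills the place of a flag.
  related : Mem.Related P.procs.length P.IsLoc P.IsLoc none Set.univ γ.mem γ'.mem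

/-- A process step is repeated by the relocated process with a matching memory action. A silent
update is either repeated or, if its message has no counterpart, skipped. -/
theorem Shifted.step (hP : P.WellFormed) (hc : c₀.length = P.procs.length) {γ γ₁ γ' : Config}
    (h : Shifted P c₀ vals γ γ') (hs : Step M P γ γ₁) :
    ∃ γ₁', Relation.ReflTransGen (Step M (P.augment (preamble P c₀ vals))) γ' γ₁' ∧
      Shifted P c₀ vals γ₁ γ₁' := by
  have hlen := augment_procs_length (P := P) (vals := vals) hc
  have hnone : P.IsLoc none := fun y hy => by cases hy
  rcases hs.exists_act with ⟨p, hp, act, q, m, hq, hm, rfl⟩ | ⟨p, hp, v, hv, hr, rfl⟩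
  · obtain ⟨h1, h2⟩ := hq.addressesIn hP (h.addresses p hp)
    obtain ⟨m', h3, h4⟩ := h.related.act (fun _ => id) hnone hp (Set.mem_univ p) h2 hm
    have hcode := codeShift_augment (P := P) (vals := vals) hc (p := p) (by omega)
    rw [← offset_eq] at hcode
    have h5 := Lifted.act_up hcode hq
    rw [← h.proc p hp] at h5
    rw [← hlen] at h3 hp
    refine ⟨_, .single (step_of_act hp h5 h3), fun p' hp' => ?_, fun p' hp' => ?_, h4⟩
    · by_cases hpp : p' = p
      · subst hpp; rw [Config.set_proc_self, Config.set_proc_self]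
      · rw [Config.set_proc_of_ne _ hpp, Config.set_proc_of_ne _ hpp]; exact h.proc p' hp'
    · by_cases hpp : p' = p
      · subst hpp; rw [Config.set_proc_self]; exact h1
      · rw [Config.set_proc_of_ne _ hpp]; exact h.addresses p' hp'
  · rcases h.related.update (fun _ => id) hnone hp hv hr with h1 | ⟨w, hw, hr', h1⟩
    · exact ⟨_, .refl, h.proc, h.addresses, h1⟩
    · rw [← hlen] at hp h1
      exact ⟨_, .single (.update p hp w hw hr'), h.proc, h.addresses, by rw [← hlen]; exact h1⟩

theorem Config.HasControl.proc_eq {γ : Config} {s : ControlState} (h : γ.HasControl s) {p : ℕ}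
    (hp : p < s.length) (hbuf : (γ.proc p).past = [] ∧ (γ.proc p).spec = []) :
    γ.proc p = ⟨s[p].1, fun r => s[p].2.getD r 0, [], []⟩ :=
  Proc.eq_mk (h p hp).1 (h p hp).2 hbuf

/-- After the preambles, the augmented program is in a plain configuration with the same values,
whose memory is as permissive as that of `γ`. The given run is simulated from there. -/
theorem controlReachable_augment (hP : P.WellFormed) (hc : c₀.length = P.procs.length)
    (hv : vals.length = P.vars) {γ : Config} (hγ : γ.IsPlain P) (hγc : γ.HasControl c₀)
    (hγv : γ.HasValues vals) {c : ControlState} (hcl : c.length = P.procs.length)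
    (h : ControlReachableFrom M P γ c) :
    ControlReachable M (P.augment (preamble P c₀ vals))
      (ControlState.augment c (preamble P c₀ vals)) := by
  have hn : 0 < P.procs.length := List.length_pos_iff.2 hP.1
  have hlen := augment_procs_length (P := P) (vals := vals) hc
  obtain ⟨γ', h1, h2, h3, h4⟩ := exists_isPlain_augment (M := M) hc hn hv
  have hloc : ∀ x, P.IsLoc x → (P.augment (preamble P c₀ vals)).IsLoc x :=
    fun x hx y hy => (hx y hy).trans (Nat.lt_succ_self _)
  have hstart : Shifted P c₀ vals γ γ' := by
    refine ⟨fun p hp => ?_, fun p hp => ?_, Mem.Related.of_isPlain h2 hn hlen hloc (hγ.core hn)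
      (fun x hx u hu v hv' hvx => ?_) fun v hv' hl hnl => ?_⟩
    · rw [hγc.proc_eq (by omega) (hγ.buffers p hp)]
      obtain ⟨h5, h6⟩ := (hasControl_augment rfl).1 h3 p (by omega)
      exact Proc.eq_mk h5 h6 (h2.buffers p (by omega))
    · intro e he
      rw [(hγ.buffers p hp).1, (hγ.buffers p hp).2] at he
      simp at he
    · have hxv : x < vals.length := by rw [hv]; exact hx x rfl
      rw [h4 x hxv v hv' hvx, hγv x hxv u hu.1 hu.2.1]
    · exact absurd ⟨hv', rfl, fun u hu hul => Or.inl (hγ.unique u hu v hv' hul)⟩ hnl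
  obtain ⟨γ₁, hrun, hcon⟩ := h
  have key : ∃ γ₁', Relation.ReflTransGen (Step M (P.augment (preamble P c₀ vals))) γ' γ₁' ∧
      Shifted P c₀ vals γ₁ γ₁' := by
    clear hcon
    induction hrun with
    | refl => exact ⟨γ', .refl, hstart⟩
    | tail _ hs ih =>
      obtain ⟨γ₂, h5, h6⟩ := ih
      obtain ⟨γ₃, h7, h8⟩ := h6.step hP hc hs
      exact ⟨γ₃, h5.trans h7, h8⟩
  obtain ⟨γ₁', h5, h6⟩ := key
  refine ⟨γ₁', h1.trans h5, (hasControl_augment (hc.trans hcl.symm)).2 fun p hp => ?_⟩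
  rw [h6.proc p (by omega)]
  exact ⟨congrArg (· + _) (hcon p hp).1, (hcon p hp).2⟩

end Simulation

/-! ### Runs of the augmented program -/

/-- The process waits for the flag. -/
structure Waiting (code : List Instr) (q : Proc) : Prop where
  speculating : Speculating code q
  pc : q.pc = 0 ∨ q.pc = 1 ∧ q.reg 0 = 0

/-- The loop cannot be left by speculation: the RMW lets nothing overtake it, and with `0` in the
register the branch is resolved and leads back to the RMW. The only effect on memory is the RMW on
the flag. -/
theorem Waiting.act {code : List Instr} {q q' : Proc} {act : MemAction} {flag : ℕ}
    (h : Waiting code q) (h0 : code[0]? = some (.rmw 0 (.const flag) ⟨[0], [([1], 1)]⟩))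
    (h1 : code[1]? = some (.branch ⟨[0], [([0], 1)]⟩ 0)) (hact : q.Act code act q') :
    (act = .tau ∧ Waiting code q') ∨
      ∃ w v, act = .rmw (some flag) w v ∧ Speculating code q' ∧ q'.pc = 1 ∧ q'.reg 0 = w ∧
        v = if w = 1 then 1 else 0 := by
  rcases h.pc with hpc | ⟨hpc, hreg⟩
  · rcases h.speculating.act_rmw (by rw [hpc]; exact h0) hact with
      ⟨h2, h3, h4, -⟩ | ⟨x, w, v, rfl, hx, hv, h3, h4, h5⟩
    · exact Or.inl ⟨h2, h3, Or.inl (h4.trans hpc)⟩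
    · rw [Expr.eval_const] at hx
      obtain rfl := Option.some.inj hx
      refine Or.inr ⟨w, v, rfl, h3, by rw [h4, hpc], by rw [h5, Function.update_self], ?_⟩
      by_cases hw : w = 1
      · subst hw
        simpa [Expr.eval, List.lookup, eq_comm] using hv
      · have hw' : (([w] : List ℕ) == [1]) = false := by simpa using hw
        rw [if_neg hw]
        simpa [Expr.eval, List.lookup, hw', eq_comm, hw] using hv
  · obtain ⟨h2, h3, h4, h5⟩ := h.speculating.act_branch (t' := 0) (b := 1) (by rw [hpc]; exact h1)
      (by simp [Expr.eval, hreg, List.lookup]) (by simp) h0 hact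
    refine Or.inl ⟨h2, h3, ?_⟩
    rcases h5 with h5 | h5
    · exact Or.inr ⟨h5.trans hpc, by rw [h4, hreg]⟩
    · exact Or.inl h5

section Simulation

variable {M : Propagation} {P : Program} {c₀ : ControlState} {vals : List ℕ} {γ γ' γ₁' : Config}

/-- The process `p` at the beginning of a run from the control state `c₀`. -/
def startProc (c₀ : ControlState) (p : ℕ) : Proc :=
  ⟨(c₀.getD p (0, [])).1, fun r => (c₀.getD p (0, [])).2.getD r 0, [], []⟩

/-- From its synchronization on, the process may act on what it has speculated of the original code,
so the original process fetches the same entries now. -/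
theorem exists_post (hP : P.WellFormed) (hc : c₀.length = P.procs.length) {p : ℕ}
    (hp : p < P.procs.length) {q' : Proc}
    (h : Speculating ((P.augment (preamble P c₀ vals)).code p) q') (hpc : q'.pc = syncLabel vals p)
    (h0 : p ≠ 0 → q'.reg 0 = 1) :
    ∃ q, Proc.TauReach (P.code p) (startProc c₀ p) q ∧ q.AddressesIn P.vars ∧
      Post (offset P c₀ vals p) ((P.augment (preamble P c₀ vals)).code p) (startProc c₀ p).pc
        (startProc c₀ p).reg q' q := by
  obtain ⟨C, h1, h2, h3⟩ := exists_setup_augment (P := P) (vals := vals) hc (hc ▸ hp) h.reg h0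
  have hcode := codeShift_augment (P := P) (vals := vals) hc (p := p) (by omega)
  rw [← offset_eq] at hcode
  obtain ⟨l', hl'⟩ := h.path
  have hget : c₀.getD p (0, []) = c₀[p]'(hc ▸ hp) := by
    simp [List.getD_eq_getElem?_getD, hc, hp]
  rw [← hpc] at h2
  obtain ⟨q, h4, h5⟩ := Post.of_codePath hcode h.past hl' h.settled h1 h2 (h2.low h3)
  refine ⟨q, by rw [startProc, hget]; exact h4, ?_, by rw [startProc, hget]; exact h5⟩
  clear h5
  induction h4 with
  | refl => intro e he; simp at he
  | tail _ hact ih => exact (hact.addressesIn hP ih).1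

/-- The state of the augmented program before the flag is set. -/
structure Storing (M : Propagation) (P : Program) (c₀ : ControlState) (vals : List ℕ)
    (γ' : Config) : Prop where
  core : γ'.mem.Core P.procs.length (P.augment (preamble P c₀ vals)).IsLoc
  -- In this model fences order nothing; what replaces their effect is the absence of old messages.
  unique : M = .multiCopyAtomic → γ'.mem.Unique
  speculating : Speculating ((P.augment (preamble P c₀ vals)).code 0) (γ'.proc 0)
  pc : (γ'.proc 0).pc ≤ vals.length
  waiting : ∀ p < P.procs.length, p ≠ 0 →
    Waiting ((P.augment (preamble P c₀ vals)).code p) (γ'.proc p)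
  flag : γ'.mem.LastMsg (some P.vars) 0 ∅
  -- Process `0` must have seen the last messages, because the fence of its signal is placed above
  -- what it has seen. It has seen the initial messages as well as its own writes.
  stored : ∀ x, P.IsLoc x → ∃ v, γ'.mem.LastMsg x v {0} ∧
    ∀ y < (γ'.proc 0).pc, x = some y → v = vals.getD y 0

/-- The state of the augmented program after the flag has been set, compared to the state of the
program. -/
structure Running (P : Program) (c₀ : ControlState) (vals : List ℕ) (post : Set ℕ)
    (γ' γ : Config) : Prop where
  related : Mem.Related P.procs.length P.IsLoc (P.augment (preamble P c₀ vals)).IsLoc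
    (some P.vars) post γ'.mem γ.mem
  flag : γ'.mem.LastMsg (some P.vars) 1 ∅
  proc : ∀ p < P.procs.length,
    p ∈ post ∧ Post (offset P c₀ vals p) ((P.augment (preamble P c₀ vals)).code p)
      (startProc c₀ p).pc (startProc c₀ p).reg (γ'.proc p) (γ.proc p) ∨
    p ≠ 0 ∧ Waiting ((P.augment (preamble P c₀ vals)).code p) (γ'.proc p) ∧
      γ.proc p = startProc c₀ p
  addresses : ∀ p < P.procs.length, (γ.proc p).AddressesIn P.vars

theorem isLoc_augment {x : Loc} (hx : P.IsLoc x) : (P.augment (preamble P c₀ vals)).IsLoc x :=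
  fun y hy => (hx y hy).trans (Nat.lt_succ_self _)

theorem isLoc_flag : (P.augment (preamble P c₀ vals)).IsLoc (some P.vars) :=
  isLoc_augment_iff.2 (Nat.lt_succ_self _)

theorem locsIn_flag {w v : ℕ} :
    (MemAction.rmw (some P.vars) w v).LocsIn (P.augment (preamble P c₀ vals)).IsLoc := isLoc_flag

theorem not_isLoc_flag : ¬ P.IsLoc (some P.vars) := fun h => (h _ rfl).ne rfl

theorem storing_initial (hc : c₀.length = P.procs.length) (hn : 0 < P.procs.length) :
    Storing M P c₀ vals (initial (P.augment (preamble P c₀ vals))) := by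
  have hlen := augment_procs_length (P := P) (vals := vals) hc
  have hplain := isPlain_initial (P := P.augment (preamble P c₀ vals)) (by omega)
  have hspec : ∀ p, Speculating ((P.augment (preamble P c₀ vals)).code p)
      ((initial (P.augment (preamble P c₀ vals))).proc p) := fun p =>
    ⟨rfl, ⟨0, rfl⟩, rfl, fun _ _ => rfl⟩
  have hlast : ∀ x, (P.augment (preamble P c₀ vals)).IsLoc x → _ := fun x hx =>
    hplain.lastMsg (by omega) hx (v := 0) fun _ _ _ => rfl
  refine ⟨hlen ▸ hplain.core (by omega), fun _ => hplain.unique, hspec 0, Nat.zero_le _,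
    fun p _ _ => ⟨hspec p, Or.inl rfl⟩, (hlast _ isLoc_flag).mono (Set.empty_subset _),
    fun x hx => ⟨0, (hlast x (isLoc_augment hx)).mono ?_, fun y hy => absurd hy (Nat.not_lt_zero y)⟩⟩
  rintro _ rfl
  simp only [Set.mem_ofPred_eq]
  omega

theorem Storing.update (h : Storing M P c₀ vals γ') {p v : ℕ} (hp : p < P.procs.length)
    (hv : v ∈ γ'.mem.writes) (hr : p ∉ (γ'.mem.msg v).redundant) :
    Storing M P c₀ vals ⟨γ'.proc, γ'.mem.update P.procs.length p v⟩ :=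
  ⟨h.core.update hp hv hr, fun hM => (h.unique hM).update _ _ _, h.speculating, h.pc, h.waiting,
    h.flag.update h.core hp hv hr, fun x hx =>
      let ⟨w, h1, h2⟩ := h.stored x hx
      ⟨w, h1.update h.core hp hv hr, h2⟩⟩

/-- The last message to the flag is `0`, so a waiting process reads `0`, writes `0` back and goes on
waiting. -/
theorem Storing.act_waiting (h : Storing M P c₀ vals γ') (hc : c₀.length = P.procs.length) {p : ℕ}
    (hp : p < P.procs.length) (hp₀ : p ≠ 0) {act : MemAction} {q : Proc} {m : Mem}
    (hq : (γ'.proc p).Act ((P.augment (preamble P c₀ vals)).code p) act q)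
    (hm : γ'.mem.Act M P.procs.length p act m) : Storing M P c₀ vals (γ'.set p q m) := by
  obtain ⟨hc0, hc1⟩ := code_augment_wait (P := P) (vals := vals) hc (p := p) (by omega) hp₀
  have hq₀ : (γ'.set p q m).proc 0 = γ'.proc 0 := Config.set_proc_of_ne _ hp₀.symm _ _
  have hwait : Waiting ((P.augment (preamble P c₀ vals)).code p) q →
      ∀ p' < P.procs.length, p' ≠ 0 →
      Waiting ((P.augment (preamble P c₀ vals)).code p') ((γ'.set p q m).proc p') :=
    fun hw p' hp' hp₀' => by
      by_cases hpp : p' = p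
      · subst hpp; rw [Config.set_proc_self]; exact hw
      · rw [Config.set_proc_of_ne _ hpp]; exact h.waiting p' hp' hp₀'
  rcases (h.waiting p hp hp₀).act hc0 hc1 hq with ⟨rfl, hw⟩ | ⟨w, v, rfl, h1, h2, h3, h4⟩
  · obtain rfl : m = γ'.mem := hm
    exact ⟨h.core, h.unique, hq₀ ▸ h.speculating, hq₀ ▸ h.pc, hwait hw, h.flag, hq₀ ▸ h.stored⟩
  · obtain rfl : w = 0 := hm.eq_of_lastMsg h.core (by simp) h.flag
    obtain rfl : v = 0 := h4
    refine ⟨h.core.act hp locsIn_flag hm, fun hM => ?_, hq₀ ▸ h.speculating, hq₀ ▸ h.pc,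
      hwait ⟨h1, Or.inr ⟨h2, h3⟩⟩, (hm.lastMsg h.core hp isLoc_flag).mono (Set.empty_subset _),
      fun x hx => ?_⟩
    · subst hM
      obtain ⟨v₀, -, -, rfl⟩ := hm
      exact (h.unique rfl).rmw _ _ _ _
    · obtain ⟨u, h5, h6⟩ := h.stored x hx
      refine ⟨u, h5.act h.core hp locsIn_flag ?_ hm, hq₀ ▸ h6⟩
      intro h'
      rw [← Option.some.inj h'] at hx
      exact not_isLoc_flag hx

theorem Storing.act_tau (h : Storing M P c₀ vals γ') {q : Proc}
    (hq : Speculating ((P.augment (preamble P c₀ vals)).code 0) q)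
    (hpc : q.pc = (γ'.proc 0).pc) : Storing M P c₀ vals (γ'.set 0 q γ'.mem) := by
  have hq₀ : (γ'.set 0 q γ'.mem).proc 0 = q := Config.set_proc_self ..
  refine ⟨h.core, h.unique, hq₀ ▸ hq, by rw [hq₀, hpc]; exact h.pc, fun p hp hp₀ => ?_, h.flag,
    by rw [hq₀, hpc]; exact h.stored⟩
  rw [Config.set_proc_of_ne _ hp₀]
  exact h.waiting p hp hp₀

theorem Storing.act_store (h : Storing M P c₀ vals γ') (hv : vals.length = P.vars)
    (hn : 0 < P.procs.length) {q : Proc} {m : Mem} {w : ℕ}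
    (hlt : (γ'.proc 0).pc < vals.length)
    (hm : γ'.mem.Act M P.procs.length 0
      (.rmw (some (γ'.proc 0).pc) w (vals.getD (γ'.proc 0).pc 0)) m)
    (hq : Speculating ((P.augment (preamble P c₀ vals)).code 0) q)
    (hpc : q.pc = (γ'.proc 0).pc + 1) : Storing M P c₀ vals (γ'.set 0 q m) := by
  have hloc : P.IsLoc (some (γ'.proc 0).pc) := fun y hy => by
    rw [← Option.some.inj hy]; omega
  have hact : (MemAction.rmw (some (γ'.proc 0).pc) w (vals.getD (γ'.proc 0).pc 0)).LocsIn
    (P.augment (preamble P c₀ vals)).IsLoc := isLoc_augment hloc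
  have hq₀ : (γ'.set 0 q m).proc 0 = q := Config.set_proc_self ..
  refine ⟨h.core.act hn hact hm, fun hM => ?_, hq₀ ▸ hq, by rw [hq₀]; omega, fun p hp hp₀ => ?_,
    h.flag.act h.core hn hact ?_ hm, fun x hx => ?_⟩
  · subst hM
    obtain ⟨v₀, -, -, rfl⟩ := hm
    exact (h.unique rfl).rmw _ _ _ _
  · rw [Config.set_proc_of_ne _ hp₀]; exact h.waiting p hp hp₀
  · intro h'
    rw [Option.some.inj h'] at hloc
    exact not_isLoc_flag hloc
  · rw [hq₀, hpc]
    by_cases hxj : x = some (γ'.proc 0).pc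
    · subst hxj
      exact ⟨_, hm.lastMsg h.core hn hact, fun y _ hy => by rw [Option.some.inj hy]⟩
    · obtain ⟨u, h1, h2⟩ := h.stored x hx
      refine ⟨u, h1.act h.core hn hact (fun h' => hxj (Option.some.inj h').symm) hm,
        fun y hy hxy => h2 y ?_ hxy⟩
      rcases Nat.lt_succ_iff_lt_or_eq.1 hy with h3 | rfl
      · exact h3
      · exact absurd hxy hxj

/-- This is where the two runs get linked. The program counter of process `0` shows that all
variables have been stored, so the last values agree with those of the plain configuration, and
`rmw_signal` takes care of the older messages. -/
theorem Storing.act_flag (h : Storing M P c₀ vals γ') (hP : P.WellFormed)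
    (hc : c₀.length = P.procs.length) (hv : vals.length = P.vars) (hγ : γ.IsPlain P)
    (hγc : γ.HasControl c₀) (hγv : γ.HasValues vals) {q : Proc} {m : Mem} {w : ℕ}
    (hpc₀ : (γ'.proc 0).pc = vals.length)
    (hm : γ'.mem.Act M P.procs.length 0 (.rmw (some P.vars) w 1) m)
    (hq : Speculating ((P.augment (preamble P c₀ vals)).code 0) q)
    (hpc : q.pc = vals.length + 1) :
    ∃ γ₁, Relation.ReflTransGen (Step M P) γ γ₁ ∧
      Running P c₀ vals {0} (γ'.set 0 q m) γ₁ := by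
  have hn : 0 < P.procs.length := List.length_pos_iff.2 hP.1
  obtain ⟨q₀, h1, h2, h3⟩ := exists_post (vals := vals) hP hc hn hq hpc (fun h' => absurd rfl h')
  have hstart : ∀ p < P.procs.length, γ.proc p = startProc c₀ p := fun p hp => by
    rw [hγc.proc_eq (hc ▸ hp) (hγ.buffers p hp)]
    simp [startProc, List.getD_eq_getElem?_getD, hc, hp]
  rw [← hstart 0 hn] at h1
  have hcore := h.core.act hn locsIn_flag hm
  refine ⟨_, h1.steps hn, ⟨?_, (hm.lastMsg h.core hn isLoc_flag).mono (Set.empty_subset _),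
    fun p hp => ?_, fun p hp => ?_⟩⟩
  · change Mem.Related _ _ _ _ _ m γ.mem
    refine Mem.Related.of_isPlain hγ hn rfl (fun _ => id) hcore (fun x hx u hu v hv' hvx => ?_)
      fun u hu hl hnl => ?_
    · obtain ⟨y, h4, h5⟩ := h.stored _ hx
      have hxv : x < vals.length := hv ▸ hx x rfl
      have hy := h5 x (hpc₀ ▸ hxv) rfl
      obtain ⟨i, hi, h6, -⟩ := h4.act h.core hn locsIn_flag (fun h' => by
        rw [← Option.some.inj h'] at hx
        exact not_isLoc_flag hx) hm
      rw [hcore.isLast_unique hu hi, h6, hy, hγv x hxv v hv' hvx]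
      simp [List.getD_eq_getElem?_getD, hxv]
    · obtain ⟨v₀, hr, -, rfl⟩ := hm
      have h4 := Mem.rmw_signal h.core hn isLoc_flag not_isLoc_flag
        (fun x hx => let ⟨v, hv, _⟩ := h.stored x hx; ⟨v, hv⟩) h.unique hr u hu hl hnl
      exact ⟨h4.1, fun p _ hp => by rw [Set.mem_singleton_iff.1 hp]; exact h4.2⟩
  · by_cases hp₀ : p = 0
    · subst hp₀
      rw [Config.set_proc_self, Config.set_proc_self]
      exact Or.inl ⟨rfl, h3⟩
    · rw [Config.set_proc_of_ne _ hp₀, Config.set_proc_of_ne _ hp₀]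
      exact Or.inr ⟨hp₀, h.waiting p hp hp₀, hstart p hp⟩
  · by_cases hp₀ : p = 0
    · subst hp₀; rw [Config.set_proc_self]; exact h2
    · rw [Config.set_proc_of_ne _ hp₀, hstart p hp]
      intro e he
      simp [startProc] at he

theorem Storing.step (h : Storing M P c₀ vals γ') (hP : P.WellFormed)
    (hc : c₀.length = P.procs.length) (hv : vals.length = P.vars) (hγ : γ.IsPlain P)
    (hγc : γ.HasControl c₀) (hγv : γ.HasValues vals)
    (hs : Step M (P.augment (preamble P c₀ vals)) γ' γ₁') :
    Storing M P c₀ vals γ₁' ∨ ∃ γ₁, Relation.ReflTransGen (Step M P) γ γ₁ ∧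
      Running P c₀ vals {0} γ₁' γ₁ := by
  have hn : 0 < P.procs.length := List.length_pos_iff.2 hP.1
  rcases hs.exists_act with ⟨p, hp, act, q, m, hq, hm, rfl⟩ | ⟨p, hp, v, hv', hr, rfl⟩
  all_goals rw [augment_procs_length hc] at *
  · by_cases hp₀ : p = 0
    · subst hp₀
      have hcode := code_augment_store (P := P) (vals := vals) hc (by omega) h.pc
      rcases h.pc.lt_or_eq with hlt | heq
      · rw [storeCode_getElem?_of_lt hlt] at hcode
        rcases h.speculating.act_rmw hcode hq with
          ⟨rfl, h1, h2, -⟩ | ⟨x, w, v, rfl, hx, hv', h1, h2, -⟩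
        · obtain rfl : m = γ'.mem := hm
          exact Or.inl (h.act_tau h1 h2)
        · rw [Expr.eval_const] at hx hv'
          cases hx
          cases hv'
          exact Or.inl (h.act_store hv hn hlt hm h1 h2)
      · rw [heq, storeCode_getElem?_length] at hcode
        rw [← heq] at hcode
        rcases h.speculating.act_rmw hcode hq with
          ⟨rfl, h1, h2, -⟩ | ⟨x, w, v, rfl, hx, hv', h1, h2, -⟩
        · obtain rfl : m = γ'.mem := hm
          exact Or.inl (h.act_tau h1 h2)
        · rw [Expr.eval_const] at hx hv'
          cases hx
          cases hv'
          exact Or.inr (h.act_flag hP hc hv hγ hγc hγv heq hm h1 (heq ▸ h2))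
    · exact Or.inl (h.act_waiting hc hp hp₀ hq hm)
  · exact Or.inl (h.update hp hv' hr)

/-- A process beyond its synchronization is imitated by the original one, or handles the rest of its
preamble while the original one rests. A waiting process that executes its RMW reads `1` and joins
`post`, while its original fetches what has been speculated. -/
theorem Running.step {post : Set ℕ} (h : Running P c₀ vals post γ' γ) (hP : P.WellFormed)
    (hc : c₀.length = P.procs.length)
    (hs : Step M (P.augment (preamble P c₀ vals)) γ' γ₁') :
    ∃ post' γ₁, Relation.ReflTransGen (Step M P) γ γ₁ ∧ Running P c₀ vals post' γ₁' γ₁ := by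
  have hcore : γ'.mem.Core P.procs.length (P.augment (preamble P c₀ vals)).IsLoc :=
    let ⟨_, _, hrel⟩ := h.related
    hrel.core
  have hL : ∀ x, P.IsLoc x → (P.augment (preamble P c₀ vals)).IsLoc x := fun _ => isLoc_augment
  rcases hs.exists_act with ⟨p, hp, act, q', m', hq, hm, rfl⟩ | ⟨p, hp, v, hv', hr, rfl⟩
  all_goals rw [augment_procs_length hc] at *
  · have hset : ∀ {post' : Set ℕ} {q : Proc} {m : Mem}, post ⊆ post' → q.AddressesIn P.vars →
        m'.LastMsg (some P.vars) 1 ∅ →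
        Mem.Related P.procs.length P.IsLoc (P.augment (preamble P c₀ vals)).IsLoc
          (some P.vars) post' m' m →
        (p ∈ post' ∧ Post (offset P c₀ vals p) ((P.augment (preamble P c₀ vals)).code p)
            (startProc c₀ p).pc (startProc c₀ p).reg q' q ∨
          p ≠ 0 ∧ Waiting ((P.augment (preamble P c₀ vals)).code p) q' ∧ q = startProc c₀ p) →
        Running P c₀ vals post' (γ'.set p q' m') (γ.set p q m) := by
      intro post' q m hsub haddr hflag hrel hproc
      refine ⟨hrel, hflag, fun p' hp' => ?_, fun p' hp' => ?_⟩
      · by_cases hpp : p' = p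
        · subst hpp
          rwa [Config.set_proc_self, Config.set_proc_self]
        · rw [Config.set_proc_of_ne _ hpp, Config.set_proc_of_ne _ hpp]
          exact (h.proc p' hp').imp_left fun h' => ⟨hsub h'.1, h'.2⟩
      · by_cases hpp : p' = p
        · subst hpp
          rwa [Config.set_proc_self]
        · rw [Config.set_proc_of_ne _ hpp]
          exact h.addresses p' hp'
    rcases h.proc p hp with ⟨hpost, hproc⟩ | ⟨hp₀, hwait, hstart⟩
    · have hcode := codeShift_augment (P := P) (vals := vals) hc (p := p) (by omega)
      rw [← offset_eq] at hcode
      rcases hproc.act hcode hq with ⟨rfl, h1⟩ | ⟨q, h1, h2⟩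
      · obtain rfl : m' = γ'.mem := hm
        have := hset subset_rfl (h.addresses p hp) h.flag h.related (Or.inl ⟨hpost, h1⟩)
        rw [Config.set_self] at this
        exact ⟨post, γ, .refl, this⟩
      · obtain ⟨h3, h4⟩ := h1.addressesIn hP (h.addresses p hp)
        obtain ⟨m, h5, h6⟩ := h.related.act hL isLoc_flag hp hpost h4 hm
        -- The original program cannot name the flag, so the flag keeps the value `1`.
        have hact : act.LocsIn (P.augment (preamble P c₀ vals)).IsLoc ∧
            act.target ≠ some (some P.vars) := by
          cases act with
          | tau | fence => exact ⟨trivial, nofun⟩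
          | read x v => exact ⟨hL _ h4, nofun⟩
          | write x v =>
            refine ⟨hL _ h4, fun h' => not_isLoc_flag (P := P) ?_⟩
            rw [← Option.some.inj h']
            exact h4
          | rmw x r v =>
            refine ⟨hL _ h4, fun h' => not_isLoc_flag (P := P) ?_⟩
            rw [← Option.some.inj h']
            exact h4
        exact ⟨post, _, .single (step_of_act hp h1 h5), hset subset_rfl h3
          (h.flag.act hcore hp hact.1 hact.2 hm) h6 (Or.inl ⟨hpost, h2⟩)⟩
    · obtain ⟨hc0, hc1⟩ := code_augment_wait (P := P) (vals := vals) hc (p := p) (by omega) hp₀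
      rcases hwait.act hc0 hc1 hq with ⟨rfl, hw⟩ | ⟨w, v, rfl, h1, h2, h3, h4⟩
      · obtain rfl : m' = γ'.mem := hm
        have := hset subset_rfl (h.addresses p hp) h.flag h.related
          (Or.inr ⟨hp₀, hw, hstart⟩)
        rw [Config.set_self] at this
        exact ⟨post, γ, .refl, this⟩
      · obtain rfl : w = 1 := hm.eq_of_lastMsg hcore (by simp) h.flag
        obtain rfl : v = 1 := h4
        obtain ⟨q, h5, h6, h7⟩ := exists_post hP hc hp h1 (by rw [h2, syncLabel, if_neg hp₀])
          fun _ => h3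
        have hflag := (hm.lastMsg hcore hp isLoc_flag).mono (Set.empty_subset _)
        obtain ⟨v₀, hr, -, rfl⟩ := hm
        rw [← hstart] at h5
        exact ⟨insert p post, _, h5.steps hp, hset (Set.subset_insert _ _) h6 hflag
          (h.related.rmw_flag hL isLoc_flag not_isLoc_flag hp hr 1)
          (Or.inl ⟨Set.mem_insert _ _, h7⟩)⟩
  · rcases h.related.update hL isLoc_flag hp hv' hr with h1 | ⟨w, hw, hr', h1⟩
    · exact ⟨post, γ, .refl, h1, h.flag.update hcore hp hv' hr, h.proc, h.addresses⟩
    · exact ⟨post, _, .single (.update p hp w hw hr'), h1, h.flag.update hcore hp hv' hr, h.proc,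
        h.addresses⟩

/-- A process that has not completed its synchronization is at a label inside its preamble, so its
program counter cannot be that of a relocated control state. -/
theorem lt_offset (hc : c₀.length = P.procs.length) {p : ℕ} (hp : p < P.procs.length) :
    syncLabel vals p < offset P c₀ vals p := by
  rw [offset_eq (hc ▸ hp), preambleCode_length, headCode, syncLabel]
  split_ifs
  · rw [storeCode_length]; omega
  · rw [waitCode]; simp only [List.length_cons, List.length_nil]; omega

theorem controlReachableFrom_of_augment (hP : P.WellFormed) (hc : c₀.length = P.procs.length)
    (hv : vals.length = P.vars) (hγ : γ.IsPlain P) (hγc : γ.HasControl c₀)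
    (hγv : γ.HasValues vals) {s : ControlState} (hs : s.length = P.procs.length)
    (h : ControlReachable M (P.augment (preamble P c₀ vals))
      (ControlState.augment s (preamble P c₀ vals))) :
    ControlReachableFrom M P γ s := by
  have hn : 0 < P.procs.length := List.length_pos_iff.2 hP.1
  obtain ⟨γ₁', hrun, hcon⟩ := h
  have key : Storing M P c₀ vals γ₁' ∨ ∃ post γ₁, Relation.ReflTransGen (Step M P) γ γ₁ ∧
      Running P c₀ vals post γ₁' γ₁ := by
    clear hcon
    induction hrun with
    | refl => exact Or.inl (storing_initial hc hn)
    | tail _ hstep ih =>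
      rcases ih with ih | ⟨post, γ₂, h1, h2⟩
      · exact (ih.step hP hc hv hγ hγc hγv hstep).imp_right fun ⟨γ₁, h1, h2⟩ => ⟨_, γ₁, h1, h2⟩
      · obtain ⟨post', γ₃, h3, h4⟩ := h2.step hP hc hstep
        exact Or.inr ⟨post', γ₃, h1.trans h3, h4⟩
  rw [hasControl_augment (hc.trans hs.symm)] at hcon
  rcases key with h1 | ⟨post, γ₁, h1, h2⟩
  -- The control state puts process `0` beyond its preamble, whereas before the signal it is still
  -- among its stores.
  · have h2 := (hcon 0 (hs ▸ hn)).1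
    have h3 := lt_offset (vals := vals) hc hn
    have h4 := h1.pc
    rw [syncLabel, if_pos rfl] at h3
    omega
  · refine ⟨γ₁, h1, fun p hp => ?_⟩
    obtain ⟨h3, h4⟩ := hcon p hp
    have hp' : p < P.procs.length := hs ▸ hp
    rcases h2.proc p hp' with ⟨-, h5⟩ | ⟨hp₀, h5, -⟩
    · obtain ⟨h6, h7⟩ := h5.control (by omega)
      refine ⟨by omega, fun r => ?_⟩
      rw [← h7]
      exact h4 r
    · have h6 := lt_offset (vals := vals) hc hp'
      have h7 := h5.pc
      rw [syncLabel, if_neg hp₀] at h6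
      omega

end Simulation

/-! ### Computability of the augmentation -/

namespace Primrec

/-- Zipping becomes a computation on positions: range over the indices, look both entries up, and
drop the index if one of them is missing. -/
theorem list_zipWith {α β γ σ : Type*} [Primcodable α] [Primcodable β] [Primcodable γ]
    [Primcodable σ] {f : α → List β} {g : α → List γ} {h : α → β → γ → σ} (hf : Primrec f)
    (hg : Primrec g) (hh : Primrec fun x : α × β × γ => h x.1 x.2.1 x.2.2) :
    Primrec fun a => List.zipWith (h a) (f a) (g a) := by
  have key : ∀ (φ : β → γ → σ) (l₁ : List β) (l₂ : List γ), List.zipWith φ l₁ l₂ =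
      (List.range l₁.length).filterMap fun i => l₁[i]?.bind fun b => l₂[i]?.map (φ b) := by
    intro φ l₁
    induction l₁ with
    | nil => intro l₂; rfl
    | cons b l₁ ih =>
      rintro (_ | ⟨d, l₂⟩)
      · simp
      · rw [List.length_cons, List.range_succ_eq_map, List.filterMap_cons, List.filterMap_map]
        simp [ih]
  refine (listFilterMap (f := fun a => List.range (f a).length)
    (g := fun a i => (f a)[i]?.bind fun b => (g a)[i]?.map (h a b))
    (list_range.comp (list_length.comp hf)) ?_).of_eq fun a => (key _ _ _).symm
  refine option_bind (list_getElem?.comp (hf.comp fst) snd) (option_map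
    (list_getElem?.comp (hg.comp (fst.comp fst)) (snd.comp fst)) ?_)
  exact hh.comp (pair (fst.comp (fst.comp fst)) (pair (snd.comp fst) snd))

theorem expr_mk : Primrec₂ Expr.mk :=
  (of_equiv_symm (e := exprEquiv)).comp (pair fst snd)

theorem expr_const : Primrec Expr.const :=
  expr_mk.comp (const _) (list_cons.comp (pair (const _) Primrec.id) (const _))

theorem instr_assign : Primrec₂ Instr.assign :=
  (of_equiv_symm (e := instrEquiv)).comp (sumInl.comp (pair fst snd))

theorem instr_branch : Primrec₂ Instr.branch :=
  (of_equiv_symm (e := instrEquiv)).comp (sumInr.comp (sumInl.comp (pair fst snd)))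

theorem instr_choose : Primrec Instr.choose :=
  (of_equiv_symm (e := instrEquiv)).comp (sumInr.comp (sumInr.comp sumInl))

theorem instr_rmw : Primrec fun x : ℕ × Expr × Expr => Instr.rmw x.1 x.2.1 x.2.2 :=
  (of_equiv_symm (e := instrEquiv)).comp
    (sumInr.comp (sumInr.comp (sumInr.comp (sumInr.comp (sumInr.comp sumInl)))))

theorem sumElim_snd {α β γ σ : Type*} [Primcodable α] [Primcodable β] [Primcodable γ]
    [Primcodable σ] {g : α → β → σ} {h : α → γ → σ} (hg : Primrec fun x : α × β => g x.1 x.2)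
    (hh : Primrec fun x : α × γ => h x.1 x.2) :
    Primrec fun x : α × (β ⊕ γ) => Sum.elim (g x.1) (h x.1) x.2 :=
  (sumCasesOn (f := fun x : α × (β ⊕ γ) => x.2) (g := fun x b => g x.1 b) (h := fun x c => h x.1 c)
    snd (hg.comp (pair (fst.comp fst) snd)) (hh.comp (pair (fst.comp fst) snd))).of_eq fun x => by
      rcases x with ⟨a, b | c⟩ <;> rfl

theorem instr_shift : Primrec₂ Instr.shift := by
  -- Only the second and third summands of the coding are changed by relocation. The types of the
  -- first summand and of the remaining ones can therefore stay abstract.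
  have key : ∀ (α β : Type) [Primcodable α] [Primcodable β],
      Primrec fun x : (ℕ × Instr) × (α ⊕ (Expr × ℕ) ⊕ ℕ ⊕ β) =>
        Sum.elim (fun _ => x.1.2) (Sum.elim (fun z : Expr × ℕ => Instr.branch z.1 (z.2 + x.1.1))
          (Sum.elim (fun t => Instr.choose (t + x.1.1)) fun _ => x.1.2)) x.2 := fun α β _ _ =>
    sumElim_snd (g := fun (y : ℕ × Instr) _ => y.2)
      (h := fun (y : ℕ × Instr) => Sum.elim (fun z : Expr × ℕ => Instr.branch z.1 (z.2 + y.1))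
        (Sum.elim (fun t => Instr.choose (t + y.1)) fun _ => y.2)) (snd.comp fst)
      (sumElim_snd (g := fun (y : ℕ × Instr) (z : Expr × ℕ) => Instr.branch z.1 (z.2 + y.1))
        (h := fun (y : ℕ × Instr) => Sum.elim (fun t => Instr.choose (t + y.1)) fun _ => y.2)
        (instr_branch.comp (fst.comp snd) (nat_add.comp (snd.comp snd) (fst.comp fst)))
        (sumElim_snd (g := fun (y : ℕ × Instr) t => Instr.choose (t + y.1)) (h := fun (y : ℕ × Instr) _ => y.2)
          (instr_choose.comp (nat_add.comp snd (fst.comp fst))) (snd.comp fst)))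
  exact ((key _ _).comp (pair Primrec.id ((of_equiv (e := instrEquiv)).comp snd))).of_eq
    fun ⟨k, i⟩ => by cases i <;> rfl

theorem program_vars : Primrec Program.vars := fst.comp (of_equiv (e := programEquiv))

theorem program_procs : Primrec Program.procs := snd.comp (of_equiv (e := programEquiv))

theorem program_mk : Primrec₂ Program.mk :=
  (of_equiv_symm (e := programEquiv)).comp (pair fst snd)

theorem augment : Primrec₂ Program.augment :=
  program_mk.comp (nat_add.comp (program_vars.comp fst) (fst.comp snd))
    (list_zipWith (snd.comp snd) (program_procs.comp fst)
      (list_append.comp (fst.comp snd) (list_map (snd.comp snd)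
        (instr_shift.comp (list_length.comp (fst.comp (snd.comp fst))) snd))))

theorem controlState_augment : Primrec₂ ControlState.augment :=
  list_zipWith (snd.comp snd) fst
    (pair (nat_add.comp (fst.comp (snd.comp snd)) (list_length.comp (fst.comp snd)))
      (snd.comp (snd.comp snd)))

theorem setupCode : Primrec setupCode :=
  list_map (list_range.comp (succ.comp list_length))
    (instr_assign.comp snd (expr_const.comp ((list_getD 0).comp fst snd)))

theorem preambleCode : Primrec₂ preambleCode :=
  list_append.comp fst (list_append.comp (setupCode.comp (snd.comp snd))
    (list_cons.comp (instr_branch.comp (const _) (nat_add.comp (fst.comp snd)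
      (nat_add.comp (list_length.comp fst) (nat_add.comp (list_length.comp (snd.comp snd))
        (const 2))))) (const [])))

theorem storeCode : Primrec₂ storeCode :=
  list_append.comp
    (list_map (list_range.comp (list_length.comp snd))
      (instr_rmw.comp (pair (const 0) (pair (expr_const.comp snd)
        (expr_const.comp ((list_getD 0).comp (snd.comp fst) snd))))))
    (list_cons.comp (instr_rmw.comp (pair (const 0) (pair (expr_const.comp fst) (const _))))
      (const []))

theorem waitCode : Primrec waitCode :=
  list_cons.comp (instr_rmw.comp (pair (const 0) (pair expr_const (const _)))) (const _)

theorem preamble : Primrec fun x : Program × ControlState × List ℕ => preamble x.1 x.2.1 x.2.2 := by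
  have := pair (const (α := Program × ControlState × List ℕ) 1)
    (list_casesOn (f := fun x : Program × ControlState × List ℕ => x.2.1) (g := fun _ => [])
    (h := fun x y => _root_.preambleCode (_root_.storeCode x.1.vars x.2.2) y.1 ::
      y.2.map (_root_.preambleCode (_root_.waitCode x.1.vars)))
    (fst.comp snd) (const _)
    (list_cons.comp
      (preambleCode.comp (storeCode.comp (program_vars.comp (fst.comp fst)) (snd.comp (snd.comp fst)))
        (fst.comp snd))
      (list_map (snd.comp snd)
        (preambleCode.comp (waitCode.comp (program_vars.comp (fst.comp (fst.comp fst)))) snd))))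
  exact this.of_eq fun x => by
    obtain ⟨P, c₀, vals⟩ := x
    cases c₀ <;> rfl

end Primrec

/-! ### The reduction -/

theorem mainTheorem4 :
    ∃ preamble : Program → ControlState → List ℕ → ℕ × List (List Instr),
      Computable (fun I : Program × ControlState × List ℕ × ControlState =>
        (I.1.augment (preamble I.1 I.2.1 I.2.2.1),
          ControlState.augment I.2.2.2 (preamble I.1 I.2.1 I.2.2.1))) ∧
      ∀ (P : Program) (c₀ : ControlState) (vals : List ℕ),
        P.WellFormed → c₀.length = P.procs.length → vals.length = P.vars →
        (preamble P c₀ vals).2.length = P.procs.length ∧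
        (∀ code ∈ (preamble P c₀ vals).2, ∀ ins ∈ code, ins.IsStrong) ∧
        (P.augment (preamble P c₀ vals)).WellFormed ∧
        ∀ M : Propagation,
          (∃ γ' : Config,
            Relation.ReflTransGen (Step M (P.augment (preamble P c₀ vals)))
              (initial (P.augment (preamble P c₀ vals))) γ' ∧
            γ'.IsPlain (P.augment (preamble P c₀ vals)) ∧
            γ'.HasControl (ControlState.augment c₀ (preamble P c₀ vals)) ∧ γ'.HasValues vals) ∧
          ∀ γ : Config, γ.IsPlain P → γ.HasControl c₀ → γ.HasValues vals →
            ∀ c : ControlState, c.length = P.procs.length →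
              (ControlReachableFrom M P γ c ↔
                ControlReachable M (P.augment (preamble P c₀ vals))
                  (ControlState.augment c (preamble P c₀ vals))) := by
  refine ⟨preamble, ?_, fun P c₀ vals hP hc hv => ⟨(preamble_length ..).trans hc,
    isStrong_of_mem_preamble, wellFormed_augment hP hc hv, fun M =>
      ⟨exists_isPlain_augment hc (List.length_pos_iff.2 hP.1) hv, fun γ hγ hγc hγv s hs =>
        ⟨controlReachable_augment hP hc hv hγ hγc hγv hs,
          controlReachableFrom_of_augment hP hc hv hγ hγc hγv hs⟩⟩⟩⟩
  open Primrec in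
  have hpre : Primrec fun I : Program × ControlState × List ℕ × ControlState =>
      _root_.preamble I.1 I.2.1 I.2.2.1 :=
    Primrec.preamble.comp (pair fst (pair (fst.comp snd) (fst.comp (snd.comp snd))))
  exact (Primrec.pair (Primrec.augment.comp Primrec.fst hpre)
    (Primrec.controlState_augment.comp (Primrec.snd.comp (Primrec.snd.comp Primrec.snd)) hpre)).to_comp
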